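/- Let $d_1,d_2,d'\ge 1$ be integers, $A=\mathbb R^{d'}$, $T>0$, $\epsilon>0$. Assume: (i) $b:\mathbb R^{d_1}\times A\to\mathbb R^{d_1}$ has jointly continuous derivatives $\nabla_x^k\nabla_a^l b$ for $0\le k+l\le 4$, with $|\nabla_x^k\nabla_a^l b(x,a)|\le C(1+|a|^{k+1})(1+|x|^l)$ for some constant $C\ge 0$, and $b(x,0)=0$ for all $x$; (ii) $\ell:A\to\mathbb R$ is convex, of class $\mathcal C^2$, and $\nabla^2\ell(a)\ge c(1+|a|^2)I_{d'}$ for all $a$ and some constant $c>0$; put $\nu^\infty(da)=e^{-\ell(a)}da/\int_A e^{-\ell}$; (iii) $L:\mathbb R^{d_1}\times\mathbb R^{d_2}\to\mathbb R$ is bounded from below and three times differentiable, and for some constant $K$, $|L(x,y)|\le K(1+|x|^2+|y|^2)$ and $|\nabla^jL(x,y)|\le K(1+|x|+|y|)$ for $j=1,2,3$. For $t_0\in[0,T]$ let $\mathcal A(t_0)$ be the set of measurable maps $\boldsymbol\nu:[t_0,T]\to\mathcal P(A)$ with $\int_{t_0}^T\mathcal E(\nu_t|\nu^\infty)\,dt<\infty$,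 where $\mathcal E$ is the relative entropy. For a measure $\nu$ on $A$ write $b(x,\nu)=\int_A b(x,a)\,d\nu(a)$. Let $\mathcal P_p$ be the set of probability measures on $\mathbb R^{d_1}\times\mathbb R^{d_2}$ with finite moment of order $p$. Given $\gamma_0\in\mathcal P_3$ and $\boldsymbol\nu\in\mathcal A(t_0)$, consider the system $$\partial_t\gamma_t+\operatorname{div}_x\bigl(b(x,\nu_t)\gamma_t\bigr)=0,\quad \gamma_{t_0}=\gamma_0;\qquad -\partial_tu_t-b(x,\nu_t)\cdot\nabla_xu_t=0,\quad u_T=L,$$ where $\boldsymbol\gamma$ is continuous from $[t_0,T]$ to $\mathcal P_2$ with the Wasserstein distance $d_2$ and solves the first equation when tested against all functions of $(t,x,y)$ that are $\mathcal C^1$ and bounded together with their first derivatives, and $\boldsymbol u$ is $1/2$-Hölder continuous from $[t_0,T]$ to the space $\mathcal C^1_{2,1}$ of $\mathcal C^1$ functions $\varphi$ with $\|\varphi\|=\sup\frac{|\varphi|}{1+|x|^2+|y|^2}+\sup\frac{|\nabla\varphi|}{1+|x|+|y|}<\infty$ and satisfies $u_t=L+\int_t^Tb(x,\nu_s)\cdot\nabla_xu_s\,ds$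 pointwise. Then there is a nondecreasing function $\Lambda:\mathbb R_+\to\mathbb R_+$, independent of $t_0$, $\gamma_0$ and $\boldsymbol\nu$, such that for all $t_0\in[0,T]$, $\gamma_0\in\mathcal P_3$ and $\boldsymbol\nu\in\mathcal A(t_0)$ the system has a solution, and for every solution $(\boldsymbol\gamma,\boldsymbol u)$ the following holds. For every $t\in[t_0,T]$, $b(\cdot,a)\cdot\nabla_xu_t$ is $\gamma_t$-integrable for all $a\in A$, and the Gibbs probability measure on $A$ $$\Gamma_t[\boldsymbol\nu](da)\ \propto\ \exp\Bigl(-\ell(a)-\frac1\epsilon\int_{\mathbb R^{d_1}\times\mathbb R^{d_2}}b(x,a)\cdot\nabla_xu_t(x,y)\,d\gamma_t(x,y)\Bigr)\,da$$ is well defined. There is a constant $C_{\rm LSI}>0$ such that for all $t\in[t_0,T]$ and all $\mathcal C^1$ functions $f:A\to\mathbb R_+$ with $\int_Af\,d\Gamma_t[\boldsymbol\nu]=1$, $$\int_Af\log f\,d\Gamma_t[\boldsymbol\nu]\le C_{\rm LSI}\int_A|\nabla\log f|^2f\,d\Gamma_t[\boldsymbol\nu]$$ (where both integrands are $0$ at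 the zeros of $f$, and the left-hand integral converges absolutely whenever the right-hand one is finite), and $$C_{\rm LSI}\le\Lambda\Bigl(\int_{\mathbb R^{d_1}\times\mathbb R^{d_2}}(|x|^2+|y|^2)^{3/2}\,d\gamma_0(x,y)+\int_{t_0}^T\int_A|a|^4\,d\nu_t(a)\,dt\Bigr).$$ -/

import Mathlib

open MeasureTheory Set Filter Topology

noncomputable section

namespace MeanFieldResNet

/-- The Euclidean space of dimension `n`. -/
abbrev Eucl (n : ℕ) : Type := EuclideanSpace ℝ (Fin n)

section Assumptions

variable {d₁ d₂ m : ℕ}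

/-- The regularity assumption on the vector field `b`, the potential `ℓ` of the prior measure and
the terminal cost `L`. -/
structure Regularity (b : Eucl d₁ → Eucl m → Eucl d₁) (ℓ : Eucl m → ℝ)
    (L : Eucl d₁ × Eucl d₂ → ℝ) : Prop where
  /-- all mixed derivatives of `b` of total order at most four exist and are jointly continuous -/
  b_contDiff : ContDiff ℝ 4 (Function.uncurry b)
  /-- growth of the mixed derivatives, `k` times in `x` and `l` times in `a` -/
  b_growth : ∃ C : ℝ, 0 ≤ C ∧ ∀ (k l : ℕ), k + l ≤ 4 → ∀ (x : Eucl d₁) (a : Eucl m),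
    ‖iteratedFDeriv ℝ k (fun x' => iteratedFDeriv ℝ l (fun a' => b x' a') a) x‖
      ≤ C * (1 + ‖a‖ ^ (k + 1)) * (1 + ‖x‖ ^ l)
  b_zero : ∀ x, b x 0 = 0
  ell_contDiff : ContDiff ℝ 2 ℓ
  ell_convex : ConvexOn ℝ univ ℓ
  /-- the Hessian of `ℓ` at `a` is at least `c (1 + |a|²)` times the identity -/
  ell_hessian : ∃ c : ℝ, 0 < c ∧ ∀ a h : Eucl m,
    c * (1 + ‖a‖ ^ 2) * ‖h‖ ^ 2 ≤ iteratedFDeriv ℝ 2 ℓ a ![h, h]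
  L_bddBelow : BddBelow (range L)
  /-- `L` is three times differentiable -/
  L_contDiff : ContDiff ℝ 2 L
  L_diff : Differentiable ℝ (iteratedFDeriv ℝ 2 L)
  L_growth : ∃ K : ℝ, ∀ z : Eucl d₁ × Eucl d₂,
    |L z| ≤ K * (1 + ‖z.1‖ ^ 2 + ‖z.2‖ ^ 2) ∧
    ∀ j : ℕ, 1 ≤ j → j ≤ 3 → ‖iteratedFDeriv ℝ j L z‖ ≤ K * (1 + ‖z.1‖ + ‖z.2‖)

end Assumptions

section Controls

variable {m : ℕ}

/-- The prior probability measure, proportional to `exp (-ℓ)`. -/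
def prior (ℓ : Eucl m → ℝ) : Measure (Eucl m) := volume.tilted (fun a => -ℓ a)

/-- Admissible controls: measurable flows of probability measures on `[t₀, T]` whose relative
entropy with respect to the prior measure is integrable in time. The values of `ν` outside
`[t₀, T]` are irrelevant. -/
structure Admissible (ℓ : Eucl m → ℝ) (t₀ T : ℝ) (ν : ℝ → Measure (Eucl m)) : Prop where
  prob : ∀ t ∈ Icc t₀ T, IsProbabilityMeasure (ν t)
  meas : Measurable (fun t : Icc t₀ T => ν t)
  entropy : ∫⁻ t in Icc t₀ T, InformationTheory.klDiv (ν t) (prior ℓ) < ⊤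

/-- The averaged vector field `b(x, ν) = ∫ b(x, a) dν(a)`. -/
def avg {d₁ : ℕ} (b : Eucl d₁ → Eucl m → Eucl d₁) (x : Eucl d₁) (ν : Measure (Eucl m)) :
    Eucl d₁ :=
  ∫ a, b x a ∂ν

end Controls

section Transport

variable {d₁ d₂ m : ℕ}

/-- The function `(|x|² + |y|²)^{p/2}`. -/
def normPow (p : ℝ) (z : Eucl d₁ × Eucl d₂) : ℝ := (‖z.1‖ ^ 2 + ‖z.2‖ ^ 2) ^ (p / 2)

/-- `μ` is a probability measure with a finite moment of order `p`. -/
def IsPp (p : ℝ) (μ : Measure (Eucl d₁ × Eucl d₂)) : Prop :=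
  IsProbabilityMeasure μ ∧ Integrable (normPow p) μ

/-- The square of the Monge-Kantorovich-Rubinstein distance of order two. -/
def transportCost (μ₁ μ₂ : Measure (Eucl d₁ × Eucl d₂)) : ENNReal :=
  ⨅ (π : Measure ((Eucl d₁ × Eucl d₂) × (Eucl d₁ × Eucl d₂)))
    (_ : π.map Prod.fst = μ₁ ∧ π.map Prod.snd = μ₂),
    ∫⁻ q, ENNReal.ofReal (‖q.1.1 - q.2.1‖ ^ 2 + ‖q.1.2 - q.2.2‖ ^ 2) ∂π

/-- The partial gradient with respect to the first variable. -/
def gradX (φ : Eucl d₁ × Eucl d₂ → ℝ) (z : Eucl d₁ × Eucl d₂) : Eucl d₁ :=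
  gradient (fun x => φ (x, z.2)) z.1

/-- Continuously differentiable test functions of `(t, x, y)` that are bounded together with their
first derivatives. -/
def IsTest (φ : ℝ → Eucl d₁ × Eucl d₂ → ℝ) : Prop :=
  ContDiff ℝ 1 (Function.uncurry φ) ∧
    ∃ K : ℝ, ∀ p, |Function.uncurry φ p| ≤ K ∧ ‖fderiv ℝ (Function.uncurry φ) p‖ ≤ K

/-- `γ` is a solution, continuous on `[t₀, T]` with values in the probability measures with finite
second moment, to `∂ₜ γ + div_x (b(x, ν) γ) = 0` with initial condition `γ₀` at time `t₀`. -/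
structure SolvesContinuity (b : Eucl d₁ → Eucl m → Eucl d₁) (t₀ T : ℝ)
    (γ₀ : Measure (Eucl d₁ × Eucl d₂)) (ν : ℝ → Measure (Eucl m))
    (γ : ℝ → Measure (Eucl d₁ × Eucl d₂)) : Prop where
  mem : ∀ t ∈ Icc t₀ T, IsPp 2 (γ t)
  cont : ∀ t ∈ Icc t₀ T,
    Tendsto (fun s => transportCost (γ s) (γ t)) (𝓝[Icc t₀ T] t) (𝓝 0)
  init : γ t₀ = γ₀
  weak : ∀ φ : ℝ → Eucl d₁ × Eucl d₂ → ℝ, IsTest φ → ∀ t₁ ∈ Icc t₀ T,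
    ∫ z, φ t₁ z ∂(γ t₁) = ∫ z, φ t₀ z ∂γ₀ +
      ∫ t in t₀..t₁, ∫ z, (deriv (fun s => φ s z) t
        + inner ℝ (avg b z.1 (ν t)) (gradX (φ t) z)) ∂(γ t)

/-- `φ` is continuously differentiable, has growth at most `K (1 + |x|² + |y|²)` and its gradient
has growth at most `K (1 + |x| + |y|)`: up to a factor two, `φ` has norm at most `K` in the space
of such functions. -/
def HasC121Bound (φ : Eucl d₁ × Eucl d₂ → ℝ) (K : ℝ) : Prop :=
  ContDiff ℝ 1 φ ∧ ∀ z, |φ z| ≤ K * (1 + ‖z.1‖ ^ 2 + ‖z.2‖ ^ 2) ∧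
    ‖fderiv ℝ φ z‖ ≤ K * (1 + ‖z.1‖ + ‖z.2‖)

/-- `u` is a solution to the backward transport equation `-∂ₜ u - b(x, ν) · ∇ₓ u = 0` on `[t₀, T]`
with terminal condition `L`, in the class of curves that are `1/2`-Hölder continuous in time with
values in the `C¹` functions of quadratic growth whose gradient has linear growth. -/
structure SolvesTransport (b : Eucl d₁ → Eucl m → Eucl d₁) (L : Eucl d₁ × Eucl d₂ → ℝ)
    (t₀ T : ℝ) (ν : ℝ → Measure (Eucl m)) (u : ℝ → Eucl d₁ × Eucl d₂ → ℝ) : Prop where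
  mem : ∀ t ∈ Icc t₀ T, ∃ K : ℝ, HasC121Bound (u t) K
  holder : ∃ K : ℝ, ∀ s ∈ Icc t₀ T, ∀ t ∈ Icc t₀ T,
    HasC121Bound (fun z => u t z - u s z) (K * Real.sqrt |t - s|)
  eqn : ∀ t ∈ Icc t₀ T, ∀ z : Eucl d₁ × Eucl d₂,
    u t z = L z + ∫ s in t..T, inner ℝ (avg b z.1 (ν s)) (gradX (u s) z)

/-- The Gibbs measure proportional to `exp (-ℓ(a) - ε⁻¹ ∫ b(x, a) · ∇ₓ v(x, y) dμ(x, y))`. -/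
def gibbs (b : Eucl d₁ → Eucl m → Eucl d₁) (ℓ : Eucl m → ℝ) (ε : ℝ)
    (μ : Measure (Eucl d₁ × Eucl d₂)) (v : Eucl d₁ × Eucl d₂ → ℝ) : Measure (Eucl m) :=
  volume.tilted (fun a => -ℓ a - ε⁻¹ * ∫ z, inner ℝ (b z.1 a) (gradX v z) ∂μ)

end Transport

/-- The log-Sobolev inequality with constant `C`, for nonnegative `C¹` densities `f`. When the
right-hand side is infinite there is nothing to prove; when it is finite, the entropy on the
left-hand side is required to be finite too. -/
def LogSobolev {m : ℕ} (μ : Measure (Eucl m)) (C : ℝ) : Prop :=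
  ∀ f : Eucl m → ℝ, ContDiff ℝ 1 f → (∀ a, 0 ≤ f a) → Integrable f μ → ∫ a, f a ∂μ = 1 →
    Integrable (fun a => ‖gradient (fun a' => Real.log (f a')) a‖ ^ 2 * f a) μ →
    Integrable (fun a => f a * Real.log (f a)) μ ∧
    ∫ a, f a * Real.log (f a) ∂μ
      ≤ C * ∫ a, ‖gradient (fun a' => Real.log (f a')) a‖ ^ 2 * f a ∂μ

end MeanFieldResNet

end

set_option linter.unusedSectionVars false
set_option linter.unusedVariables false

noncomputable section

namespace MeanFieldResNet

/-! ### Absolutely continuous curves and the chain rule along them. -/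

section AbsolutelyContinuousCurves

variable {E : Type*} [NormedAddCommGroup E] [NormedSpace ℝ E]

/-! The Gibbs measure has potential `ℓ + W` with `W(a) = ε⁻¹ ∫ b(x, a) · ∇ₓu_t dγ_t`. The Hessian of
`ℓ` is at least `c (1 + |a|²)`, while that of `W` is formally at most `N (1 + |a|)` with `N = ε⁻¹ C
∫ (1 + |x|²) |∇ₓu_t| dγ_t`. Quadratic growth beats linear growth, so `ℓ + W` is a strongly convex
function plus a bounded one, with quantities that depend on `c` and `N` only
(`integrable_and_logSobolev_tilted`). Strongly log-concave measures satisfy a log-Sobolev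
inequality, and a bounded change of potential preserves it up to an exponential factor. Everything
therefore rests on bounding `N` by the moments of the data (`interaction_le`).

Since the prior density decays at least like `exp (-c |a|⁴ / 12)`, the entropy inequality turns
finite entropy into a time-integrable fourth moment of `ν_t`. The averaged field is then bounded and
Lipschitz in `x` with a kernel integrable in time, and it has a flow that is differentiable in the
initial point. A solution of the transport equation is constant along characteristics, so it equals
`L` composed with the flow (`SolvesTransport.eq_transported`); hence `∇ₓu_t` has linear growth with
an explicit constant. The integrand in `N` is then dominated by the cube of `(1 + |x|² +
|y|²)^{1/2}`, whose integral is propagated along every weak solution of the continuity equation by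
testing with bounded approximations and applying Gronwall (`SolvesContinuity.integral_bracket_le`).
Uniqueness for the continuity equation is not needed.

Existence comes from the same flow: push `γ₀` forward, pull `L` back. The `1/2`-Hölder regularity in
time holds because the field and its first `x`-derivative need only second moments of `ν_t`, while
fourth moments are integrable in time.

The log-Sobolev inequality for strongly convex potentials is derived from the Prékopa-Leindler
inequality (`prekopaLeindler_eucl`), applied to weights `1 - s` and `s` and expanded as `s → 0`.
This is done for functions that are constant outside a compact set; a truncation reaches all
nonnegative `C¹` densities. -/

theorem abs_intervalIntegral_of_nonneg_le {k : ℝ → ℝ} (hk0 : ∀ t, 0 ≤ k t) {s t : ℝ} (h : s ≤ t) :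
    |∫ r in s..t, k r| = ∫ r in s..t, k r :=
  abs_of_nonneg (intervalIntegral.integral_nonneg_of_forall h hk0)

/-- A curve whose increments are infinitesimal with respect to an integrable kernel is constant. -/
theorem eq_of_small_increments {F : ℝ → E} {k : ℝ → ℝ} {a b : ℝ} (hab : a ≤ b)
    (hk : ∀ a b, IntervalIntegrable k volume a b) (hk0 : ∀ t, 0 ≤ k t)
    (h : ∀ t ∈ Icc a b, ∀ ε > 0, ∀ᶠ s in 𝓝[Icc a b] t,
      ‖F s - F t‖ ≤ ε * |∫ r in t..s, k r|) : F b = F a := by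
  have hKc : ∀ t, Continuous fun s => ∫ r in t..s, k r := fun t =>
    intervalIntegral.continuous_primitive hk t
  have hFc : ContinuousOn F (Icc a b) := by
    intro t ht
    rw [ContinuousWithinAt, tendsto_iff_norm_sub_tendsto_zero]
    have h1 : Tendsto (fun s => 1 * |∫ r in t..s, k r|) (𝓝[Icc a b] t) (𝓝 0) := by
      have := (continuous_const.mul (hKc t).abs).tendsto' t 0
        (f := fun s => 1 * |∫ r in t..s, k r|) (by simp)
      exact this.mono_left nhdsWithin_le_nhds
    exact squeeze_zero' (Eventually.of_forall fun _ => norm_nonneg _) (h t ht 1 one_pos) h1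
  have key : ∀ ε > 0, ‖F b - F a‖ ≤ ε * ∫ r in a..b, k r := by
    intro ε hε
    -- Continuous induction along `[a, b]`: the set where the bound holds is closed, and it extends
    -- a little to the right of each of its points. Letting `ε → 0` at the end forces the increment
    -- to vanish.
    have hcl : IsClosed ({s | ‖F s - F a‖ ≤ ε * ∫ r in a..s, k r} ∩ Icc a b) := by
      rw [inter_comm]
      exact isClosed_Icc.isClosed_le (hFc.sub continuousOn_const).norm
        (continuous_const.mul (hKc a)).continuousOn
    refine hcl.Icc_subset_of_forall_exists_gt (by simp) ?_ (right_mem_Icc.2 hab)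
    rintro x ⟨hx, hxI⟩ y hy
    have hx1 : x ∈ Icc a b := ⟨hxI.1, hxI.2.le⟩
    have hev := h x hx1 ε hε
    have hev2 : ∀ᶠ s in 𝓝[>] x, s ∈ Icc a b := by
      filter_upwards [Ioo_mem_nhdsGT hxI.2] with s hs using ⟨hxI.1.trans hs.1.le, hs.2.le⟩
    have hle : 𝓝[>] x ≤ 𝓝[Icc a b] x :=
      le_inf nhdsWithin_le_nhds (le_principal_iff.2 hev2)
    obtain ⟨s, hs, hsx⟩ := ((hev.filter_mono hle).and (Ioc_mem_nhdsGT hy)).exists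
    refine ⟨s, ?_, hsx⟩
    rw [abs_intervalIntegral_of_nonneg_le hk0 hsx.1.le] at hs
    have := intervalIntegral.integral_add_adjacent_intervals (hk a x) (hk x s)
    simp only [mem_ofPred_eq] at hx ⊢
    calc ‖F s - F a‖ = ‖(F s - F x) + (F x - F a)‖ := by congr 1; abel
      _ ≤ _ := norm_add_le _ _
      _ ≤ ε * (∫ r in x..s, k r) + ε * ∫ r in a..x, k r := add_le_add hs hx
      _ = _ := by rw [← this]; ring
  have hlim : Tendsto (fun ε : ℝ => ε * ∫ r in a..b, k r) (𝓝[>] 0) (𝓝 0) := by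
    have : Tendsto (fun ε : ℝ => ε * ∫ r in a..b, k r) (𝓝 0) (𝓝 (0 * ∫ r in a..b, k r)) :=
      tendsto_id.mul_const _
    rw [zero_mul] at this
    exact this.mono_left nhdsWithin_le_nhds
  have := ge_of_tendsto hlim (eventually_nhdsWithin_of_forall fun ε hε => key ε hε)
  exact sub_eq_zero.1 (norm_le_zero_iff.1 this)

theorem norm_intervalIntegral_le_abs {v : ℝ → E} {k : ℝ → ℝ}
    (hk : ∀ a b, IntervalIntegrable k volume a b) {s t : ℝ}
    (hv : ∀ r ∈ uIcc s t, ‖v r‖ ≤ k r) :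
    ‖∫ r in s..t, v r‖ ≤ |∫ r in s..t, k r| := by
  refine intervalIntegral.norm_integral_le_abs_of_norm_le ?_ (hk s t)
  filter_upwards [ae_restrict_mem measurableSet_uIoc] with r hr
  exact hv r (uIoc_subset_uIcc hr)

theorem intervalIntegrable_of_norm_le {v : ℝ → E} {k : ℝ → ℝ}
    (hk : ∀ a b, IntervalIntegrable k volume a b)
    (hvm : AEStronglyMeasurable v volume) (hv : ∀ r, ‖v r‖ ≤ k r) (a b : ℝ) :
    IntervalIntegrable v volume a b := by
  refine (hk a b).mono_fun' hvm.restrict ?_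
  exact Eventually.of_forall hv

theorem aestronglyMeasurable_clm_apply {F : Type*} [NormedAddCommGroup F] [NormedSpace ℝ F]
    {μ : Measure ℝ} {A : ℝ → E →L[ℝ] F} {v : ℝ → E} (hA : AEStronglyMeasurable A μ)
    (hv : AEStronglyMeasurable v μ) : AEStronglyMeasurable (fun r => A r (v r)) μ :=
  (ContinuousLinearMap.id ℝ (E →L[ℝ] F)).aestronglyMeasurable_comp₂ hA hv

/-- The chain rule along an absolutely continuous curve. -/
theorem comp_sub_comp_eq_integral [CompleteSpace E] {φ : E → ℝ} (hφ : ContDiff ℝ 1 φ) {Z v : ℝ → E} {k : ℝ → ℝ}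
    (hk : ∀ a b, IntervalIntegrable k volume a b)
    (hvm : AEStronglyMeasurable v volume) (hv : ∀ r, ‖v r‖ ≤ k r)
    (hZ : ∀ s t, Z t - Z s = ∫ r in s..t, v r) {a b : ℝ} (hab : a ≤ b) :
    IntervalIntegrable (fun r => fderiv ℝ φ (Z r) (v r)) volume a b ∧
    φ (Z b) - φ (Z a) = ∫ r in a..b, fderiv ℝ φ (Z r) (v r) := by
  have hk0 : ∀ t, 0 ≤ k t := fun t => (norm_nonneg _).trans (hv t)
  have hvi := intervalIntegrable_of_norm_le hk hvm hv
  have hZc : Continuous Z := by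
    have : Z = fun t => Z 0 + ∫ r in (0 : ℝ)..t, v r := by
      ext t; rw [← hZ 0 t]; abel
    rw [this]
    exact continuous_const.add (intervalIntegral.continuous_primitive hvi 0)
  have hDc : Continuous fun r => fderiv ℝ φ (Z r) :=
    (hφ.continuous_fderiv one_ne_zero).comp hZc
  have hmeas : AEStronglyMeasurable (fun r => fderiv ℝ φ (Z r) (v r)) volume :=
    aestronglyMeasurable_clm_apply hDc.aestronglyMeasurable hvm
  have hint : ∀ c d, IntervalIntegrable (fun r => fderiv ℝ φ (Z r) (v r)) volume c d := by
    intro c d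
    obtain ⟨M, hM⟩ := (isCompact_uIcc (a := c) (b := d)).exists_bound_of_continuousOn
      hDc.continuousOn
    refine ((hk c d).const_mul M).mono_fun' hmeas.restrict ?_
    filter_upwards [ae_restrict_mem measurableSet_uIoc] with r hr
    calc _ ≤ ‖fderiv ℝ φ (Z r)‖ * ‖v r‖ := ContinuousLinearMap.le_opNorm _ _
      _ ≤ M * k r := mul_le_mul (hM r (uIoc_subset_uIcc hr)) (hv r) (norm_nonneg _)
          ((norm_nonneg _).trans (hM r (uIoc_subset_uIcc hr)))
  refine ⟨hint a b, ?_⟩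
  -- The difference of the two sides has small increments: the first-order remainder of `φ` at `Z t`
  -- and the oscillation of `Dφ` along `Z` each contribute `ε / 2`. Differentiability of `Z` at
  -- individual times is never used.
  have key := eq_of_small_increments
    (F := fun s => φ (Z s) - ∫ r in a..s, fderiv ℝ φ (Z r) (v r)) hab hk hk0 ?_
  · simp only [intervalIntegral.integral_same, sub_zero] at key
    linarith
  intro t ht ε hε
  refine Filter.Eventually.filter_mono nhdsWithin_le_nhds ?_
  have hd := ((hφ.differentiable one_ne_zero) (Z t)).hasFDerivAt
  have h1 : ∀ᶠ s in 𝓝 t, ‖φ (Z s) - φ (Z t) - fderiv ℝ φ (Z t) (Z s - Z t)‖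
      ≤ ε / 2 * ‖Z s - Z t‖ :=
    (hZc.tendsto t).eventually ((hasFDerivAt_iff_isLittleO.1 hd).def (half_pos hε))
  have h2 : ∀ᶠ s in 𝓝 t, ∀ r ∈ uIcc t s, ‖fderiv ℝ φ (Z t) - fderiv ℝ φ (Z r)‖ ≤ ε / 2 := by
    have : ∀ᶠ s in 𝓝 t, dist (fderiv ℝ φ (Z s)) (fderiv ℝ φ (Z t)) < ε / 2 :=
      (hDc.tendsto t) (Metric.ball_mem_nhds _ (half_pos hε))
    obtain ⟨δ, hδ, hδ'⟩ := Metric.eventually_nhds_iff.1 this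
    refine Metric.eventually_nhds_iff.2 ⟨δ, hδ, fun s hs r hr => ?_⟩
    have hr' : dist r t ≤ dist s t := by
      rw [Real.dist_eq, Real.dist_eq]
      exact abs_sub_left_of_mem_uIcc hr
    rw [← dist_eq_norm, dist_comm]
    exact (hδ' (hr'.trans_lt hs)).le
  filter_upwards [h1, h2] with s hs1 hs2
  have e1 : (φ (Z s) - ∫ r in a..s, fderiv ℝ φ (Z r) (v r)) -
      (φ (Z t) - ∫ r in a..t, fderiv ℝ φ (Z r) (v r)) =
      (φ (Z s) - φ (Z t) - fderiv ℝ φ (Z t) (Z s - Z t)) +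
        ∫ r in t..s, (fderiv ℝ φ (Z t) - fderiv ℝ φ (Z r)) (v r) := by
    have e2 : ∫ r in t..s, (fderiv ℝ φ (Z t) - fderiv ℝ φ (Z r)) (v r) =
        fderiv ℝ φ (Z t) (Z s - Z t) - ∫ r in t..s, fderiv ℝ φ (Z r) (v r) := by
      simp only [_root_.sub_apply]
      rw [intervalIntegral.integral_sub ?_ (hint t s), hZ t s,
        ContinuousLinearMap.intervalIntegral_comp_comm _ (hvi t s)]
      refine ((hk t s).const_mul ‖fderiv ℝ φ (Z t)‖).mono_fun'
        (aestronglyMeasurable_clm_apply continuous_const.aestronglyMeasurable hvm).restrict ?_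
      refine Eventually.of_forall fun r => ?_
      exact (ContinuousLinearMap.le_opNorm _ _).trans
        (mul_le_mul_of_nonneg_left (hv r) (norm_nonneg _))
    rw [e2, ← intervalIntegral.integral_add_adjacent_intervals (hint a t) (hint t s)]
    ring
  rw [e1]
  have e3 : ‖Z s - Z t‖ ≤ |∫ r in t..s, k r| := by
    rw [hZ]; exact norm_intervalIntegral_le_abs hk fun r _ => hv r
  have e4 : ‖∫ r in t..s, (fderiv ℝ φ (Z t) - fderiv ℝ φ (Z r)) (v r)‖ ≤
      ε / 2 * |∫ r in t..s, k r| := by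
    have := norm_intervalIntegral_le_abs (v := fun r => (fderiv ℝ φ (Z t) - fderiv ℝ φ (Z r)) (v r))
      (k := fun r => ε / 2 * k r) (fun a b => (hk a b).const_mul _) (s := t) (t := s)
      fun r hr => (ContinuousLinearMap.le_opNorm _ _).trans
        (mul_le_mul (hs2 r hr) (hv r) (norm_nonneg _) (half_pos hε).le)
    rwa [intervalIntegral.integral_const_mul, abs_mul, abs_of_pos (half_pos hε)] at this
  calc _ ≤ _ := norm_add_le _ _
    _ ≤ ε / 2 * |∫ r in t..s, k r| + ε / 2 * |∫ r in t..s, k r| :=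
      add_le_add (hs1.trans (mul_le_mul_of_nonneg_left e3 (half_pos hε).le)) e4
    _ = _ := by ring

end AbsolutelyContinuousCurves

/-! ### Gronwall's lemma with an exponential weight. -/

section Gronwall

/-- The exponential weight attached to a kernel `k` and an initial time `s`. -/
def weight (k : ℝ → ℝ) (s t : ℝ) : ℝ := Real.exp (2 * |∫ r in s..t, k r|)

variable {k : ℝ → ℝ}

theorem one_le_weight (s t : ℝ) : 1 ≤ weight k s t :=
  Real.one_le_exp (by positivity)

theorem weight_pos (s t : ℝ) : 0 < weight k s t := Real.exp_pos _

theorem continuous_weight (hk : ∀ a b, IntervalIntegrable k volume a b) (s : ℝ) :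
    Continuous (weight k s) :=
  Real.continuous_exp.comp
    (continuous_const.mul (intervalIntegral.continuous_primitive hk s).abs)

theorem weight_le (hk : Integrable k) (hk0 : ∀ t, 0 ≤ k t) (s t : ℝ) :
    weight k s t ≤ Real.exp (2 * ∫ r, k r) := by
  refine Real.exp_le_exp.2 (mul_le_mul_of_nonneg_left ?_ two_pos.le)
  rw [← Real.norm_eq_abs, intervalIntegral.norm_intervalIntegral_eq]
  exact (norm_integral_le_integral_norm _).trans ((integral_mono_measure Measure.restrict_le_self
    (Eventually.of_forall fun _ => norm_nonneg _) hk.norm).trans_eq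
      (integral_congr_ae (Eventually.of_forall fun t => by simp [abs_of_nonneg (hk0 t)])))

theorem integral_mul_exp_primitive (hk : ∀ a b, IntervalIntegrable k volume a b)
    (hk0 : ∀ t, 0 ≤ k t) (c d s : ℝ) {a b : ℝ} (hab : a ≤ b) :
    ∫ r in a..b, c * (k r * Real.exp (c * (∫ q in s..r, k q) + d)) =
      Real.exp (c * (∫ q in s..b, k q) + d) - Real.exp (c * (∫ q in s..a, k q) + d) := by
  have hφ : ContDiff ℝ 1 fun x : ℝ => Real.exp (c * x + d) := by fun_prop
  by_cases hkm : AEStronglyMeasurable k volume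
  · have h := (comp_sub_comp_eq_integral (v := k) (k := k) hφ hk hkm
      (fun r => by rw [Real.norm_of_nonneg (hk0 r)])
      (Z := fun t => ∫ q in s..t, k q)
      (fun a b => by
        rw [← intervalIntegral.integral_add_adjacent_intervals (hk s a) (hk a b)]; ring) hab).2
    rw [h]
    congr 1
    ext r
    have : HasDerivAt (fun x : ℝ => Real.exp (c * x + d))
        (Real.exp (c * (∫ q in s..r, k q) + d) * (c * 1)) (∫ q in s..r, k q) :=
      (((hasDerivAt_id _).const_mul c).add_const d).exp
    rw [fderiv_eq_smul_deriv, this.deriv, smul_eq_mul]; ring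
  · exact absurd (by
      refine (locallyIntegrable_iff.2 fun K hK => ?_ : LocallyIntegrable k).aestronglyMeasurable
      obtain ⟨R, hR⟩ := hK.isBounded.subset_closedBall 0
      rw [Real.closedBall_eq_Icc] at hR
      rcases le_or_gt (0 - R) (0 + R) with h | h
      · exact ((intervalIntegrable_iff_integrableOn_Icc_of_le h).1 (hk _ _)).mono_set hR
      · rw [Icc_eq_empty (not_le.2 h)] at hR
        exact integrableOn_empty.mono_set hR) hkm

theorem intervalIntegrable_mul_weight (hk : ∀ a b, IntervalIntegrable k volume a b) (s a b : ℝ) :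
    IntervalIntegrable (fun r => k r * weight k s r) volume a b :=
  (hk a b).mul_continuousOn (continuous_weight hk s).continuousOn

/-- Up to sign, `k * weight` is half the derivative of the weight, because of the factor 2 in the
exponent. The resulting factor `1 / 2` is what makes the Picard map a contraction and the Gronwall
iteration converge. -/
theorem abs_integral_mul_weight_le (hk : ∀ a b, IntervalIntegrable k volume a b)
    (hk0 : ∀ t, 0 ≤ k t) (s t : ℝ) :
    |∫ r in s..t, k r * weight k s r| ≤ weight k s t / 2 := by
  have key : ∀ a b, a ≤ b → ∀ c d : ℝ, |c| = 2 →
      (∀ r ∈ Icc a b, weight k s r = Real.exp (c * (∫ q in s..r, k q) + d)) →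
      |∫ r in a..b, k r * weight k s r| = |weight k s b - weight k s a| / 2 := by
    intro a b hab c d hc hw
    rw [hw b ⟨hab, le_rfl⟩, hw a ⟨le_rfl, hab⟩, ← integral_mul_exp_primitive hk hk0 c d s hab,
      intervalIntegral.integral_const_mul, abs_mul, hc]
    have : ∫ r in a..b, k r * weight k s r =
        ∫ r in a..b, k r * Real.exp (c * (∫ q in s..r, k q) + d) := by
      refine intervalIntegral.integral_congr fun r hr => ?_
      rw [uIcc_of_le hab] at hr
      simp only [hw r hr]
    rw [this]; ring
  have hss : weight k s s = 1 := by simp [weight]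
  rcases le_total s t with h | h
  · rw [key s t h 2 0 (by norm_num) fun r hr => by
      rw [weight, abs_intervalIntegral_of_nonneg_le hk0 hr.1, add_zero], hss,
      abs_of_nonneg (by linarith [one_le_weight (k := k) s t])]
    linarith
  · rw [intervalIntegral.integral_symm, abs_neg,
      key t s h (-2) 0 (by norm_num) fun r hr => by
      rw [weight, intervalIntegral.integral_symm, abs_neg,
        abs_intervalIntegral_of_nonneg_le hk0 hr.2]
      congr 1; ring, hss, abs_sub_comm, abs_of_nonneg (by linarith [one_le_weight (k := k) s t])]
    linarith

/-- A form of Gronwall's lemma for integrable kernels. -/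
theorem gronwall_weight (hk : ∀ a b, IntervalIntegrable k volume a b) (hk0 : ∀ t, 0 ≤ k t)
    {s : ℝ} {I : Set ℝ} {m : ℝ → ℝ} {B m₀ : ℝ} (hB : ∀ t ∈ I, m t ≤ B) (hm₀ : 0 ≤ m₀)
    (h : ∀ S : ℝ, 0 ≤ S → (∀ r ∈ I, m r ≤ S * weight k s r) →
      ∀ t ∈ I, m t ≤ m₀ + S * |∫ r in s..t, k r * weight k s r|) :
    ∀ t ∈ I, m t ≤ 2 * m₀ * weight k s t := by
  -- A bound `S * weight` improves to `(m₀ + S / 2) * weight`, so the excess of `S` over `2 * m₀` is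
  -- halved each time; the a priori bound `B` starts the iteration. As the hypothesis only converts
  -- one bound into another, `m` need not be measurable.
  have step : ∀ n : ℕ, ∀ t ∈ I, m t ≤ (2 * m₀ + |B| / 2 ^ n) * weight k s t := by
    intro n
    induction n with
    | zero =>
      intro t ht
      have h1 := one_le_weight (k := k) s t
      have h2 := hB t ht
      have h3 := le_abs_self B
      have h4 : (0 : ℝ) ≤ 2 * m₀ + |B| := by positivity
      simp only [pow_zero, div_one]
      nlinarith
    | succ n ih =>
      intro t ht
      have h0 : 0 ≤ 2 * m₀ + |B| / 2 ^ n := by positivity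
      have h1 := h _ h0 ih t ht
      have h2 := mul_le_mul_of_nonneg_left (abs_integral_mul_weight_le hk hk0 s t) h0
      have h3 := mul_le_mul_of_nonneg_left (one_le_weight (k := k) s t) hm₀
      calc m t ≤ m₀ * weight k s t + (2 * m₀ + |B| / 2 ^ n) * (weight k s t / 2) := by linarith
        _ = _ := by rw [pow_succ]; field_simp; ring
  intro t ht
  have hlim : Tendsto (fun n : ℕ => (2 * m₀ + |B| / 2 ^ n) * weight k s t) atTop
      (𝓝 ((2 * m₀ + 0) * weight k s t)) := by
    refine (tendsto_const_nhds.add ?_).mul_const _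
    exact tendsto_const_nhds.div_atTop (tendsto_pow_atTop_atTop_of_one_lt one_lt_two)
  rw [add_zero] at hlim
  exact ge_of_tendsto' hlim fun n => step n t ht

end Gronwall

/-! ### Flows of Carathéodory vector fields and their derivative in the initial point. -/

section Flow

variable {E : Type*} [NormedAddCommGroup E] [NormedSpace ℝ E]

/-- Time-dependent vector fields that are Lipschitz in space, with an integrable Lipschitz
constant. -/
structure IsCaratheodory (f : ℝ → E → E) (k : ℝ → ℝ) : Prop where
  meas : ∀ X : ℝ → E, Continuous X → StronglyMeasurable fun t => f t (X t)
  integrable : Integrable k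
  nonneg : ∀ t, 0 ≤ k t
  zero : ∀ t, ‖f t 0‖ ≤ k t
  lip : ∀ t x y, ‖f t x - f t y‖ ≤ k t * ‖x - y‖

/-- `X` is a bounded integral curve of `f`, with value `x` at time `s`. -/
structure IsFlowLine (f : ℝ → E → E) (s : ℝ) (x : E) (X : ℝ → E) : Prop where
  cont : Continuous X
  bdd : ∃ B, ∀ t, ‖X t‖ ≤ B
  eqn : ∀ t, X t = x + ∫ r in s..t, f r (X r)

/-- The total mass of the exponential weight. -/
def totalWeight (k : ℝ → ℝ) : ℝ := Real.exp (2 * ∫ r, k r)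

theorem totalWeight_pos (k : ℝ → ℝ) : 0 < totalWeight k := Real.exp_pos _

variable {f : ℝ → E → E} {k : ℝ → ℝ}

namespace IsCaratheodory

theorem intervalIntegrable (hf : IsCaratheodory f k) (a b : ℝ) : IntervalIntegrable k volume a b :=
  hf.integrable.intervalIntegrable

theorem norm_le (hf : IsCaratheodory f k) (t : ℝ) (x : E) : ‖f t x‖ ≤ k t * (1 + ‖x‖) := by
  have h1 := hf.lip t x 0
  have h2 := hf.zero t
  rw [sub_zero] at h1
  calc ‖f t x‖ = ‖(f t x - f t 0) + f t 0‖ := by rw [sub_add_cancel]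
    _ ≤ _ := norm_add_le _ _
    _ ≤ _ := by linarith

theorem intervalIntegrable_comp (hf : IsCaratheodory f k) {X : ℝ → E} (hX : Continuous X)
    (a b : ℝ) : IntervalIntegrable (fun r => f r (X r)) volume a b := by
  refine ((hf.intervalIntegrable a b).mul_continuousOn
    (g := fun r => 1 + ‖X r‖) (by fun_prop)).mono_fun' (hf.meas X hX).aestronglyMeasurable ?_
  exact Eventually.of_forall fun r => hf.norm_le r _

end IsCaratheodory

theorem abs_intervalIntegral_le_integral (hk : Integrable k) (hk0 : ∀ t, 0 ≤ k t) (s t : ℝ) :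
    |∫ r in s..t, k r| ≤ ∫ r, k r := by
  have := weight_le hk hk0 s t
  rw [weight, Real.exp_le_exp] at this
  linarith

/-- Gronwall's lemma for curves with an affine bound on the velocity. -/
theorem norm_le_of_velocity_bound (hk : Integrable k) (hk0 : ∀ t, 0 ≤ k t) {Z v : ℝ → E}
    {s c : ℝ} {z : E} (hc : 0 ≤ c) (hZ : ∀ t, Z t = z + ∫ r in s..t, v r)
    (hbdd : ∃ B, ∀ t, ‖Z t‖ ≤ B) (hv : ∀ r, ‖v r‖ ≤ k r * ‖Z r‖ + c * k r) (t : ℝ) :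
    ‖Z t‖ ≤ 2 * (‖z‖ + c * ∫ r, k r) * totalWeight k := by
  obtain ⟨B, hB⟩ := hbdd
  have hki : ∀ a b, IntervalIntegrable k volume a b := fun a b => hk.intervalIntegrable
  have hK : 0 ≤ ∫ r, k r := integral_nonneg hk0
  have hm : 0 ≤ ‖z‖ + c * ∫ r, k r := by positivity
  have key := gronwall_weight (s := s) (I := univ) (m := fun t => ‖Z t‖) hki hk0
    (fun t _ => hB t) hm ?_ t (mem_univ t)
  · exact key.trans (mul_le_mul_of_nonneg_left (weight_le hk hk0 s t) (by positivity))
  intro S hS hZS t _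
  have h1 := norm_intervalIntegral_le_abs (v := v) (s := s) (t := t)
    (k := fun r => S * (k r * weight k s r) + c * k r)
    (fun a b => ((intervalIntegrable_mul_weight hki s a b).const_mul S).add
      ((hki a b).const_mul c)) fun r _ => by
    have := mul_le_mul_of_nonneg_left (hZS r (mem_univ r)) (hk0 r)
    refine (hv r).trans ?_
    linarith
  rw [intervalIntegral.integral_add ((intervalIntegrable_mul_weight hki s _ _).const_mul S)
      ((hki _ _).const_mul c), intervalIntegral.integral_const_mul,
      intervalIntegral.integral_const_mul] at h1
  have h2 := abs_add_le (S * ∫ r in s..t, k r * weight k s r) (c * ∫ r in s..t, k r)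
  rw [abs_mul, abs_mul, abs_of_nonneg hS, abs_of_nonneg hc] at h2
  have h3 := mul_le_mul_of_nonneg_left (abs_intervalIntegral_le_integral hk hk0 s t) hc
  simp only [hZ t]
  have h4 := norm_add_le z (∫ r in s..t, v r)
  linarith

variable [CompleteSpace E]

/-- Global existence for Carathéodory ordinary differential equations. -/
theorem IsCaratheodory.exists_isFlowLine (hf : IsCaratheodory f k) (s : ℝ) (x : E) :
    ∃ X, IsFlowLine f s x X := by
  have hki := hf.intervalIntegrable
  set w := weight k s with hw
  have hwc : Continuous w := continuous_weight hki s
  have hw1 : ∀ t, 1 ≤ w t := fun t => one_le_weight s t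
  have hw0 : ∀ t, 0 < w t := fun t => weight_pos s t
  -- The unknown is `Y = X / w`, in the space of bounded continuous functions on the whole line. In
  -- this weighted norm the Picard map contracts by `1 / 2`, so a global solution is obtained at
  -- once, with no gluing of short intervals.
  let curve : BoundedContinuousFunction ℝ E → ℝ → E := fun Y r => w r • Y r
  have hcurve : ∀ Y, Continuous (curve Y) := fun Y => hwc.smul Y.continuous
  let Q : BoundedContinuousFunction ℝ E → ℝ → E := fun Y t =>
    x + ∫ r in s..t, f r (curve Y r)
  have hQc : ∀ Y, Continuous (Q Y) := fun Y => continuous_const.add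
    (intervalIntegral.continuous_primitive (hf.intervalIntegrable_comp (hcurve Y)) s)
  have hQb : ∀ Y t, ‖Q Y t‖ ≤ ‖x‖ + (1 + totalWeight k * ‖Y‖) * ∫ r, k r := by
    intro Y t
    refine (norm_add_le _ _).trans (add_le_add le_rfl ?_)
    have := norm_intervalIntegral_le_abs (v := fun r => f r (curve Y r)) (s := s) (t := t)
      (k := fun r => (1 + totalWeight k * ‖Y‖) * k r) (fun a b => (hki a b).const_mul _)
      fun r _ => by
        refine (hf.norm_le r _).trans ?_
        rw [mul_comm]
        refine mul_le_mul_of_nonneg_right (add_le_add le_rfl ?_) (hf.nonneg r)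
        rw [norm_smul, Real.norm_of_nonneg (hw0 r).le]
        exact mul_le_mul (weight_le hf.integrable hf.nonneg s r) (Y.norm_coe_le_norm r)
          (norm_nonneg _) (totalWeight_pos k).le
    have hpos : 0 ≤ 1 + totalWeight k * ‖Y‖ := by have := totalWeight_pos k; positivity
    rw [intervalIntegral.integral_const_mul, abs_mul, abs_of_nonneg hpos] at this
    exact this.trans (mul_le_mul_of_nonneg_left
      (abs_intervalIntegral_le_integral hf.integrable hf.nonneg s t) hpos)
  let P : BoundedContinuousFunction ℝ E → BoundedContinuousFunction ℝ E := fun Y =>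
    BoundedContinuousFunction.ofNormedAddCommGroup (fun t => (w t)⁻¹ • Q Y t)
      ((hwc.inv₀ fun t => (hw0 t).ne').smul (hQc Y))
      (‖x‖ + (1 + totalWeight k * ‖Y‖) * ∫ r, k r) fun t => by
        rw [norm_smul, norm_inv, Real.norm_of_nonneg (hw0 t).le]
        exact (mul_le_of_le_one_left (norm_nonneg _) (inv_le_one_of_one_le₀ (hw1 t))).trans
          (hQb Y t)
  have hP : ∀ Y t, P Y t = (w t)⁻¹ • Q Y t := fun _ _ => rfl
  have hlip : LipschitzWith (1 / 2) P := by
    refine LipschitzWith.of_dist_le_mul fun Y Y' => ?_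
    refine (BoundedContinuousFunction.dist_le (by positivity)).2 fun t => ?_
    rw [hP, hP, dist_eq_norm, ← smul_sub, norm_smul, norm_inv, Real.norm_of_nonneg (hw0 t).le,
      add_sub_add_left_eq_sub, ← intervalIntegral.integral_sub
        (hf.intervalIntegrable_comp (hcurve Y) _ _) (hf.intervalIntegrable_comp (hcurve Y') _ _)]
    have := norm_intervalIntegral_le_abs
      (v := fun r => f r (curve Y r) - f r (curve Y' r)) (s := s) (t := t)
      (k := fun r => dist Y Y' * (k r * w r))
      (fun a b => (intervalIntegrable_mul_weight hki s a b).const_mul _)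
      fun r _ => by
        refine (hf.lip r _ _).trans ?_
        rw [← smul_sub, norm_smul, Real.norm_of_nonneg (hw0 r).le, ← dist_eq_norm]
        have := mul_le_mul_of_nonneg_left (Y.dist_coe_le_dist (g := Y') r)
          (mul_nonneg (hf.nonneg r) (hw0 r).le)
        linarith
    rw [intervalIntegral.integral_const_mul, abs_mul, abs_of_nonneg dist_nonneg] at this
    have h2 := mul_le_mul_of_nonneg_left (abs_integral_mul_weight_le hki hf.nonneg s t)
      (dist_nonneg (x := Y) (y := Y'))
    calc _ ≤ (w t)⁻¹ * (dist Y Y' * (w t / 2)) :=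
        mul_le_mul_of_nonneg_left (this.trans h2) (inv_nonneg.2 (hw0 t).le)
      _ = _ := by
        have := (hw0 t).ne'
        push_cast
        field_simp
  have hcon : ContractingWith (1 / 2) P := ⟨by
    rw [div_lt_one two_pos]; exact one_lt_two, hlip⟩
  set Y := ContractingWith.fixedPoint P hcon
  have hY : P Y = Y := hcon.fixedPoint_isFixedPt
  have hQY : ∀ t, curve Y t = Q Y t := by
    intro t
    change w t • Y t = _
    conv_lhs => rw [← hY]
    rw [hP, smul_smul, mul_inv_cancel₀ (hw0 t).ne', one_smul]
  exact ⟨curve Y, hcurve Y, ⟨_, fun t => by rw [hQY]; exact hQb Y t⟩, hQY⟩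

/-- The value at time `t` of the integral curve of `f` with value `x` at time `s`. -/
def flow (f : ℝ → E → E) (s : ℝ) (x : E) : ℝ → E :=
  Classical.epsilon fun X => IsFlowLine f s x X

namespace IsCaratheodory

theorem isFlowLine (hf : IsCaratheodory f k) (s : ℝ) (x : E) : IsFlowLine f s x (flow f s x) :=
  Classical.epsilon_spec (hf.exists_isFlowLine s x)

theorem continuous_flow (hf : IsCaratheodory f k) (s : ℝ) (x : E) : Continuous (flow f s x) :=
  (hf.isFlowLine s x).cont

theorem flow_eq (hf : IsCaratheodory f k) (s : ℝ) (x : E) (t : ℝ) :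
    flow f s x t = x + ∫ r in s..t, f r (flow f s x r) :=
  (hf.isFlowLine s x).eqn t

theorem flow_self (hf : IsCaratheodory f k) (s : ℝ) (x : E) : flow f s x s = x := by
  rw [hf.flow_eq]; simp

theorem flow_sub (hf : IsCaratheodory f k) (s : ℝ) (x : E) (a b : ℝ) :
    flow f s x b - flow f s x a = ∫ r in a..b, f r (flow f s x r) := by
  have hi := hf.intervalIntegrable_comp (hf.continuous_flow s x)
  rw [hf.flow_eq s x a, hf.flow_eq s x b,
    ← intervalIntegral.integral_add_adjacent_intervals (hi s a) (hi a b)]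
  abel

/-- The difference of two flow lines has velocity at most `k` times its norm, so Gronwall applies.
The case `x = y` is uniqueness among bounded flow lines. -/
theorem isFlowLine_dist_le (hf : IsCaratheodory f k) {s : ℝ} {x y : E} {X Y : ℝ → E}
    (hX : IsFlowLine f s x X) (hY : IsFlowLine f s y Y) (t : ℝ) :
    ‖X t - Y t‖ ≤ 2 * totalWeight k * ‖x - y‖ := by
  obtain ⟨B, hB⟩ := hX.bdd
  obtain ⟨B', hB'⟩ := hY.bdd
  have := norm_le_of_velocity_bound hf.integrable hf.nonneg (s := s) (c := 0) (z := x - y)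
    (Z := fun t => X t - Y t) (v := fun r => f r (X r) - f r (Y r)) le_rfl (fun t => by
      rw [intervalIntegral.integral_sub (hf.intervalIntegrable_comp hX.cont _ _)
        (hf.intervalIntegrable_comp hY.cont _ _), hX.eqn t, hY.eqn t]
      abel) ⟨B + B', fun t => (norm_sub_le _ _).trans (add_le_add (hB t) (hB' t))⟩
      (fun r => by simpa using hf.lip r _ _) t
  linarith

theorem flow_lipschitz (hf : IsCaratheodory f k) (s : ℝ) (x y : E) (t : ℝ) :
    ‖flow f s x t - flow f s y t‖ ≤ 2 * totalWeight k * ‖x - y‖ :=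
  hf.isFlowLine_dist_le (hf.isFlowLine s x) (hf.isFlowLine s y) t

/-- By uniqueness: both sides are bounded flow lines through the same point at time `r`. -/
theorem flow_flow (hf : IsCaratheodory f k) (s r : ℝ) (x : E) (t : ℝ) :
    flow f r (flow f s x r) t = flow f s x t := by
  have h := hf.isFlowLine_dist_le (hf.isFlowLine r (flow f s x r))
    (⟨hf.continuous_flow s x, (hf.isFlowLine s x).bdd, fun t => by
      rw [← hf.flow_sub]; abel⟩ : IsFlowLine f r (flow f s x r) (flow f s x)) t
  rw [sub_self, norm_zero, mul_zero] at h
  exact sub_eq_zero.1 (norm_le_zero_iff.1 h)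

theorem continuous_flow_right (hf : IsCaratheodory f k) (s t : ℝ) :
    Continuous fun x => flow f s x t := by
  refine LipschitzWith.continuous (K := (2 * totalWeight k).toNNReal)
    (LipschitzWith.of_dist_le_mul fun x y => ?_)
  have := totalWeight_pos k
  rw [Real.coe_toNNReal _ (by positivity), dist_eq_norm, dist_eq_norm]
  exact hf.flow_lipschitz s x y t

/-- The kernel `κ` is allowed to differ from the Lipschitz kernel `k`, so that a bound with better
time integrability can be inserted to obtain Hölder estimates in time. -/
theorem norm_flow_sub_le (hf : IsCaratheodory f k) {κ : ℝ → ℝ}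
    (hκ : ∀ a b, IntervalIntegrable κ volume a b) (hfκ : ∀ t x, ‖f t x‖ ≤ κ t)
    (s : ℝ) (x : E) (a b : ℝ) :
    ‖flow f s x b - flow f s x a‖ ≤ |∫ r in a..b, κ r| := by
  rw [hf.flow_sub]
  exact norm_intervalIntegral_le_abs hκ fun r _ => hfκ r _

end IsCaratheodory

/-- Carathéodory vector fields with a Lipschitz derivative. -/
structure IsSmoothCaratheodory (f : ℝ → E → E) (D : ℝ → E → E →L[ℝ] E) (k : ℝ → ℝ) : Prop
    extends IsCaratheodory f k where
  hasFDerivAt : ∀ t x, HasFDerivAt (f t) (D t x) x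
  deriv_meas : ∀ X : ℝ → E, Continuous X → StronglyMeasurable fun t => D t (X t)
  deriv_bound : ∀ t x, ‖D t x‖ ≤ k t
  deriv_lip : ∀ t x y, ‖D t x - D t y‖ ≤ k t * ‖x - y‖

/-- The derivative of the flow with respect to the initial position. -/
def flowDeriv (f : ℝ → E → E) (D : ℝ → E → E →L[ℝ] E) (s : ℝ) (x : E) : ℝ → E →L[ℝ] E :=
  flow (fun (t : ℝ) (M : E →L[ℝ] E) => (D t (flow f s x t)).comp M) s (ContinuousLinearMap.id ℝ E)

variable {D : ℝ → E → E →L[ℝ] E}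

namespace IsSmoothCaratheodory

/-- The variational equation is itself a Carathéodory equation, in the Banach space of operators and
with the same kernel, so existence and bounds for the derivative of the flow come from the results
above. -/
theorem linearized (hf : IsSmoothCaratheodory f D k) (s : ℝ) (x : E) :
    IsCaratheodory (fun (t : ℝ) (M : E →L[ℝ] E) => (D t (flow f s x t)).comp M) k where
  meas M hM :=
    (show Continuous fun p : (E →L[ℝ] E) × (E →L[ℝ] E) => p.1.comp p.2 from
      continuous_fst.clm_comp continuous_snd).comp_stronglyMeasurable
      ((hf.deriv_meas _ (hf.continuous_flow s x)).prodMk hM.stronglyMeasurable)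
  integrable := hf.integrable
  nonneg := hf.nonneg
  zero t := by simpa using hf.nonneg t
  lip t M N := by
    rw [← ContinuousLinearMap.comp_sub]
    exact (ContinuousLinearMap.opNorm_comp_le _ _).trans
      (mul_le_mul_of_nonneg_right (hf.deriv_bound t _) (norm_nonneg _))

theorem intervalIntegrable_flowDeriv (hf : IsSmoothCaratheodory f D k) (s : ℝ) (x : E) (a b : ℝ) :
    IntervalIntegrable (fun r => (D r (flow f s x r)).comp (flowDeriv f D s x r)) volume a b :=
  (hf.linearized s x).intervalIntegrable_comp ((hf.linearized s x).continuous_flow s _) a b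

theorem flowDeriv_eq (hf : IsSmoothCaratheodory f D k) (s : ℝ) (x : E) (t : ℝ) :
    flowDeriv f D s x t = ContinuousLinearMap.id ℝ E +
      ∫ r in s..t, (D r (flow f s x r)).comp (flowDeriv f D s x r) :=
  (hf.linearized s x).flow_eq s _ t

theorem norm_flowDeriv_le (hf : IsSmoothCaratheodory f D k) (s : ℝ) (x : E) (t : ℝ) :
    ‖flowDeriv f D s x t‖ ≤ 2 * totalWeight k := by
  have := norm_le_of_velocity_bound hf.integrable hf.nonneg (c := 0) le_rfl
    ((hf.linearized s x).flow_eq s (ContinuousLinearMap.id ℝ E))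
    ((hf.linearized s x).isFlowLine s _).bdd
    (fun r => by
      rw [zero_mul, add_zero]
      exact (ContinuousLinearMap.opNorm_comp_le _ _).trans
        (mul_le_mul_of_nonneg_right (hf.deriv_bound r _) (norm_nonneg _))) t
  have h2 : ‖ContinuousLinearMap.id ℝ E‖ ≤ 1 := ContinuousLinearMap.norm_id_le
  have h3 := totalWeight_pos k
  refine this.trans ?_
  nlinarith

theorem norm_flowDeriv_sub_id_le (hf : IsSmoothCaratheodory f D k) {κ : ℝ → ℝ}
    (hκ : ∀ a b, IntervalIntegrable κ volume a b) (hDκ : ∀ t x, ‖D t x‖ ≤ κ t)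
    (s : ℝ) (x : E) (t : ℝ) :
    ‖flowDeriv f D s x t - ContinuousLinearMap.id ℝ E‖
      ≤ 2 * totalWeight k * |∫ r in s..t, κ r| := by
  have h0 := totalWeight_pos k
  rw [hf.flowDeriv_eq, add_sub_cancel_left]
  have := norm_intervalIntegral_le_abs (k := fun r => 2 * totalWeight k * κ r)
    (v := fun r => (D r (flow f s x r)).comp (flowDeriv f D s x r)) (s := s) (t := t)
    (fun a b => (hκ a b).const_mul _) fun r _ => by
      refine (ContinuousLinearMap.opNorm_comp_le _ _).trans ?_
      rw [mul_comm]
      exact mul_le_mul (hf.norm_flowDeriv_le s x r) (hDκ _ _) (norm_nonneg _) (by positivity)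
  rwa [intervalIntegral.integral_const_mul, abs_mul, abs_of_nonneg (by positivity)] at this

/-- The difference of two solutions of the variational equation starts at zero and solves a linear
equation with a source. The source is at most `k * (2 W ‖x - y‖) * (2 W)`, where `W` is the total
weight: Lipschitz dependence of `D` along the flow, times the bound on the derivative. -/
theorem flowDeriv_lipschitz (hf : IsSmoothCaratheodory f D k) (s : ℝ) (x y : E) (t : ℝ) :
    ‖flowDeriv f D s x t - flowDeriv f D s y t‖
      ≤ 8 * totalWeight k ^ 3 * (∫ r, k r) * ‖x - y‖ := by
  have h0 := totalWeight_pos k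
  have hx := hf.linearized s x
  have hy := hf.linearized s y
  obtain ⟨B, hB⟩ := (hx.isFlowLine s (ContinuousLinearMap.id ℝ E)).bdd
  obtain ⟨B', hB'⟩ := (hy.isFlowLine s (ContinuousLinearMap.id ℝ E)).bdd
  have := norm_le_of_velocity_bound hf.integrable hf.nonneg (s := s) (z := (0 : E →L[ℝ] E))
    (c := 4 * totalWeight k ^ 2 * ‖x - y‖)
    (Z := fun t => flowDeriv f D s x t - flowDeriv f D s y t)
    (v := fun r => (D r (flow f s x r)).comp (flowDeriv f D s x r)
      - (D r (flow f s y r)).comp (flowDeriv f D s y r)) (by positivity)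
    (fun t => by
      rw [intervalIntegral.integral_sub
        (hf.intervalIntegrable_flowDeriv s x _ _) (hf.intervalIntegrable_flowDeriv s y _ _),
        hf.flowDeriv_eq s x t, hf.flowDeriv_eq s y t]
      abel)
    ⟨B + B', fun t => (norm_sub_le _ _).trans (add_le_add (hB t) (hB' t))⟩
    (fun r => by
      have e : (D r (flow f s x r)).comp (flowDeriv f D s x r)
          - (D r (flow f s y r)).comp (flowDeriv f D s y r) =
          (D r (flow f s y r)).comp (flowDeriv f D s x r - flowDeriv f D s y r) +
          (D r (flow f s x r) - D r (flow f s y r)).comp (flowDeriv f D s x r) := by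
        rw [ContinuousLinearMap.comp_sub, ContinuousLinearMap.sub_comp]; abel
      rw [e]
      refine (norm_add_le _ _).trans (add_le_add ?_ ?_)
      · exact (ContinuousLinearMap.opNorm_comp_le _ _).trans
          (mul_le_mul_of_nonneg_right (hf.deriv_bound r _) (norm_nonneg _))
      · calc _ ≤ _ := ContinuousLinearMap.opNorm_comp_le _ _
          _ ≤ (k r * (2 * totalWeight k * ‖x - y‖)) * (2 * totalWeight k) := by
            refine mul_le_mul ((hf.deriv_lip r _ _).trans (mul_le_mul_of_nonneg_left
              (hf.flow_lipschitz s x y r) (hf.nonneg r))) (hf.norm_flowDeriv_le s x r)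
              (norm_nonneg _) (mul_nonneg (hf.nonneg r) (by positivity))
          _ = _ := by ring) t
  refine this.trans_eq ?_
  rw [norm_zero]; ring

theorem norm_sub_sub_le (hf : IsSmoothCaratheodory f D k) (t : ℝ) (x y : E) :
    ‖f t y - f t x - D t x (y - x)‖ ≤ k t * ‖y - x‖ * ‖y - x‖ := by
  refine Convex.norm_image_sub_le_of_norm_hasFDerivWithin_le' (s := segment ℝ x y)
    (fun z _ => (hf.hasFDerivAt t z).hasFDerivWithinAt) (fun z hz => ?_) (convex_segment x y)
    (left_mem_segment ℝ x y) (right_mem_segment ℝ x y)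
  refine (hf.deriv_lip t z x).trans (mul_le_mul_of_nonneg_left ?_ (hf.nonneg t))
  obtain ⟨a, ha, rfl⟩ := (segment_eq_image' ℝ x y ▸ hz)
  simp only [add_sub_cancel_left, norm_smul, Real.norm_of_nonneg ha.1]
  exact mul_le_of_le_one_left (norm_nonneg _) ha.2

/-- The first-order remainder starts at zero and solves the linearized equation with a source
quadratic in `‖y - x‖`, which is the Taylor remainder of `f`. By Gronwall the remainder is itself
quadratic. -/
theorem hasFDerivAt_flow (hf : IsSmoothCaratheodory f D k) (s : ℝ) (x : E) (t : ℝ) :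
    HasFDerivAt (fun y => flow f s y t) (flowDeriv f D s x t) x := by
  have h0 := totalWeight_pos k
  have hx := hf.linearized s x
  have hJ := hx.isFlowLine s (ContinuousLinearMap.id ℝ E)
  have key : ∀ y, ‖flow f s y t - flow f s x t - flowDeriv f D s x t (y - x)‖ ≤
      8 * totalWeight k ^ 3 * (∫ r, k r) * ‖y - x‖ ^ 2 := by
    intro y
    obtain ⟨B, hB⟩ := (hf.isFlowLine s x).bdd
    obtain ⟨B', hB'⟩ := (hf.isFlowLine s y).bdd
    obtain ⟨M, hM⟩ := hJ.bdd
    have i1 := hf.intervalIntegrable_comp (hf.continuous_flow s y)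
    have i2 := hf.intervalIntegrable_comp (hf.continuous_flow s x)
    have i3 := hf.intervalIntegrable_flowDeriv s x
    have i4 : ∀ a b, IntervalIntegrable
        (fun r => (D r (flow f s x r)) (flowDeriv f D s x r (y - x))) volume a b :=
      fun a b => intervalIntegrable_iff.2
        ((ContinuousLinearMap.apply ℝ E (y - x)).integrable_comp (intervalIntegrable_iff.1 (i3 a b)))
    have := norm_le_of_velocity_bound hf.integrable hf.nonneg (s := s) (z := (0 : E))
      (c := 4 * totalWeight k ^ 2 * ‖y - x‖ ^ 2)
      (Z := fun t => flow f s y t - flow f s x t - flowDeriv f D s x t (y - x))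
      (v := fun r => f r (flow f s y r) - f r (flow f s x r)
        - (D r (flow f s x r)) (flowDeriv f D s x r (y - x))) (by positivity)
      (fun t => by
        have e : flowDeriv f D s x t (y - x) = (y - x) +
            ∫ r in s..t, (D r (flow f s x r)) (flowDeriv f D s x r (y - x)) := by
          rw [hf.flowDeriv_eq s x t, _root_.add_apply,
            ContinuousLinearMap.intervalIntegral_apply (i3 s t)]
          rfl
        rw [intervalIntegral.integral_sub ((i1 _ _).sub (i2 _ _)) (i4 _ _),
          intervalIntegral.integral_sub (i1 _ _) (i2 _ _), e, hf.flow_eq s x t, hf.flow_eq s y t]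
        abel)
      ⟨B' + B + M * ‖y - x‖, fun t => (norm_sub_le _ _).trans (add_le_add
        ((norm_sub_le _ _).trans (add_le_add (hB' t) (hB t)))
        ((ContinuousLinearMap.le_opNorm _ _).trans
          (mul_le_mul_of_nonneg_right (hM t) (norm_nonneg _))))⟩
      (fun r => by
        have e : f r (flow f s y r) - f r (flow f s x r)
            - (D r (flow f s x r)) (flowDeriv f D s x r (y - x)) =
            D r (flow f s x r) (flow f s y r - flow f s x r - flowDeriv f D s x r (y - x)) +
            (f r (flow f s y r) - f r (flow f s x r)
              - D r (flow f s x r) (flow f s y r - flow f s x r)) := by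
          simp only [map_sub]; abel
        rw [e]
        refine (norm_add_le _ _).trans (add_le_add ?_ ?_)
        · exact (ContinuousLinearMap.le_opNorm _ _).trans
            (mul_le_mul_of_nonneg_right (hf.deriv_bound r _) (norm_nonneg _))
        · refine (hf.norm_sub_sub_le r _ _).trans ?_
          have h1 := hf.flow_lipschitz s y x r
          have h2 := mul_le_mul h1 h1 (norm_nonneg _) (by positivity)
          have h3 := mul_le_mul_of_nonneg_left h2 (hf.nonneg r)
          linarith) t
    refine this.trans_eq ?_
    rw [norm_zero]; ring
  rw [hasFDerivAt_iff_isLittleO]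
  have hO : (fun y => flow f s y t - flow f s x t - flowDeriv f D s x t (y - x)) =O[𝓝 x]
      fun y => ‖y - x‖ ^ 2 :=
    Asymptotics.IsBigO.of_bound _ (Eventually.of_forall fun y => by
      rw [Real.norm_of_nonneg (by positivity : 0 ≤ ‖y - x‖ ^ 2)]; exact key y)
  exact hO.trans_isLittleO (Asymptotics.isLittleO_pow_sub_sub x one_lt_two)

theorem continuous_flowDeriv (hf : IsSmoothCaratheodory f D k) (s t : ℝ) :
    Continuous fun x => flowDeriv f D s x t := by
  have h0 := totalWeight_pos k
  have h1 : 0 ≤ ∫ r, k r := integral_nonneg hf.nonneg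
  refine LipschitzWith.continuous (K := (8 * totalWeight k ^ 3 * (∫ r, k r)).toNNReal)
    (LipschitzWith.of_dist_le_mul fun x y => ?_)
  rw [Real.coe_toNNReal _ (by positivity), dist_eq_norm, dist_eq_norm]
  exact hf.flowDeriv_lipschitz s x y t

theorem flowDeriv_comp (hf : IsSmoothCaratheodory f D k) (s r : ℝ) (x : E) (t : ℝ) :
    flowDeriv f D s x t = (flowDeriv f D r (flow f s x r) t).comp (flowDeriv f D s x r) := by
  have h1 := (hf.hasFDerivAt_flow r (flow f s x r) t).comp x (hf.hasFDerivAt_flow s x r)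
  refine (hf.hasFDerivAt_flow s x t).unique (h1.congr_of_eventuallyEq ?_)
  exact Eventually.of_forall fun y => (hf.flow_flow s r y t).symm

end IsSmoothCaratheodory

end Flow

/-! ### The field averaged against a control, and the kernels that dominate it. -/

section ControlledField

variable {d₁ d₂ m : ℕ}

/-- The consequences of the growth assumption on the derivatives of `b` that are used below. -/
structure FieldBounds (b : Eucl d₁ → Eucl m → Eucl d₁) (C : ℝ) : Prop where
  contDiff : ContDiff ℝ 2 (Function.uncurry b)
  nonneg : 0 ≤ C
  bound : ∀ x a, ‖b x a‖ ≤ C * (1 + ‖a‖)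
  deriv_bound : ∀ x a, ‖fderiv ℝ (fun x' => b x' a) x‖ ≤ C * (1 + ‖a‖ ^ 2)
  deriv_lip : ∀ x y a, ‖fderiv ℝ (fun x' => b x' a) x - fderiv ℝ (fun x' => b x' a) y‖
    ≤ C * (1 + ‖a‖ ^ 3) * ‖x - y‖
  hess_bound : ∀ x a, ‖iteratedFDeriv ℝ 2 (b x) a‖ ≤ C * (1 + ‖a‖) * (1 + ‖x‖ ^ 2)

theorem norm_iteratedFDeriv_iteratedFDeriv_zero (b : Eucl d₁ → Eucl m → Eucl d₁) (k : ℕ)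
    (x : Eucl d₁) (a : Eucl m) :
    ‖iteratedFDeriv ℝ k (fun x' => iteratedFDeriv ℝ 0 (fun a' => b x' a') a) x‖ =
      ‖iteratedFDeriv ℝ k (fun x' => b x' a) x‖ := by
  have : (fun x' => iteratedFDeriv ℝ 0 (fun a' => b x' a') a) =
      (continuousMultilinearCurryFin0 ℝ (Eucl m) (Eucl d₁)).symm ∘ fun x' => b x' a := by
    ext x' : 1
    rw [iteratedFDeriv_zero_eq_comp]
    rfl
  rw [this, LinearIsometryEquiv.norm_iteratedFDeriv_comp_left]

theorem Regularity.exists_fieldBounds {b : Eucl d₁ → Eucl m → Eucl d₁} {ℓ : Eucl m → ℝ}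
    {L : Eucl d₁ × Eucl d₂ → ℝ} (h : Regularity b ℓ L) : ∃ C, FieldBounds b C := by
  obtain ⟨C, hC, hb⟩ := h.b_growth
  have hcd : ContDiff ℝ 2 (Function.uncurry b) := h.b_contDiff.of_le (by norm_num)
  have hsec : ∀ a, ContDiff ℝ 2 fun x' => b x' a := fun a =>
    hcd.comp (contDiff_id.prodMk contDiff_const)
  -- The factor 2 is `1 + ‖x‖ ^ 0`, the growth factor in `x` when no derivative in `a` is taken.
  have h2 : ∀ x a, ‖fderiv ℝ (fderiv ℝ fun x' => b x' a) x‖ ≤ 2 * C * (1 + ‖a‖ ^ 3) := by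
    intro x a
    have := hb 2 0 (by norm_num) x a
    rw [norm_iteratedFDeriv_iteratedFDeriv_zero, ← norm_iteratedFDeriv_fderiv,
      norm_iteratedFDeriv_one] at this
    refine this.trans_eq ?_
    norm_num; ring
  refine ⟨2 * C, hcd, by positivity, fun x a => ?_, fun x a => ?_, fun x y a => ?_, fun x a => ?_⟩
  · have := hb 0 0 (by norm_num) x a
    rw [norm_iteratedFDeriv_iteratedFDeriv_zero, norm_iteratedFDeriv_zero] at this
    refine this.trans_eq ?_
    norm_num; ring
  · have := hb 1 0 (by norm_num) x a
    rw [norm_iteratedFDeriv_iteratedFDeriv_zero, norm_iteratedFDeriv_one] at this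
    refine this.trans_eq ?_
    norm_num; ring
  · exact convex_univ.norm_image_sub_le_of_norm_fderiv_le
      (fun z _ => (((hsec a).fderiv_right (m := 1) (by norm_num)).differentiable one_ne_zero) z)
      (fun z _ => h2 z a) (mem_univ y) (mem_univ x)
  · have := hb 0 2 (by norm_num) x a
    rw [norm_iteratedFDeriv_zero] at this
    refine this.trans ?_
    have h1 : 0 ≤ C * (1 + ‖a‖) * (1 + ‖x‖ ^ 2) := by positivity
    norm_num
    linarith

/-- Measurable flows of subprobability measures with finite moments of order four, which are
integrable in time. -/
structure IsControlFlow (μ : ℝ → Measure (Eucl m)) : Prop where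
  meas : Measurable μ
  mass : ∀ t, μ t univ ≤ 1
  fin : ∀ t, Integrable (fun a => 1 + ‖a‖ ^ 4) (μ t)
  int : Integrable fun t => ∫ a, (1 + ‖a‖ ^ 4) ∂(μ t)

theorem pow_le_one_add_pow_four {r : ℝ} (hr : 0 ≤ r) {j : ℕ} (hj : j ≤ 4) :
    1 + r ^ j ≤ 2 * (1 + r ^ 4) := by
  rcases le_total r 1 with h | h
  · have := pow_le_one₀ (n := j) hr h
    have : 0 ≤ r ^ 4 := by positivity
    linarith
  · have := pow_le_pow_right₀ h hj
    have : 0 ≤ r ^ 4 := by positivity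
    linarith

namespace IsControlFlow

variable {μ : ℝ → Measure (Eucl m)} {F : Type*} [NormedAddCommGroup F] [NormedSpace ℝ F]

theorem isFinite (h : IsControlFlow μ) (t : ℝ) : IsFiniteMeasure (μ t) :=
  ⟨(h.mass t).trans_lt ENNReal.one_lt_top⟩

theorem integrable (h : IsControlFlow μ) {g : Eucl m → F} (hg : Continuous g) {c : ℝ} {j : ℕ}
    (hj : j ≤ 4) (hc : 0 ≤ c) (hgc : ∀ a, ‖g a‖ ≤ c * (1 + ‖a‖ ^ j)) (t : ℝ) :
    Integrable g (μ t) := by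
  refine ((h.fin t).const_mul (c * 2)).mono' hg.aestronglyMeasurable
    (Eventually.of_forall fun a => (hgc a).trans ?_)
  have := mul_le_mul_of_nonneg_left (pow_le_one_add_pow_four (norm_nonneg a) hj) hc
  linarith

theorem norm_integral_le (h : IsControlFlow μ) {g : Eucl m → F} {c : ℝ} {j : ℕ}
    (hj : j ≤ 4) (hc : 0 ≤ c) (hgc : ∀ a, ‖g a‖ ≤ c * (1 + ‖a‖ ^ j)) (t : ℝ) :
    ‖∫ a, g a ∂(μ t)‖ ≤ 2 * c * ∫ a, (1 + ‖a‖ ^ 4) ∂(μ t) := by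
  rw [← integral_const_mul]
  refine norm_integral_le_of_norm_le ((h.fin t).const_mul _)
    (Eventually.of_forall fun a => (hgc a).trans ?_)
  have := mul_le_mul_of_nonneg_left (pow_le_one_add_pow_four (norm_nonneg a) hj) hc
  linarith

theorem stronglyMeasurable_integral (h : IsControlFlow μ) {g : ℝ × Eucl m → F}
    (hg : StronglyMeasurable g) : StronglyMeasurable fun t => ∫ a, g (t, a) ∂(μ t) := by
  let κ : ProbabilityTheory.Kernel ℝ (Eucl m) := ⟨μ, h.meas⟩
  have : ProbabilityTheory.IsFiniteKernel κ := ⟨⟨1, ENNReal.one_lt_top, h.mass⟩⟩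
  exact StronglyMeasurable.integral_kernel_prod_right' (κ := κ) hg

end IsControlFlow

/-- The spatial derivative of the averaged field. -/
def avgDeriv (b : Eucl d₁ → Eucl m → Eucl d₁) (x : Eucl d₁) (ν : Measure (Eucl m)) :
    Eucl d₁ →L[ℝ] Eucl d₁ :=
  ∫ a, fderiv ℝ (fun x' => b x' a) x ∂ν

/-- The kernel that dominates the averaged field and its first two derivatives. -/
def fieldKernel (C : ℝ) (μ : ℝ → Measure (Eucl m)) (t : ℝ) : ℝ :=
  2 * C * ∫ a, (1 + ‖a‖ ^ 4) ∂(μ t)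

/-- A kernel with better integrability that dominates the averaged field and its derivative. -/
def fieldKernelTwo (C : ℝ) (μ : ℝ → Measure (Eucl m)) (t : ℝ) : ℝ :=
  2 * C * ∫ a, (1 + ‖a‖ ^ 2) ∂(μ t)

variable {b : Eucl d₁ → Eucl m → Eucl d₁} {C : ℝ} {μ : ℝ → Measure (Eucl m)}

namespace FieldBounds

theorem continuous_right (hb : FieldBounds b C) (x : Eucl d₁) : Continuous fun a => b x a :=
  hb.contDiff.continuous.comp (by fun_prop : Continuous fun a => (x, a))

theorem differentiable_left (hb : FieldBounds b C) (a : Eucl m) :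
    Differentiable ℝ fun x' => b x' a :=
  (hb.contDiff.comp (contDiff_id.prodMk contDiff_const)).differentiable two_ne_zero

theorem continuous_fderiv (hb : FieldBounds b C) :
    Continuous fun p : Eucl d₁ × Eucl m => fderiv ℝ (fun x' => b x' p.2) p.1 := by
  have : ContDiff ℝ 0 fun p : Eucl d₁ × Eucl m => fderiv ℝ (fun x' => b x' p.2) p.1 := by
    refine ContDiff.fderiv (m := 2) (f := fun (p : Eucl d₁ × Eucl m) x' => b x' p.2) ?_
      contDiff_fst (by norm_num)
    exact hb.contDiff.comp (contDiff_snd.prodMk (contDiff_snd.comp contDiff_fst))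
  exact this.continuous

theorem integrable_avg (hb : FieldBounds b C) (hμ : IsControlFlow μ) (x : Eucl d₁) (t : ℝ) :
    Integrable (b x) (μ t) :=
  hμ.integrable (j := 1) (hb.continuous_right x) (by norm_num) hb.nonneg
    (fun a => by simpa using hb.bound x a) t

theorem integrable_avgDeriv (hb : FieldBounds b C) (hμ : IsControlFlow μ) (x : Eucl d₁) (t : ℝ) :
    Integrable (fun a => fderiv ℝ (fun x' => b x' a) x) (μ t) :=
  hμ.integrable (j := 2) (hb.continuous_fderiv.comp (by fun_prop : Continuous fun a => (x, a)))
    (by norm_num) hb.nonneg (fun a => hb.deriv_bound x a) t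

theorem hasFDerivAt_avg (hb : FieldBounds b C) (hμ : IsControlFlow μ) (t : ℝ) (x : Eucl d₁) :
    HasFDerivAt (fun x' => avg b x' (μ t)) (avgDeriv b x (μ t)) x := by
  refine hasFDerivAt_integral_of_dominated_of_fderiv_le (F := fun x a => b x a)
    (F' := fun x a => fderiv ℝ (fun x' => b x' a) x)
    (bound := fun a => C * (1 + ‖a‖ ^ 2)) univ_mem
    (Eventually.of_forall fun x' => (hb.continuous_right x').aestronglyMeasurable)
    (hb.integrable_avg hμ x t) (hb.integrable_avgDeriv hμ x t).aestronglyMeasurable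
    (Eventually.of_forall fun a y _ => hb.deriv_bound y a) ?_
    (Eventually.of_forall fun a y _ => (hb.differentiable_left a y).hasFDerivAt)
  refine hμ.integrable (j := 2) (c := C) (by fun_prop) (by norm_num) hb.nonneg (fun a => ?_) t
  rw [Real.norm_of_nonneg (mul_nonneg hb.nonneg (by positivity))]

theorem stronglyMeasurable_avg (hb : FieldBounds b C) (hμ : IsControlFlow μ)
    {X : ℝ → Eucl d₁} (hX : Continuous X) : StronglyMeasurable fun t => avg b (X t) (μ t) :=
  hμ.stronglyMeasurable_integral (g := fun p => b (X p.1) p.2)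
    (hb.contDiff.continuous.comp
      (by fun_prop : Continuous fun p : ℝ × Eucl m => (X p.1, p.2))).stronglyMeasurable

theorem norm_avg_le (hb : FieldBounds b C) (hμ : IsControlFlow μ) (t : ℝ) (x : Eucl d₁) :
    ‖avg b x (μ t)‖ ≤ fieldKernel C μ t :=
  hμ.norm_integral_le (j := 1) (by norm_num) hb.nonneg (fun a => by simpa using hb.bound x a) t

theorem norm_avgDeriv_le (hb : FieldBounds b C) (hμ : IsControlFlow μ) (t : ℝ) (x : Eucl d₁) :
    ‖avgDeriv b x (μ t)‖ ≤ fieldKernel C μ t :=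
  hμ.norm_integral_le (j := 2) (by norm_num) hb.nonneg (fun a => hb.deriv_bound x a) t

theorem isSmoothCaratheodory (hb : FieldBounds b C) (hμ : IsControlFlow μ) :
    IsSmoothCaratheodory (fun t x => avg b x (μ t)) (fun t x => avgDeriv b x (μ t))
      (fieldKernel C μ) where
  meas X hX := hb.stronglyMeasurable_avg hμ hX
  integrable := hμ.int.const_mul _
  nonneg t := mul_nonneg (mul_nonneg two_pos.le hb.nonneg)
    (integral_nonneg fun a => by positivity)
  zero t := hb.norm_avg_le hμ t 0
  lip t x y := convex_univ.norm_image_sub_le_of_norm_hasFDerivWithin_le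
      (fun z _ => (hb.hasFDerivAt_avg hμ t z).hasFDerivWithinAt)
      (fun z _ => hb.norm_avgDeriv_le hμ t z) (mem_univ y) (mem_univ x)
  hasFDerivAt t x := hb.hasFDerivAt_avg hμ t x
  deriv_meas X hX := hμ.stronglyMeasurable_integral
    (g := fun p => fderiv ℝ (fun x' => b x' p.2) (X p.1))
    (hb.continuous_fderiv.comp
      (by fun_prop : Continuous fun p : ℝ × Eucl m => (X p.1, p.2))).stronglyMeasurable
  deriv_bound t x := hb.norm_avgDeriv_le hμ t x
  deriv_lip t x y := by
    rw [avgDeriv, avgDeriv,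
      ← integral_sub (hb.integrable_avgDeriv hμ x t) (hb.integrable_avgDeriv hμ y t)]
    refine (hμ.norm_integral_le (j := 3) (c := C * ‖x - y‖) (by norm_num)
      (mul_nonneg hb.nonneg (norm_nonneg _)) (fun a => ?_) t).trans_eq ?_
    · refine (hb.deriv_lip x y a).trans_eq ?_
      ring
    · rw [fieldKernel]; ring

theorem fieldKernelTwo_nonneg (hC : 0 ≤ C) (t : ℝ) : 0 ≤ fieldKernelTwo C μ t :=
  mul_nonneg (by positivity) (integral_nonneg fun a => by positivity)

theorem integrable_one_add_sq (hμ : IsControlFlow μ) (t : ℝ) :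
    Integrable (fun a => 1 + ‖a‖ ^ 2) (μ t) :=
  hμ.integrable (j := 2) (c := 1) (by fun_prop) (by norm_num) zero_le_one
    (fun a => by rw [one_mul, Real.norm_of_nonneg (by positivity)]) t

theorem norm_avg_le_two (hb : FieldBounds b C) (hμ : IsControlFlow μ) (t : ℝ) (x : Eucl d₁) :
    ‖avg b x (μ t)‖ ≤ fieldKernelTwo C μ t := by
  rw [fieldKernelTwo, ← integral_const_mul]
  refine norm_integral_le_of_norm_le ((integrable_one_add_sq hμ t).const_mul _)
    (Eventually.of_forall fun a => (hb.bound x a).trans ?_)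
  have := mul_le_mul_of_nonneg_left
    (by nlinarith [sq_nonneg (‖a‖ - 1 / 2)] : 1 + ‖a‖ ≤ 2 * (1 + ‖a‖ ^ 2)) hb.nonneg
  linarith

theorem norm_avgDeriv_le_two (hb : FieldBounds b C) (hμ : IsControlFlow μ) (t : ℝ)
    (x : Eucl d₁) : ‖avgDeriv b x (μ t)‖ ≤ fieldKernelTwo C μ t := by
  rw [fieldKernelTwo, ← integral_const_mul]
  refine norm_integral_le_of_norm_le ((integrable_one_add_sq hμ t).const_mul _)
    (Eventually.of_forall fun a => (hb.deriv_bound x a).trans ?_)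
  have := mul_nonneg hb.nonneg (by positivity : 0 ≤ 1 + ‖a‖ ^ 2)
  linarith

theorem integrable_fieldKernelTwo (hC : 0 ≤ C) (hμ : IsControlFlow μ) :
    Integrable (fieldKernelTwo C μ) := by
  refine (hμ.int.const_mul (2 * C * 2)).mono' ((hμ.stronglyMeasurable_integral
    (g := fun p => 1 + ‖p.2‖ ^ 2) (by fun_prop)).const_mul _).aestronglyMeasurable
    (Eventually.of_forall fun t => ?_)
  rw [Real.norm_of_nonneg (fieldKernelTwo_nonneg hC t), fieldKernelTwo]
  have h1 : ∫ a, (1 + ‖a‖ ^ 2) ∂(μ t) ≤ ∫ a, 2 * (1 + ‖a‖ ^ 4) ∂(μ t) :=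
    integral_mono (integrable_one_add_sq hμ t) ((hμ.fin t).const_mul _)
      fun a => pow_le_one_add_pow_four (norm_nonneg a) (by norm_num)
  rw [integral_const_mul] at h1
  have h2 := mul_le_mul_of_nonneg_left h1 (by positivity : 0 ≤ 2 * C)
  linarith

/-- The source of the `1/2`-Hölder regularity. With `δ = √(t - s)`, Young's inequality `|a|² ≤ δ⁻¹ +
δ |a|⁴` is integrated over an interval of length `δ²`: the first term contributes `δ`, the second
`δ` times the total fourth moment. -/
theorem integral_fieldKernelTwo_le (hC : 0 ≤ C) (hμ : IsControlFlow μ) {s t : ℝ} (hst : s ≤ t) :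
    ∫ r in s..t, fieldKernelTwo C μ r ≤ 2 * C * Real.sqrt (t - s) *
      (Real.sqrt (t - s) + 1 + ∫ r, ∫ a, (1 + ‖a‖ ^ 4) ∂(μ r)) := by
  rcases hst.eq_or_lt with rfl | hlt
  · simp
  set δ := Real.sqrt (t - s) with hδ
  have hδ0 : 0 < δ := Real.sqrt_pos.2 (by linarith)
  have hδ2 : δ * δ = t - s := Real.mul_self_sqrt (by linarith)
  have hpt : ∀ r, fieldKernelTwo C μ r ≤
      2 * C * ((1 + δ⁻¹) + δ * ∫ a, (1 + ‖a‖ ^ 4) ∂(μ r)) := by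
    intro r
    have := hμ.isFinite r
    refine mul_le_mul_of_nonneg_left ?_ (by positivity)
    have h1 : ∫ a, (1 + ‖a‖ ^ 2) ∂(μ r) ≤
        ∫ a, ((1 + δ⁻¹) + δ * (1 + ‖a‖ ^ 4)) ∂(μ r) := by
      refine integral_mono (integrable_one_add_sq hμ r)
        ((integrable_const _).add ((hμ.fin r).const_mul _)) fun a => ?_
      have h3 : ‖a‖ ^ 2 ≤ δ⁻¹ + δ * ‖a‖ ^ 4 := by
        rw [← sub_nonneg]
        have h4 : δ⁻¹ + δ * ‖a‖ ^ 4 - ‖a‖ ^ 2 = δ⁻¹ * ((1 - δ * ‖a‖ ^ 2) ^ 2 + δ * ‖a‖ ^ 2) := by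
          field_simp; ring
        rw [h4]; positivity
      simp only
      linarith
    rw [integral_add (integrable_const _) ((hμ.fin r).const_mul _), integral_const_mul,
      integral_const, smul_eq_mul] at h1
    have h5 : (μ r).real univ ≤ 1 := ENNReal.toReal_le_of_le_ofReal zero_le_one
      (by simpa using hμ.mass r)
    have h6 := mul_le_mul_of_nonneg_right h5 (by positivity : (0 : ℝ) ≤ 1 + δ⁻¹)
    linarith
  have hNi : ∀ a b, IntervalIntegrable (fun r => ∫ a, (1 + ‖a‖ ^ 4) ∂(μ r)) volume a b :=
    fun _ _ => hμ.int.intervalIntegrable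
  have h1 : ∫ r in s..t, fieldKernelTwo C μ r ≤
      ∫ r in s..t, 2 * C * ((1 + δ⁻¹) + δ * ∫ a, (1 + ‖a‖ ^ 4) ∂(μ r)) :=
    intervalIntegral.integral_mono_on hst (integrable_fieldKernelTwo hC hμ).intervalIntegrable
      ((intervalIntegrable_const.add ((hNi _ _).const_mul _)).const_mul _) fun r _ => hpt r
  rw [intervalIntegral.integral_const_mul, intervalIntegral.integral_add
    intervalIntegrable_const ((hNi _ _).const_mul _), intervalIntegral.integral_const,
    intervalIntegral.integral_const_mul, smul_eq_mul, ← hδ2] at h1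
  have h2 := (le_abs_self _).trans (abs_intervalIntegral_le_integral hμ.int
    (fun r => integral_nonneg fun a => by positivity) s t)
  have h3 := mul_le_mul_of_nonneg_left h2 (by positivity : 0 ≤ 2 * C * δ)
  refine h1.trans ?_
  have h4 : δ * δ * (1 + δ⁻¹) = δ * (δ + 1) := by field_simp
  rw [h4]
  linarith

end FieldBounds

end ControlledField

/-! ### The partial gradient in the first variable. -/

section PartialGradient

variable {d₁ d₂ : ℕ}

theorem hasFDerivAt_section_left {φ : Eucl d₁ × Eucl d₂ → ℝ} {z : Eucl d₁ × Eucl d₂}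
    (h : DifferentiableAt ℝ φ z) :
    HasFDerivAt (fun x => φ (x, z.2)) ((fderiv ℝ φ z).comp (ContinuousLinearMap.inl ℝ _ _)) z.1 :=
  HasFDerivAt.comp z.1 (g := φ) (f := fun x => (x, z.2)) h.hasFDerivAt
    (hasFDerivAt_prodMk_left z.1 z.2)

theorem gradX_eq {φ : Eucl d₁ × Eucl d₂ → ℝ} {z : Eucl d₁ × Eucl d₂}
    (h : DifferentiableAt ℝ φ z) :
    gradX φ z = (InnerProductSpace.toDual ℝ (Eucl d₁)).symm
      ((fderiv ℝ φ z).comp (ContinuousLinearMap.inl ℝ _ _)) := by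
  rw [gradX, gradient, (hasFDerivAt_section_left h).fderiv]

theorem inner_gradX {φ : Eucl d₁ × Eucl d₂ → ℝ} {z : Eucl d₁ × Eucl d₂}
    (h : DifferentiableAt ℝ φ z) (v : Eucl d₁) :
    inner ℝ v (gradX φ z) = fderiv ℝ φ z (v, 0) := by
  rw [gradX_eq h, real_inner_comm, InnerProductSpace.toDual_symm_apply]
  rfl

theorem norm_gradX_le {φ : Eucl d₁ × Eucl d₂ → ℝ} {z : Eucl d₁ × Eucl d₂}
    (h : DifferentiableAt ℝ φ z) : ‖gradX φ z‖ ≤ ‖fderiv ℝ φ z‖ := by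
  rw [gradX_eq h, LinearIsometryEquiv.norm_map]
  refine ContinuousLinearMap.opNorm_le_bound _ (norm_nonneg _) fun v => ?_
  exact ((fderiv ℝ φ z).le_opNorm (v, 0)).trans_eq (by simp)

theorem gradX_sub {φ ψ : Eucl d₁ × Eucl d₂ → ℝ} {z : Eucl d₁ × Eucl d₂}
    (h : DifferentiableAt ℝ φ z) (h' : DifferentiableAt ℝ ψ z) :
    gradX φ z - gradX ψ z = gradX (fun w => φ w - ψ w) z := by
  rw [gradX_eq h, gradX_eq h', gradX_eq (h.fun_sub h'), ← map_sub, fderiv_fun_sub h h',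
    ContinuousLinearMap.sub_comp]

theorem continuous_gradX {φ : Eucl d₁ × Eucl d₂ → ℝ} (h : ContDiff ℝ 1 φ) :
    Continuous (gradX φ) := by
  have : gradX φ = fun z => (InnerProductSpace.toDual ℝ (Eucl d₁)).symm
      ((fderiv ℝ φ z).comp (ContinuousLinearMap.inl ℝ _ _)) := by
    ext1 z; exact gradX_eq (h.differentiable one_ne_zero z)
  rw [this]
  exact (LinearIsometryEquiv.continuous _).comp
    ((h.continuous_fderiv one_ne_zero).clm_comp continuous_const)

theorem hasFDerivAt_inner_gradX {φ : Eucl d₁ × Eucl d₂ → ℝ} {x : Eucl d₁} {y : Eucl d₂}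
    (h : DifferentiableAt ℝ φ (x, y)) {ε : ℝ} (hε : 0 < ε) :
    ∀ᶠ x' in 𝓝 x, |φ (x', y) - φ (x, y) - inner ℝ (x' - x) (gradX φ (x, y))| ≤ ε * ‖x' - x‖ := by
  have := (hasFDerivAt_iff_isLittleO.1 (hasFDerivAt_section_left h)).def hε
  filter_upwards [this] with x' hx'
  rw [inner_gradX h]
  exact hx'

theorem abs_inner_sub_inner_le {E : Type*} [NormedAddCommGroup E] [InnerProductSpace ℝ E]
    (v w g h : E) : |inner ℝ v g - inner ℝ w h| ≤ ‖v - w‖ * ‖h‖ + ‖v‖ * ‖g - h‖ := by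
  have : inner ℝ v g - inner ℝ w h = inner ℝ (v - w) h + inner ℝ v (g - h) := by
    rw [inner_sub_left, inner_sub_right]; ring
  rw [this]
  exact (abs_add_le _ _).trans
    (add_le_add (abs_real_inner_le_norm _ _) (abs_real_inner_le_norm _ _))

end PartialGradient

/-! ### Hölder curves of functions and joint continuity of their gradients. -/

section HolderCurves

variable {d₁ d₂ : ℕ} {u : ℝ → Eucl d₁ × Eucl d₂ → ℝ} {t₀ T : ℝ}

/-- Curves that are `1/2`-Hölder continuous with values in `C¹` functions of quadratic growth. -/
structure IsHolderCurve (t₀ T : ℝ) (u : ℝ → Eucl d₁ × Eucl d₂ → ℝ) : Prop where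
  mem : ∀ t ∈ Icc t₀ T, ∃ K : ℝ, HasC121Bound (u t) K
  holder : ∃ K : ℝ, ∀ s ∈ Icc t₀ T, ∀ t ∈ Icc t₀ T,
    HasC121Bound (fun z => u t z - u s z) (K * Real.sqrt |t - s|)

namespace IsHolderCurve

theorem contDiff (hu : IsHolderCurve t₀ T u) {t : ℝ} (ht : t ∈ Icc t₀ T) : ContDiff ℝ 1 (u t) :=
  (hu.mem t ht).choose_spec.1

theorem differentiableAt (hu : IsHolderCurve t₀ T u) {t : ℝ} (ht : t ∈ Icc t₀ T)
    (z : Eucl d₁ × Eucl d₂) : DifferentiableAt ℝ (u t) z :=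
  (hu.contDiff ht).differentiable one_ne_zero z

theorem exists_norm_gradX_sub_le (hu : IsHolderCurve t₀ T u) :
    ∃ K, 0 ≤ K ∧ ∀ s ∈ Icc t₀ T, ∀ t ∈ Icc t₀ T, ∀ z : Eucl d₁ × Eucl d₂,
      ‖gradX (u t) z - gradX (u s) z‖ ≤ K * Real.sqrt |t - s| * (1 + ‖z.1‖ + ‖z.2‖) := by
  obtain ⟨K, hK⟩ := hu.holder
  refine ⟨|K|, abs_nonneg _, fun s hs t ht z => ?_⟩
  rw [gradX_sub (hu.differentiableAt ht z) (hu.differentiableAt hs z)]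
  have h1 := hK s hs t ht
  refine (norm_gradX_le (h1.1.differentiable one_ne_zero z)).trans ((h1.2 z).2.trans ?_)
  exact mul_le_mul_of_nonneg_right
    (mul_le_mul_of_nonneg_right (le_abs_self K) (Real.sqrt_nonneg _)) (by positivity)

/-- The Hölder modulus in time is locally uniform in space, so continuity of the gradient at the
fixed time `t` suffices for joint convergence. -/
theorem tendsto_gradX (hu : IsHolderCurve t₀ T u) {t : ℝ} (ht : t ∈ Icc t₀ T)
    (z : Eucl d₁ × Eucl d₂) :
    Tendsto (fun p : ℝ × (Eucl d₁ × Eucl d₂) => gradX (u p.1) p.2)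
      (𝓝[Icc t₀ T] t ×ˢ 𝓝 z) (𝓝 (gradX (u t) z)) := by
  obtain ⟨K, hK0, hK⟩ := hu.exists_norm_gradX_sub_le
  rw [tendsto_iff_norm_sub_tendsto_zero]
  have hb : Tendsto (fun p : ℝ × (Eucl d₁ × Eucl d₂) =>
      K * Real.sqrt |p.1 - t| * (1 + ‖p.2.1‖ + ‖p.2.2‖) + ‖gradX (u t) p.2 - gradX (u t) z‖)
      (𝓝 t ×ˢ 𝓝 z) (𝓝 0) := by
    have hc : Continuous (fun p : ℝ × (Eucl d₁ × Eucl d₂) =>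
      K * Real.sqrt |p.1 - t| * (1 + ‖p.2.1‖ + ‖p.2.2‖) + ‖gradX (u t) p.2 - gradX (u t) z‖) := by
      have := continuous_gradX (hu.contDiff ht)
      fun_prop
    rw [← nhds_prod_eq]
    exact hc.tendsto' _ _ (by simp)
  refine squeeze_zero' (Eventually.of_forall fun _ => norm_nonneg _) ?_
    (hb.mono_left (prod_mono nhdsWithin_le_nhds le_rfl))
  filter_upwards [prod_mem_prod self_mem_nhdsWithin univ_mem] with p hp
  have h1 := hK t ht p.1 hp.1 p.2
  calc _ = ‖(gradX (u p.1) p.2 - gradX (u t) p.2) + (gradX (u t) p.2 - gradX (u t) z)‖ := by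
        rw [sub_add_sub_cancel]
    _ ≤ _ := (norm_add_le _ _).trans (add_le_add h1 le_rfl)

theorem continuousOn_gradX (hu : IsHolderCurve t₀ T u) (z : Eucl d₁ × Eucl d₂) :
    ContinuousOn (fun t => gradX (u t) z) (Icc t₀ T) := fun _ ht =>
  (hu.tendsto_gradX ht z).comp (tendsto_id.prodMk tendsto_const_nhds)

end IsHolderCurve

theorem SolvesTransport.isHolderCurve {m : ℕ} {b : Eucl d₁ → Eucl m → Eucl d₁}
    {L : Eucl d₁ × Eucl d₂ → ℝ} {ν : ℝ → Measure (Eucl m)} (h : SolvesTransport b L t₀ T ν u) :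
    IsHolderCurve t₀ T u := ⟨h.mem, h.holder⟩

end HolderCurves

/-! ### Constancy of solutions of the transport equation along characteristics. -/

section Characteristics

variable {d₁ d₂ : ℕ} {f : ℝ → Eucl d₁ → Eucl d₁} {k : ℝ → ℝ}
  {u : ℝ → Eucl d₁ × Eucl d₂ → ℝ} {t₀ T : ℝ}

theorem IsCaratheodory.intervalIntegrable_inner_gradX (hf : IsCaratheodory f k)
    (hu : IsHolderCurve t₀ T u) (z : Eucl d₁ × Eucl d₂) {s t : ℝ} (hs : s ∈ Icc t₀ T)
    (ht : t ∈ Icc t₀ T) :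
    IntervalIntegrable (fun r => inner ℝ (f r z.1) (gradX (u r) z)) volume s t := by
  have hsub : uIcc s t ⊆ Icc t₀ T := uIcc_subset_Icc hs ht
  obtain ⟨M, hM⟩ := isCompact_Icc.exists_bound_of_continuousOn (hu.continuousOn_gradX z)
  have hfm := (hf.meas (fun _ => z.1) continuous_const).aestronglyMeasurable (μ := volume)
  have hgm : AEStronglyMeasurable (fun r => gradX (u r) z) (volume.restrict (uIoc s t)) :=
    ((hu.continuousOn_gradX z).mono (uIoc_subset_uIcc.trans hsub)).aestronglyMeasurable
      measurableSet_uIoc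
  refine (((hf.intervalIntegrable s t).mul_const (1 + ‖z.1‖)).mul_const M).mono_fun'
    (hfm.restrict.inner hgm) ?_
  filter_upwards [ae_restrict_mem measurableSet_uIoc] with r hr
  have h1 := hM r (hsub (uIoc_subset_uIcc hr))
  exact (abs_real_inner_le_norm _ _).trans (mul_le_mul (hf.norm_le r _) h1 (norm_nonneg _)
    (mul_nonneg (hf.nonneg r) (by positivity)))

/-- The values at times close to `t` of a kernel primitive and of other quantities that tend to
zero control increments. -/
theorem IsCaratheodory.eventually_abs_integral_lt (hf : IsCaratheodory f k) (t : ℝ) {δ : ℝ}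
    (hδ : 0 < δ) : ∀ᶠ s in 𝓝 t, |∫ r in t..s, k r| < δ := by
  have : Tendsto (fun s => |∫ r in t..s, k r|) (𝓝 t) (𝓝 0) :=
    ((intervalIntegral.continuous_primitive hf.intervalIntegrable t).abs).tendsto' _ _ (by simp)
  exact this.eventually_lt_const hδ

theorem eventually_forall_uIcc {p : ℝ → Prop} {I : Set ℝ} (hI : OrdConnected I) {t : ℝ}
    (ht : t ∈ I) (h : ∀ᶠ s in 𝓝[I] t, p s) : ∀ᶠ s in 𝓝[I] t, ∀ r ∈ uIcc t s, p r := by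
  obtain ⟨δ, hδ, hδ'⟩ := Metric.mem_nhdsWithin_iff.1 h
  filter_upwards [inter_mem_nhdsWithin I (Metric.ball_mem_nhds t hδ)] with s hs r hr
  refine hδ' ⟨?_, hI.uIcc_subset ht hs.1 hr⟩
  rw [Metric.mem_ball, Real.dist_eq]
  exact (abs_sub_left_of_mem_uIcc hr).trans_lt hs.2

/-- A solution of the transport equation is constant along the characteristics. -/
theorem IsCaratheodory.eq_comp_flow (hf : IsCaratheodory f k) (hu : IsHolderCurve t₀ T u)
    (heq : ∀ s ∈ Icc t₀ T, ∀ t ∈ Icc t₀ T, ∀ z : Eucl d₁ × Eucl d₂,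
      u s z - u t z = ∫ r in s..t, inner ℝ (f r z.1) (gradX (u r) z))
    {t : ℝ} (ht : t ∈ Icc t₀ T) (x : Eucl d₁) (y : Eucl d₂) :
    u T (flow f t x T, y) = u t (x, y) := by
  set X := flow f t x with hX
  have hXc : Continuous X := hf.continuous_flow t x
  obtain ⟨B, hB⟩ := (hf.isFlowLine t x).bdd
  have hB0 : 0 ≤ B := (norm_nonneg _).trans (hB 0)
  have hkB : ∀ a b, IntervalIntegrable (fun r => (1 + B) * k r) volume a b :=
    fun a b => (hf.intervalIntegrable a b).const_mul _
  have hfB : ∀ r s, ‖f r (X s)‖ ≤ (1 + B) * k r := fun r s =>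
    (hf.norm_le r _).trans (by
      rw [mul_comm]
      exact mul_le_mul_of_nonneg_right (add_le_add le_rfl (hB s)) (hf.nonneg r))
  -- The increment splits into a space increment at the frozen time `τ` and a time increment, given
  -- by the equation, at the frozen point `X s`. To leading order they are opposite integrals of `f
  -- · G`, where `G` is the gradient at the base point. Of the three portions `η = ε / 3`, one pays
  -- for the Taylor remainder and two for freezing the integrand.
  have key := eq_of_small_increments (F := fun s => u s (X s, y)) (k := fun r => (1 + B) * k r)
    ht.2 hkB (fun r => mul_nonneg (by positivity) (hf.nonneg r)) ?_
  · simpa [hX, hf.flow_self] using key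
  intro τ hτ ε hε
  have hτ' : τ ∈ Icc t₀ T := ⟨ht.1.trans hτ.1, hτ.2⟩
  set G := gradX (u τ) (X τ, y) with hG
  set η := ε / 3 with hη
  have hη0 : 0 < η := by positivity
  have hδ : 0 < η / (‖G‖ + 1) := by positivity
  refine Filter.Eventually.filter_mono (nhdsWithin_mono τ (Icc_subset_Icc ht.1 le_rfl)) ?_
  have e1 : ∀ᶠ s in 𝓝[Icc t₀ T] τ, |u τ (X s, y) - u τ (X τ, y) - inner ℝ (X s - X τ) G|
      ≤ η * ‖X s - X τ‖ :=
    (hXc.tendsto τ).eventually (hasFDerivAt_inner_gradX (hu.differentiableAt hτ' _) hη0)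
      |>.filter_mono nhdsWithin_le_nhds
  have e2 : ∀ᶠ s in 𝓝[Icc t₀ T] τ, ∀ r ∈ uIcc τ s, ‖X r - X τ‖ < η / (‖G‖ + 1) / 2 := by
    refine eventually_forall_uIcc ordConnected_Icc hτ' ?_
    have := (hXc.tendsto τ).eventually (Metric.ball_mem_nhds _ (half_pos hδ))
    simp only [dist_eq_norm] at this
    exact this.filter_mono nhdsWithin_le_nhds
  have e3 : ∀ᶠ s in 𝓝[Icc t₀ T] τ, ∀ r ∈ uIcc τ s, ‖gradX (u r) (X s, y) - G‖ < η := by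
    have h1 : ∀ᶠ p in 𝓝[Icc t₀ T] τ ×ˢ 𝓝 (X τ, y), ‖gradX (u p.1) p.2 - G‖ < η := by
      have := (hu.tendsto_gradX hτ' (X τ, y)).eventually (Metric.ball_mem_nhds _ hη0)
      simpa only [Metric.mem_ball, dist_eq_norm] using this
    obtain ⟨p, hp, q, hq, hpq⟩ := eventually_prod_iff.1 h1
    have h2 := eventually_forall_uIcc ordConnected_Icc hτ' hp
    have h3 : ∀ᶠ s in 𝓝[Icc t₀ T] τ, q (X s, y) :=
      ((hXc.prodMk continuous_const).tendsto τ).eventually hq |>.filter_mono nhdsWithin_le_nhds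
    filter_upwards [h2, h3] with s hs1 hs2 r hr using hpq (hs1 r hr) hs2
  filter_upwards [e1, e2, e3, self_mem_nhdsWithin] with s h1 h2 h3 hs
  have hXs : X s - X τ = ∫ r in τ..s, f r (X r) := hf.flow_sub t x τ s
  have iX := hf.intervalIntegrable_comp hXc
  have i1 : IntervalIntegrable (fun r => inner ℝ (f r (X r)) G) volume τ s := by
    have := intervalIntegrable_iff.2
      ((innerSL ℝ G).integrable_comp (intervalIntegrable_iff.1 (iX τ s)))
    refine this.congr fun r _ => ?_
    rw [innerSL_apply_apply, real_inner_comm]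
  have i2 := hf.intervalIntegrable_inner_gradX hu (X s, y) hτ' hs
  have hin : inner ℝ (X s - X τ) G = ∫ r in τ..s, inner ℝ (f r (X r)) G := by
    rw [hXs, real_inner_comm, ← innerSL_apply_apply ℝ,
      ← ContinuousLinearMap.intervalIntegral_comp_comm _ (iX τ s)]
    refine intervalIntegral.integral_congr fun r _ => ?_
    rw [innerSL_apply_apply, real_inner_comm]
  have hdec : u s (X s, y) - u τ (X τ, y) =
      (u τ (X s, y) - u τ (X τ, y) - inner ℝ (X s - X τ) G) -
      ∫ r in τ..s, (inner ℝ (f r (X s)) (gradX (u r) (X s, y)) - inner ℝ (f r (X r)) G) := by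
    rw [intervalIntegral.integral_sub i2 i1, ← hin, ← heq τ hτ' s hs]
    ring
  have hX1 : ‖X s - X τ‖ ≤ |∫ r in τ..s, (1 + B) * k r| := by
    rw [hXs]; exact norm_intervalIntegral_le_abs hkB fun r _ => hfB r r
  have hI : ‖∫ r in τ..s, (inner ℝ (f r (X s)) (gradX (u r) (X s, y)) - inner ℝ (f r (X r)) G)‖
      ≤ |∫ r in τ..s, 2 * η * ((1 + B) * k r)| := by
    refine norm_intervalIntegral_le_abs (fun a b => (hkB a b).const_mul _) fun r hr => ?_
    refine (abs_inner_sub_inner_le _ _ _ _).trans ?_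
    have h4 : ‖X s - X r‖ ≤ η / (‖G‖ + 1) := by
      have h5 := h2 r hr
      have h6 := h2 s right_mem_uIcc
      have h7 := norm_sub_le (X s - X τ) (X r - X τ)
      rw [sub_sub_sub_cancel_right] at h7
      linarith
    have h5 : ‖f r (X s) - f r (X r)‖ * ‖G‖ ≤ η * k r := by
      calc _ ≤ k r * (η / (‖G‖ + 1)) * ‖G‖ := mul_le_mul_of_nonneg_right
            ((hf.lip r _ _).trans (mul_le_mul_of_nonneg_left h4 (hf.nonneg r))) (norm_nonneg _)
        _ = (η * k r) * (‖G‖ / (‖G‖ + 1)) := by ring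
        _ ≤ (η * k r) * 1 := mul_le_mul_of_nonneg_left
            (by rw [div_le_one (by positivity)]; linarith) (mul_nonneg hη0.le (hf.nonneg r))
        _ = _ := mul_one _
    have h6 := mul_le_mul (hfB r s) (h3 r hr).le (norm_nonneg _)
      (mul_nonneg (by positivity) (hf.nonneg r))
    have h7 := mul_nonneg (mul_nonneg hη0.le (hf.nonneg r)) hB0
    linarith
  rw [intervalIntegral.integral_const_mul, abs_mul, abs_of_pos (by positivity)] at hI
  rw [hdec]
  refine (norm_sub_le _ _).trans ?_
  have h8 := h1.trans (mul_le_mul_of_nonneg_left hX1 hη0.le)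
  rw [← Real.norm_eq_abs] at h8
  have : ε = 3 * η := by rw [hη]; ring
  rw [this]
  linarith

end Characteristics

/-! ### The terminal cost carried backward by the flow. -/

section TransportedCost

variable {d₁ d₂ : ℕ} {f : ℝ → Eucl d₁ → Eucl d₁} {D : ℝ → Eucl d₁ → Eucl d₁ →L[ℝ] Eucl d₁}
  {k : ℝ → ℝ} {L : Eucl d₁ × Eucl d₂ → ℝ} {t₀ T K : ℝ}

/-- The growth assumption on the terminal cost that is used below. -/
structure CostBounds (L : Eucl d₁ × Eucl d₂ → ℝ) (K : ℝ) : Prop where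
  contDiff : ContDiff ℝ 2 L
  nonneg : 0 ≤ K
  bound : ∀ z, |L z| ≤ K * (1 + ‖z.1‖ ^ 2 + ‖z.2‖ ^ 2)
  deriv_bound : ∀ z, ‖fderiv ℝ L z‖ ≤ K * (1 + ‖z.1‖ + ‖z.2‖)
  hess_bound : ∀ z, ‖fderiv ℝ (fderiv ℝ L) z‖ ≤ K * (1 + ‖z.1‖ + ‖z.2‖)

theorem Regularity.exists_costBounds {m : ℕ} {b : Eucl d₁ → Eucl m → Eucl d₁} {ℓ : Eucl m → ℝ}
    (h : Regularity b ℓ L) : ∃ K, CostBounds L K := by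
  obtain ⟨K, hK⟩ := h.L_growth
  refine ⟨K, h.L_contDiff, ?_, fun z => (hK z).1, fun z => ?_, fun z => ?_⟩
  · simpa using (abs_nonneg _).trans (hK 0).1
  · simpa only [norm_iteratedFDeriv_one] using (hK z).2 1 le_rfl (by norm_num)
  · have := (hK z).2 2 (by norm_num) (by norm_num)
    rwa [← norm_iteratedFDeriv_fderiv, norm_iteratedFDeriv_one] at this

namespace CostBounds

theorem differentiable (hL : CostBounds L K) : Differentiable ℝ L :=
  hL.contDiff.differentiable two_ne_zero

theorem norm_fderiv_sub_le (hL : CostBounds L K) {R : ℝ} {x x' : Eucl d₁} {y : Eucl d₂}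
    (hx : ‖x‖ ≤ R) (hx' : ‖x'‖ ≤ R) :
    ‖fderiv ℝ L (x, y) - fderiv ℝ L (x', y)‖ ≤ K * (1 + R + ‖y‖) * ‖x - x'‖ := by
  have hs : Convex ℝ (Metric.closedBall (0 : Eucl d₁) R ×ˢ ({y} : Set (Eucl d₂))) :=
    (convex_closedBall _ _).prod (convex_singleton y)
  have := hs.norm_image_sub_le_of_norm_fderiv_le (f := fderiv ℝ L)
    (C := K * (1 + R + ‖y‖)) (x := (x', y)) (y := (x, y))
    (fun z _ => (hL.contDiff.fderiv_right (m := 1) (by norm_num)).differentiable one_ne_zero z)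
    (fun z hz => (hL.hess_bound z).trans ?_) (by simpa using hx') (by simpa using hx)
  · refine this.trans_eq ?_
    rw [Prod.mk_sub_mk, sub_self, Prod.norm_mk, norm_zero, max_eq_left (norm_nonneg _)]
  · have h1 : ‖z.1‖ ≤ R := by simpa using hz.1
    have h2 : z.2 = y := hz.2
    rw [h2]
    exact mul_le_mul_of_nonneg_left (by linarith) hL.nonneg

theorem abs_sub_le (hL : CostBounds L K) {R : ℝ} {x x' : Eucl d₁} {y : Eucl d₂}
    (hx : ‖x‖ ≤ R) (hx' : ‖x'‖ ≤ R) :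
    |L (x, y) - L (x', y)| ≤ K * (1 + R + ‖y‖) * ‖x - x'‖ := by
  have hs : Convex ℝ (Metric.closedBall (0 : Eucl d₁) R ×ˢ ({y} : Set (Eucl d₂))) :=
    (convex_closedBall _ _).prod (convex_singleton y)
  have := hs.norm_image_sub_le_of_norm_fderiv_le (𝕜 := ℝ) (f := L)
    (C := K * (1 + R + ‖y‖)) (x := (x', y)) (y := (x, y))
    (fun z _ => hL.differentiable z)
    (fun z hz => (hL.deriv_bound z).trans ?_) (by simpa using hx') (by simpa using hx)
  · refine this.trans_eq ?_
    rw [Prod.mk_sub_mk, sub_self, Prod.norm_mk, norm_zero, max_eq_left (norm_nonneg _)]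
  · have h1 : ‖z.1‖ ≤ R := by simpa using hz.1
    have h2 : z.2 = y := hz.2
    rw [h2]
    exact mul_le_mul_of_nonneg_left (by linarith) hL.nonneg

end CostBounds

/-- The terminal cost transported backward by the flow of `f`. -/
def transported (f : ℝ → Eucl d₁ → Eucl d₁) (L : Eucl d₁ × Eucl d₂ → ℝ) (T t : ℝ)
    (z : Eucl d₁ × Eucl d₂) : ℝ := L (flow f t z.1 T, z.2)

/-- The derivative of `(x, y) ↦ (Φ(x), y)`, where `Φ` is the flow of `f` from `t` to `T`. -/
def flowProdDeriv (f : ℝ → Eucl d₁ → Eucl d₁) (D : ℝ → Eucl d₁ → Eucl d₁ →L[ℝ] Eucl d₁) (T t : ℝ)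
    (z : Eucl d₁ × Eucl d₂) : Eucl d₁ × Eucl d₂ →L[ℝ] Eucl d₁ × Eucl d₂ :=
  ((flowDeriv f D t z.1 T).comp (ContinuousLinearMap.fst ℝ _ _)).prod
    (ContinuousLinearMap.snd ℝ _ _)

theorem one_le_totalWeight (hf : IsCaratheodory f k) : 1 ≤ totalWeight k :=
  Real.one_le_exp (mul_nonneg two_pos.le (integral_nonneg hf.nonneg))

namespace IsSmoothCaratheodory

theorem hasFDerivAt_transported (hf : IsSmoothCaratheodory f D k) (hL : CostBounds L K)
    (t : ℝ) (z : Eucl d₁ × Eucl d₂) :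
    HasFDerivAt (transported f L T t)
      ((fderiv ℝ L (flow f t z.1 T, z.2)).comp (flowProdDeriv f D T t z)) z := by
  have h1 : HasFDerivAt (fun w : Eucl d₁ × Eucl d₂ => flow f t w.1 T)
      ((flowDeriv f D t z.1 T).comp (ContinuousLinearMap.fst ℝ _ _)) z :=
    (hf.hasFDerivAt_flow t z.1 T).comp z hasFDerivAt_fst
  exact (hL.differentiable _).hasFDerivAt.comp z (h1.prodMk hasFDerivAt_snd)

theorem contDiff_transported (hf : IsSmoothCaratheodory f D k) (hL : CostBounds L K) (t : ℝ) :
    ContDiff ℝ 1 (transported f L T t) := by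
  rw [contDiff_one_iff_fderiv]
  refine ⟨fun z => (hf.hasFDerivAt_transported hL t z).differentiableAt, ?_⟩
  have : fderiv ℝ (transported f L T t) = fun z =>
      (fderiv ℝ L (flow f t z.1 T, z.2)).comp (flowProdDeriv f D T t z) := by
    ext1 z; exact (hf.hasFDerivAt_transported hL t z).fderiv
  rw [this]
  have h1 : Continuous fun z : Eucl d₁ × Eucl d₂ => flow f t z.1 T :=
    (hf.continuous_flow_right t T).comp continuous_fst
  have h2 : Continuous fun z : Eucl d₁ × Eucl d₂ => flowDeriv f D t z.1 T :=
    (hf.continuous_flowDeriv t T).comp continuous_fst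
  refine ((hL.contDiff.continuous_fderiv two_ne_zero).comp (h1.prodMk continuous_snd)).clm_comp ?_
  have h3 : (flowProdDeriv f D T t : Eucl d₁ × Eucl d₂ → _) = fun z =>
      ContinuousLinearMap.prodₗᵢ ℝ ((flowDeriv f D t z.1 T).comp
        (ContinuousLinearMap.fst ℝ (Eucl d₁) (Eucl d₂)),
        ContinuousLinearMap.snd ℝ (Eucl d₁) (Eucl d₂)) := rfl
  rw [h3]
  exact (LinearIsometryEquiv.continuous _).comp
    ((h2.clm_comp continuous_const).prodMk continuous_const)

theorem norm_flowProdDeriv_le (hf : IsSmoothCaratheodory f D k) (t : ℝ) (z : Eucl d₁ × Eucl d₂) :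
    ‖flowProdDeriv f D T t z‖ ≤ 2 * totalWeight k := by
  have hw := one_le_totalWeight hf.toIsCaratheodory
  refine ContinuousLinearMap.opNorm_le_bound _ (by linarith) fun v => ?_
  refine max_le ?_ ?_
  · exact ((flowDeriv f D t z.1 T).le_opNorm v.1).trans (mul_le_mul
      (hf.norm_flowDeriv_le t z.1 T) (norm_fst_le v) (norm_nonneg _) (by linarith))
  · refine (norm_snd_le v).trans (le_mul_of_one_le_left (norm_nonneg _) (by linarith))

theorem norm_flowProdDeriv_sub_le (t s : ℝ) (z : Eucl d₁ × Eucl d₂) :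
    ‖flowProdDeriv f D T t z - flowProdDeriv f D T s z‖ ≤
      ‖flowDeriv f D t z.1 T - flowDeriv f D s z.1 T‖ := by
  refine ContinuousLinearMap.opNorm_le_bound _ (norm_nonneg _) fun v => ?_
  have : (flowProdDeriv f D T t z - flowProdDeriv f D T s z) v =
      ((flowDeriv f D t z.1 T - flowDeriv f D s z.1 T) v.1, 0) := by
    simp [flowProdDeriv]
  rw [this, Prod.norm_mk, norm_zero, max_eq_left (norm_nonneg _)]
  exact (ContinuousLinearMap.le_opNorm _ _).trans
    (mul_le_mul_of_nonneg_left (norm_fst_le v) (norm_nonneg _))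

end IsSmoothCaratheodory

/-- The field is bounded in `x`, not merely of linear growth, so a point moves by at most the
integral of `k`. Growth at infinity is therefore preserved under the flow. -/
theorem norm_flow_le (hf : IsCaratheodory f k) (hfk : ∀ t x, ‖f t x‖ ≤ k t) (s : ℝ) (x : Eucl d₁)
    (t : ℝ) : ‖flow f s x t‖ ≤ ‖x‖ + ∫ r, k r := by
  have h1 := hf.norm_flow_sub_le hf.intervalIntegrable hfk s x s t
  rw [hf.flow_self] at h1
  have h2 := abs_intervalIntegral_le_integral hf.integrable hf.nonneg s t
  have h3 := norm_sub_norm_le (flow f s x t) x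
  linarith

namespace IsSmoothCaratheodory

/-- Chain rule: the flow derivative is at most `2 * totalWeight k`, and `DL` has linear growth at
the displaced point. The control enters only through the integral of `k`, and this constant
reappears in `interactionBound`. -/
theorem norm_fderiv_transported_le (hf : IsSmoothCaratheodory f D k)
    (hfk : ∀ t x, ‖f t x‖ ≤ k t) (hL : CostBounds L K) (t : ℝ) (z : Eucl d₁ × Eucl d₂) :
    ‖fderiv ℝ (transported f L T t) z‖ ≤
      2 * totalWeight k * K * (1 + ∫ r, k r) * (1 + ‖z.1‖ + ‖z.2‖) := by
  have hw := totalWeight_pos k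
  have hk0 : 0 ≤ ∫ r, k r := integral_nonneg hf.nonneg
  rw [(hf.hasFDerivAt_transported hL t z).fderiv]
  have h1 := norm_flow_le hf.toIsCaratheodory hfk t z.1 T
  have h2 : K * (1 + ‖flow f t z.1 T‖ + ‖z.2‖) ≤
      K * ((1 + ∫ r, k r) * (1 + ‖z.1‖ + ‖z.2‖)) := by
    refine mul_le_mul_of_nonneg_left ?_ hL.nonneg
    have := mul_nonneg hk0 (by positivity : 0 ≤ ‖z.1‖ + ‖z.2‖)
    linarith
  have h3 := (hL.deriv_bound (flow f t z.1 T, z.2)).trans h2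
  have h4 := hf.norm_flowProdDeriv_le (T := T) t z
  have h5 := mul_le_mul h3 h4 (norm_nonneg _) ((norm_nonneg _).trans h3)
  refine (ContinuousLinearMap.opNorm_comp_le _ _).trans (h5.trans_eq ?_)
  ring

theorem abs_transported_le (hf : IsSmoothCaratheodory f D k)
    (hfk : ∀ t x, ‖f t x‖ ≤ k t) (hL : CostBounds L K) (t : ℝ) (z : Eucl d₁ × Eucl d₂) :
    |transported f L T t z| ≤ 2 * K * (1 + ∫ r, k r) ^ 2 * (1 + ‖z.1‖ ^ 2 + ‖z.2‖ ^ 2) := by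
  have hk0 : 0 ≤ ∫ r, k r := integral_nonneg hf.nonneg
  have h1 := norm_flow_le hf.toIsCaratheodory hfk t z.1 T
  set κ := ∫ r, k r
  have h2 : ‖flow f t z.1 T‖ ^ 2 ≤ 2 * ‖z.1‖ ^ 2 + 2 * κ ^ 2 := by
    have := pow_le_pow_left₀ (norm_nonneg _) h1 2
    nlinarith [sq_nonneg (‖z.1‖ - κ)]
  refine (hL.bound _).trans ?_
  rw [show 2 * K * (1 + κ) ^ 2 * (1 + ‖z.1‖ ^ 2 + ‖z.2‖ ^ 2) =
    K * (2 * (1 + κ) ^ 2 * (1 + ‖z.1‖ ^ 2 + ‖z.2‖ ^ 2)) by ring]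
  refine mul_le_mul_of_nonneg_left ?_ hL.nonneg
  have h3 : 0 ≤ (κ ^ 2 + 2 * κ) * (‖z.1‖ ^ 2 + ‖z.2‖ ^ 2) := by positivity
  have h4 : 0 ≤ ‖z.2‖ ^ 2 := by positivity
  simp only
  nlinarith

theorem hasC121Bound_transported (hf : IsSmoothCaratheodory f D k)
    (hfk : ∀ t x, ‖f t x‖ ≤ k t) (hL : CostBounds L K) (t : ℝ) :
    ∃ M, HasC121Bound (transported f L T t) M := by
  have hk0 : 0 ≤ ∫ r, k r := integral_nonneg hf.nonneg
  have hK := hL.nonneg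
  have hw := totalWeight_pos k
  refine ⟨2 * K * (1 + ∫ r, k r) ^ 2 + 2 * totalWeight k * K * (1 + ∫ r, k r),
    hf.contDiff_transported hL t, fun z => ⟨(hf.abs_transported_le hfk hL t z).trans ?_,
    (hf.norm_fderiv_transported_le hfk hL t z).trans ?_⟩⟩
  · exact mul_le_mul_of_nonneg_right (le_add_of_nonneg_right (by positivity)) (by positivity)
  · exact mul_le_mul_of_nonneg_right (le_add_of_nonneg_left (by positivity)) (by positivity)

/-- The difference of the transported costs at two times. -/
theorem transported_sub_bounds (hf : IsSmoothCaratheodory f D k)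
    (hfk : ∀ t x, ‖f t x‖ ≤ k t) (hL : CostBounds L K) {κ : ℝ → ℝ}
    (hκ : ∀ a b, IntervalIntegrable κ volume a b) (hfκ : ∀ t x, ‖f t x‖ ≤ κ t)
    (hDκ : ∀ t x, ‖D t x‖ ≤ κ t) :
    ∃ M, 0 ≤ M ∧ ∀ s t (z : Eucl d₁ × Eucl d₂),
      |transported f L T t z - transported f L T s z| ≤
        M * |∫ r in s..t, κ r| * (1 + ‖z.1‖ + ‖z.2‖) ∧
      ‖fderiv ℝ (transported f L T t) z - fderiv ℝ (transported f L T s) z‖ ≤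
        M * |∫ r in s..t, κ r| * (1 + ‖z.1‖ + ‖z.2‖) := by
  have hk0 : 0 ≤ ∫ r, k r := integral_nonneg hf.nonneg
  have hK := hL.nonneg
  have hw := totalWeight_pos k
  set W := totalWeight k
  set A := ∫ r, k r
  refine ⟨K * (1 + A) * (2 * W) + (K * (1 + A) * (2 * W) * (2 * W) +
    K * (1 + A) * (4 * W ^ 2 + 8 * W ^ 3 * A)), by positivity, fun s t z => ?_⟩
  set δ := |∫ r in s..t, κ r| with hδ
  have hδ0 : 0 ≤ δ := abs_nonneg _
  set x := z.1
  set y := z.2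
  set X := flow f s x t with hX
  have hXx : ‖X - x‖ ≤ δ := by
    have := hf.norm_flow_sub_le hκ hfκ s x s t
    rwa [hf.flow_self] at this
  have hflow : ‖flow f t x T - flow f s x T‖ ≤ 2 * W * δ := by
    rw [← hf.flow_flow s t x T]
    refine (hf.flow_lipschitz t x X T).trans ?_
    rw [norm_sub_rev]
    exact mul_le_mul_of_nonneg_left hXx (by positivity)
  have hbt := norm_flow_le hf.toIsCaratheodory hfk t x T
  have hbs := norm_flow_le hf.toIsCaratheodory hfk s x T
  have hR : K * (1 + (‖x‖ + A) + ‖y‖) ≤ K * (1 + A) * (1 + ‖x‖ + ‖y‖) := by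
    rw [mul_assoc]
    refine mul_le_mul_of_nonneg_left ?_ hK
    have := mul_nonneg hk0 (by positivity : 0 ≤ ‖x‖ + ‖y‖)
    linarith
  set P := 1 + ‖x‖ + ‖y‖ with hP
  have hP0 : 0 ≤ P := by positivity
  constructor
  · have h1 := hL.abs_sub_le (y := y) hbt hbs
    have h2 := mul_le_mul hR hflow (norm_nonneg _) (by positivity)
    refine (h1.trans h2).trans ?_
    have h3 : 0 ≤ (K * (1 + A) * (2 * W) * (2 * W) +
      K * (1 + A) * (4 * W ^ 2 + 8 * W ^ 3 * A)) * δ * P := by positivity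
    linarith
  · rw [(hf.hasFDerivAt_transported hL t z).fderiv, (hf.hasFDerivAt_transported hL s z).fderiv]
    set B := flowProdDeriv f D T t z
    set B' := flowProdDeriv f D T s z
    have hB : ‖B‖ ≤ 2 * W := hf.norm_flowProdDeriv_le t z
    have hJ : ‖flowDeriv f D t x T - flowDeriv f D s x T‖ ≤ (4 * W ^ 2 + 8 * W ^ 3 * A) * δ := by
      -- The derivative from `s` to `T` factors through time `t`. On the short interval the
      -- derivative is close to the identity, and on the remaining one only the base point changes,
      -- from `x` to the nearby `X`.
      rw [hf.flowDeriv_comp s t x T, norm_sub_rev]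
      have e : (flowDeriv f D t X T).comp (flowDeriv f D s x t) - flowDeriv f D t x T =
          (flowDeriv f D t X T).comp (flowDeriv f D s x t - ContinuousLinearMap.id ℝ _) +
          (flowDeriv f D t X T - flowDeriv f D t x T) := by
        rw [ContinuousLinearMap.comp_sub, ContinuousLinearMap.comp_id]; abel
      rw [e]
      have h1 : ‖(flowDeriv f D t X T).comp (flowDeriv f D s x t - ContinuousLinearMap.id ℝ _)‖
          ≤ 2 * W * (2 * W * δ) := (ContinuousLinearMap.opNorm_comp_le _ _).trans
        (mul_le_mul (hf.norm_flowDeriv_le t X T) (hf.norm_flowDeriv_sub_id_le hκ hDκ s x t)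
          (norm_nonneg _) (by positivity))
      have h2 : ‖flowDeriv f D t X T - flowDeriv f D t x T‖ ≤ 8 * W ^ 3 * A * δ :=
        (hf.flowDeriv_lipschitz t X x T).trans (mul_le_mul_of_nonneg_left hXx (by positivity))
      refine (norm_add_le _ _).trans ((add_le_add h1 h2).trans_eq ?_)
      ring
    have hBB : ‖B - B'‖ ≤ (4 * W ^ 2 + 8 * W ^ 3 * A) * δ :=
      (norm_flowProdDeriv_sub_le t s z).trans hJ
    have e : (fderiv ℝ L (flow f t x T, y)).comp B - (fderiv ℝ L (flow f s x T, y)).comp B' =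
        (fderiv ℝ L (flow f t x T, y) - fderiv ℝ L (flow f s x T, y)).comp B +
        (fderiv ℝ L (flow f s x T, y)).comp (B - B') := by
      rw [ContinuousLinearMap.comp_sub, ContinuousLinearMap.sub_comp]; abel
    rw [e]
    have h1 : ‖(fderiv ℝ L (flow f t x T, y) - fderiv ℝ L (flow f s x T, y)).comp B‖ ≤
        (K * (1 + A) * P * (2 * W * δ)) * (2 * W) :=
      (ContinuousLinearMap.opNorm_comp_le _ _).trans (mul_le_mul
        ((hL.norm_fderiv_sub_le hbt hbs).trans
          (mul_le_mul hR hflow (norm_nonneg _) (by positivity))) hB (norm_nonneg _)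
          (by positivity))
    have h2 : ‖(fderiv ℝ L (flow f s x T, y)).comp (B - B')‖ ≤
        (K * (1 + A) * P) * ((4 * W ^ 2 + 8 * W ^ 3 * A) * δ) :=
      (ContinuousLinearMap.opNorm_comp_le _ _).trans (mul_le_mul
        ((hL.deriv_bound _).trans ((mul_le_mul_of_nonneg_left
          (by simp only; linarith) hK).trans hR)) hBB (norm_nonneg _) (by positivity))
    refine (norm_add_le _ _).trans ((add_le_add h1 h2).trans ?_)
    have h3 : 0 ≤ K * (1 + A) * (2 * W) * δ * P := by positivity
    linarith

theorem isHolderCurve_transported (hf : IsSmoothCaratheodory f D k)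
    (hfk : ∀ t x, ‖f t x‖ ≤ k t) (hL : CostBounds L K) {κ : ℝ → ℝ}
    (hκ : ∀ a b, IntervalIntegrable κ volume a b) (hfκ : ∀ t x, ‖f t x‖ ≤ κ t)
    (hDκ : ∀ t x, ‖D t x‖ ≤ κ t) {H : ℝ}
    (hH : ∀ s ∈ Icc t₀ T, ∀ t ∈ Icc t₀ T, |∫ r in s..t, κ r| ≤ H * Real.sqrt |t - s|) :
    IsHolderCurve t₀ T (transported f L T) := by
  obtain ⟨M, hM0, hM⟩ := hf.transported_sub_bounds (T := T) hfk hL hκ hfκ hDκ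
  refine ⟨fun t _ => hf.hasC121Bound_transported hfk hL t, 2 * M * H, fun s hs t ht =>
    ⟨(hf.contDiff_transported hL t).sub (hf.contDiff_transported hL s), fun z => ?_⟩⟩
  obtain ⟨h1, h2⟩ := hM s t z
  have h3 := mul_le_mul_of_nonneg_left (hH s hs t ht) hM0
  have h5 : 0 ≤ M * (H * Real.sqrt |t - s|) := (mul_nonneg hM0 (abs_nonneg _)).trans h3
  constructor
  · refine h1.trans ((mul_le_mul_of_nonneg_right h3 (by positivity)).trans ?_)
    have h4 : 1 + ‖z.1‖ + ‖z.2‖ ≤ 2 * (1 + ‖z.1‖ ^ 2 + ‖z.2‖ ^ 2) := by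
      nlinarith [sq_nonneg (‖z.1‖ - 1 / 2), sq_nonneg (‖z.2‖ - 1 / 2)]
    have := mul_le_mul_of_nonneg_left h4 h5
    linarith
  · rw [fderiv_fun_sub ((hf.contDiff_transported hL t).differentiable one_ne_zero z)
      ((hf.contDiff_transported hL s).differentiable one_ne_zero z)]
    refine h2.trans ((mul_le_mul_of_nonneg_right h3 (by positivity)).trans ?_)
    have := mul_nonneg h5 (by positivity : 0 ≤ 1 + ‖z.1‖ + ‖z.2‖)
    linarith

end IsSmoothCaratheodory

/-- A function that is transported by the flow solves the transport equation. -/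
theorem IsCaratheodory.integral_inner_gradX (hf : IsCaratheodory f k)
    (hfk : ∀ t x, ‖f t x‖ ≤ k t) {u : ℝ → Eucl d₁ × Eucl d₂ → ℝ} (hu : IsHolderCurve t₀ T u)
    (hflow : ∀ s t x y, u t (flow f s x t, y) = u s (x, y)) {t : ℝ} (ht : t ∈ Icc t₀ T)
    (z : Eucl d₁ × Eucl d₂) :
    u t z = u T z + ∫ r in t..T, inner ℝ (f r z.1) (gradX (u r) z) := by
  obtain ⟨x, y⟩ := z
  have hki := hf.intervalIntegrable
  have hi : ∀ a ∈ Icc t₀ T, ∀ b ∈ Icc t₀ T, IntervalIntegrable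
      (fun r => inner ℝ (f r x) (gradX (u r) (x, y))) volume a b :=
    fun a ha b hb => hf.intervalIntegrable_inner_gradX hu (x, y) ha hb
  -- Transport by the flow gives `u_s(x) = u_τ(flow f s x τ)`, which turns a time increment at `x`
  -- into a space increment at the frozen time `τ`. Its leading term cancels against the added
  -- integral.
  have key := eq_of_small_increments (k := k)
    (F := fun s => u s (x, y) + ∫ r in t..s, inner ℝ (f r x) (gradX (u r) (x, y)))
    ht.2 hki hf.nonneg ?_
  · simpa using key.symm
  intro τ hτ ε hε
  have hτ' : τ ∈ Icc t₀ T := ⟨ht.1.trans hτ.1, hτ.2⟩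
  set G := gradX (u τ) (x, y) with hG
  set η := ε / 3 with hη
  have hη0 : 0 < η := by positivity
  have hδ : 0 < η / (‖G‖ + 1) / 2 := by positivity
  refine Filter.Eventually.filter_mono (nhdsWithin_mono τ (Icc_subset_Icc ht.1 le_rfl)) ?_
  have e0 : ∀ᶠ s in 𝓝[Icc t₀ T] τ, ∀ r ∈ uIcc τ s, |∫ q in τ..r, k q| < η / (‖G‖ + 1) / 2 :=
    eventually_forall_uIcc ordConnected_Icc hτ'
      ((hf.eventually_abs_integral_lt τ hδ).filter_mono nhdsWithin_le_nhds)
  have hψ : ∀ s, ‖flow f s x τ - x‖ ≤ |∫ r in τ..s, k r| := fun s => by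
    have := hf.norm_flow_sub_le hki hfk s x s τ
    rwa [hf.flow_self, intervalIntegral.integral_symm, abs_neg] at this
  have e1 : ∀ᶠ s in 𝓝[Icc t₀ T] τ, |u τ (flow f s x τ, y) - u τ (x, y)
      - inner ℝ (flow f s x τ - x) G| ≤ η * ‖flow f s x τ - x‖ := by
    have ht : Tendsto (fun s => flow f s x τ) (𝓝 τ) (𝓝 x) := by
      rw [tendsto_iff_norm_sub_tendsto_zero]
      exact squeeze_zero (fun _ => norm_nonneg _) hψ
        (((intervalIntegral.continuous_primitive hki τ).abs).tendsto' _ _ (by simp))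
    exact (ht.eventually (hasFDerivAt_inner_gradX (hu.differentiableAt hτ' _) hη0)).filter_mono
      nhdsWithin_le_nhds
  have e3 : ∀ᶠ s in 𝓝[Icc t₀ T] τ, ∀ r ∈ uIcc τ s, ‖gradX (u r) (x, y) - G‖ < η := by
    refine eventually_forall_uIcc ordConnected_Icc hτ' ?_
    have := (hu.continuousOn_gradX (x, y) τ hτ').eventually (Metric.ball_mem_nhds _ hη0)
    simpa only [Metric.mem_ball, dist_eq_norm] using this
  filter_upwards [e0, e1, e3, self_mem_nhdsWithin] with s h0 h1 h3 hs
  have iX := hf.intervalIntegrable_comp (hf.continuous_flow s x)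
  have hψs : flow f s x τ - x = -∫ r in τ..s, f r (flow f s x r) := by
    have := hf.flow_sub s x s τ
    rwa [hf.flow_self, intervalIntegral.integral_symm] at this
  have i1 : IntervalIntegrable (fun r => inner ℝ (f r (flow f s x r)) G) volume τ s := by
    have := intervalIntegrable_iff.2
      ((innerSL ℝ G).integrable_comp (intervalIntegrable_iff.1 (iX τ s)))
    refine this.congr fun r _ => ?_
    rw [innerSL_apply_apply, real_inner_comm]
  have hin : inner ℝ (flow f s x τ - x) G = -∫ r in τ..s, inner ℝ (f r (flow f s x r)) G := by
    rw [hψs, inner_neg_left, real_inner_comm, ← innerSL_apply_apply ℝ,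
      ← ContinuousLinearMap.intervalIntegral_comp_comm _ (iX τ s)]
    congr 1
    refine intervalIntegral.integral_congr fun r _ => ?_
    rw [innerSL_apply_apply, real_inner_comm]
  have hdec : (u s (x, y) + ∫ r in t..s, inner ℝ (f r x) (gradX (u r) (x, y))) -
      (u τ (x, y) + ∫ r in t..τ, inner ℝ (f r x) (gradX (u r) (x, y))) =
      (u τ (flow f s x τ, y) - u τ (x, y) - inner ℝ (flow f s x τ - x) G) +
      ∫ r in τ..s, (inner ℝ (f r x) (gradX (u r) (x, y)) - inner ℝ (f r (flow f s x r)) G) := by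
    rw [intervalIntegral.integral_sub (hi τ hτ' s hs) i1, hin, hflow,
      ← intervalIntegral.integral_add_adjacent_intervals (hi t ht τ hτ') (hi τ hτ' s hs)]
    ring
  have hI : ‖∫ r in τ..s, (inner ℝ (f r x) (gradX (u r) (x, y))
      - inner ℝ (f r (flow f s x r)) G)‖ ≤ |∫ r in τ..s, 2 * η * k r| := by
    refine norm_intervalIntegral_le_abs (fun a b => (hki a b).const_mul _) fun r hr => ?_
    refine (abs_inner_sub_inner_le _ _ _ _).trans ?_
    have h4 : ‖x - flow f s x r‖ ≤ η / (‖G‖ + 1) := by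
      have h5 := h0 r hr
      have h6 := h0 s right_mem_uIcc
      have h7 := hf.norm_flow_sub_le hki hfk s x s r
      rw [hf.flow_self, ← intervalIntegral.integral_interval_sub_left (hki τ r) (hki τ s)] at h7
      have h8 := abs_sub (∫ q in τ..r, k q) (∫ q in τ..s, k q)
      rw [norm_sub_rev]
      linarith
    have h5 : ‖f r x - f r (flow f s x r)‖ * ‖G‖ ≤ η * k r := by
      calc _ ≤ k r * (η / (‖G‖ + 1)) * ‖G‖ := mul_le_mul_of_nonneg_right
            ((hf.lip r _ _).trans (mul_le_mul_of_nonneg_left h4 (hf.nonneg r))) (norm_nonneg _)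
        _ = (η * k r) * (‖G‖ / (‖G‖ + 1)) := by ring
        _ ≤ (η * k r) * 1 := mul_le_mul_of_nonneg_left
            (by rw [div_le_one (by positivity)]; linarith) (mul_nonneg hη0.le (hf.nonneg r))
        _ = _ := mul_one _
    have h6 := mul_le_mul (hfk r x) (h3 r hr).le (norm_nonneg _) (hf.nonneg r)
    linarith
  rw [intervalIntegral.integral_const_mul, abs_mul, abs_of_pos (by positivity)] at hI
  rw [hdec]
  refine (norm_add_le _ _).trans ?_
  have h8 := h1.trans (mul_le_mul_of_nonneg_left (hψ s) hη0.le)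
  rw [← Real.norm_eq_abs] at h8
  have : ε = 3 * η := by rw [hη]; ring
  rw [this]
  linarith

end TransportedCost

/-! ### Push-forward by the flow solves the continuity equation. -/

section PushForward

variable {d₁ d₂ m : ℕ}

theorem normPow_two (z : Eucl d₁ × Eucl d₂) : normPow 2 z = ‖z.1‖ ^ 2 + ‖z.2‖ ^ 2 := by
  simp [normPow]

theorem normPow_three (z : Eucl d₁ × Eucl d₂) :
    normPow 3 z = Real.sqrt (‖z.1‖ ^ 2 + ‖z.2‖ ^ 2) ^ 3 := by
  rw [normPow, Real.sqrt_eq_rpow, ← Real.rpow_natCast (_ ^ (1 / 2 : ℝ)) 3, ← Real.rpow_mul (by positivity)]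
  norm_num

theorem continuous_normPow {p : ℝ} (hp : 0 ≤ p) :
    Continuous (normPow p : Eucl d₁ × Eucl d₂ → ℝ) := by
  unfold normPow
  exact (by fun_prop : Continuous fun z : Eucl d₁ × Eucl d₂ => ‖z.1‖ ^ 2 + ‖z.2‖ ^ 2).rpow_const
    fun _ => Or.inr (by positivity)

theorem normPow_nonneg (p : ℝ) (z : Eucl d₁ × Eucl d₂) : 0 ≤ normPow p z := by
  unfold normPow; positivity

theorem normPow_two_le (z : Eucl d₁ × Eucl d₂) : normPow 2 z ≤ 1 + normPow 3 z := by
  rw [normPow_two, normPow_three]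
  set r := Real.sqrt (‖z.1‖ ^ 2 + ‖z.2‖ ^ 2) with hr
  have hr2 : r ^ 2 = ‖z.1‖ ^ 2 + ‖z.2‖ ^ 2 := Real.sq_sqrt (by positivity)
  have hr0 : 0 ≤ r := Real.sqrt_nonneg _
  rw [← hr2]
  rcases le_total r 1 with h | h
  · nlinarith [pow_nonneg hr0 3, pow_le_one₀ (n := 2) hr0 h]
  · nlinarith [pow_nonneg hr0 2]

theorem IsPp.two_of_three {μ : Measure (Eucl d₁ × Eucl d₂)} (h : IsPp 3 μ) : IsPp 2 μ := by
  have := h.1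
  refine ⟨h.1, ((integrable_const 1).add h.2).mono'
    (continuous_normPow two_pos.le).aestronglyMeasurable (Eventually.of_forall fun z => ?_)⟩
  rw [Real.norm_of_nonneg (normPow_nonneg _ _)]
  exact normPow_two_le z

/-- The total derivative of a function of `(t, x, y)` in the direction `(1, v, 0)`. -/
theorem fderiv_uncurry_apply {φ : ℝ → Eucl d₁ × Eucl d₂ → ℝ}
    (hφ : ContDiff ℝ 1 (Function.uncurry φ)) (t : ℝ) (z : Eucl d₁ × Eucl d₂) (v : Eucl d₁) :
    fderiv ℝ (Function.uncurry φ) (t, z) (1, (v, 0)) =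
      deriv (fun s => φ s z) t + inner ℝ v (gradX (φ t) z) := by
  have hd := (hφ.differentiable one_ne_zero (t, z)).hasFDerivAt
  have h1 : HasDerivAt (fun s => φ s z) (fderiv ℝ (Function.uncurry φ) (t, z) (1, 0)) t :=
    HasFDerivAt.comp_hasDerivAt t (l := Function.uncurry φ) (f := fun s => (s, z)) hd
      ((hasDerivAt_id t).prodMk (hasDerivAt_const t z))
  have h2 : HasFDerivAt (φ t) ((fderiv ℝ (Function.uncurry φ) (t, z)).comp
      (ContinuousLinearMap.inr ℝ ℝ (Eucl d₁ × Eucl d₂))) z :=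
    HasFDerivAt.comp z (g := Function.uncurry φ) (f := fun w => (t, w)) hd
      (hasFDerivAt_prodMk_right t z)
  rw [h1.deriv, inner_gradX h2.differentiableAt, h2.fderiv]
  simp only [ContinuousLinearMap.comp_apply, ContinuousLinearMap.inr_apply, ← map_add]
  simp

variable {f : ℝ → Eucl d₁ → Eucl d₁} {k : ℝ → ℝ} {t₀ T : ℝ}

/-- The flow of `f`, from time `s` to time `t`, that leaves the second variable fixed. -/
def flowProd (f : ℝ → Eucl d₁ → Eucl d₁) (s t : ℝ) (z : Eucl d₁ × Eucl d₂) :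
    Eucl d₁ × Eucl d₂ := (flow f s z.1 t, z.2)

theorem continuous_uncurry_flow (hf : IsCaratheodory f k) (s : ℝ) :
    Continuous fun p : ℝ × Eucl d₁ => flow f s p.2 p.1 := by
  rw [continuous_iff_continuousAt]
  rintro ⟨t, x⟩
  rw [ContinuousAt, tendsto_iff_norm_sub_tendsto_zero]
  have hc := hf.continuous_flow s x
  have hb : Tendsto (fun p : ℝ × Eucl d₁ => 2 * totalWeight k * ‖p.2 - x‖ +
      ‖flow f s x p.1 - flow f s x t‖) (𝓝 (t, x)) (𝓝 0) :=
    (by fun_prop : Continuous fun p : ℝ × Eucl d₁ => 2 * totalWeight k * ‖p.2 - x‖ +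
      ‖flow f s x p.1 - flow f s x t‖).tendsto' _ _ (by simp)
  refine squeeze_zero (fun _ => norm_nonneg _) (fun p => ?_) hb
  rw [← sub_add_sub_cancel (flow f s p.2 p.1) (flow f s x p.1)]
  exact (norm_add_le _ _).trans (add_le_add (hf.flow_lipschitz s _ _ _) le_rfl)

theorem continuous_flowProd (hf : IsCaratheodory f k) (s t : ℝ) :
    Continuous (flowProd f s t : Eucl d₁ × Eucl d₂ → _) :=
  ((hf.continuous_flow_right s t).comp continuous_fst).prodMk continuous_snd

theorem IsCaratheodory.continuous (hf : IsCaratheodory f k) (t : ℝ) : Continuous (f t) := by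
  refine LipschitzWith.continuous (K := (k t).toNNReal) (LipschitzWith.of_dist_le_mul fun x y => ?_)
  rw [Real.coe_toNNReal _ (hf.nonneg t), dist_eq_norm, dist_eq_norm]
  exact hf.lip t x y

theorem IsCaratheodory.stronglyMeasurable_uncurry (hf : IsCaratheodory f k) :
    StronglyMeasurable fun p : ℝ × Eucl d₁ => f p.1 p.2 := by
  have := stronglyMeasurable_uncurry_of_continuous_of_stronglyMeasurable
    (u := fun (x : Eucl d₁) (t : ℝ) => f t x) hf.continuous
    (fun x => hf.meas (fun _ => x) continuous_const)
  exact this.comp_measurable measurable_swap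

/-- Coupling the two measures through their common starting points moves each point by at most the
integral of `k` between the two times. -/
theorem transportCost_map_le {γ₀ : Measure (Eucl d₁ × Eucl d₂)} [IsProbabilityMeasure γ₀]
    (hf : IsCaratheodory f k) (hfk : ∀ t x, ‖f t x‖ ≤ k t) (t₀ s t : ℝ) :
    transportCost (γ₀.map (flowProd f t₀ s)) (γ₀.map (flowProd f t₀ t)) ≤
      ENNReal.ofReal (|∫ r in t..s, k r| ^ 2) := by
  have hs : Measurable (flowProd f t₀ s : Eucl d₁ × Eucl d₂ → _) :=
    (continuous_flowProd hf t₀ s).measurable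
  have ht : Measurable (flowProd f t₀ t : Eucl d₁ × Eucl d₂ → _) :=
    (continuous_flowProd hf t₀ t).measurable
  have hst := hs.prodMk ht
  refine iInf₂_le_of_le (γ₀.map fun z => (flowProd f t₀ s z, flowProd f t₀ t z))
    ⟨?_, ?_⟩ ?_
  · rw [Measure.map_map measurable_fst hst]; rfl
  · rw [Measure.map_map measurable_snd hst]; rfl
  rw [lintegral_map (by fun_prop) hst]
  refine (lintegral_mono (g := fun _ => ENNReal.ofReal (|∫ r in t..s, k r| ^ 2))
    fun z => ?_).trans_eq (by simp)
  refine ENNReal.ofReal_le_ofReal ?_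
  simp only [flowProd, sub_self, norm_zero]
  have := hf.norm_flow_sub_le hf.intervalIntegrable hfk t₀ z.1 t s
  have := pow_le_pow_left₀ (norm_nonneg _) this 2
  simpa using this

theorem isPp_two_map {γ₀ : Measure (Eucl d₁ × Eucl d₂)} (hγ : IsPp 2 γ₀)
    (hf : IsCaratheodory f k) (hfk : ∀ t x, ‖f t x‖ ≤ k t) (t₀ t : ℝ) :
    IsPp 2 (γ₀.map (flowProd f t₀ t)) := by
  have hp := hγ.1
  have hc : Continuous (flowProd f t₀ t : Eucl d₁ × Eucl d₂ → _) := continuous_flowProd hf t₀ t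
  refine ⟨Measure.isProbabilityMeasure_map hc.aemeasurable, ?_⟩
  rw [integrable_map_measure (continuous_normPow two_pos.le).aestronglyMeasurable hc.aemeasurable]
  refine ((hγ.2.const_mul 2).add (integrable_const (2 * (∫ r, k r) ^ 2))).mono'
    ((continuous_normPow two_pos.le).comp hc).aestronglyMeasurable
    (Eventually.of_forall fun z => ?_)
  rw [Function.comp_apply, Real.norm_of_nonneg (normPow_nonneg _ _), Pi.add_apply, normPow_two,
    normPow_two]
  have h1 := pow_le_pow_left₀ (norm_nonneg _) (norm_flow_le hf hfk t₀ z.1 t) 2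
  simp only [flowProd]
  nlinarith [sq_nonneg (‖z.1‖ - ∫ r, k r), sq_nonneg ‖z.2‖]

/-- For each starting point, this is the chain rule for `φ` along the absolutely continuous curve `t
↦ (t, flowProd f t₀ t z)`; it is then integrated against `γ₀` with Fubini's theorem. -/
theorem flowProd_weak {γ₀ : Measure (Eucl d₁ × Eucl d₂)} [IsProbabilityMeasure γ₀]
    (hf : IsCaratheodory f k) (hfk : ∀ t x, ‖f t x‖ ≤ k t) {φ : ℝ → Eucl d₁ × Eucl d₂ → ℝ}
    (hφ : IsTest φ) {t₁ : ℝ} (h01 : t₀ ≤ t₁) :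
    ∫ z, φ t₁ z ∂(γ₀.map (flowProd f t₀ t₁)) = ∫ z, φ t₀ z ∂γ₀ +
      ∫ t in t₀..t₁, ∫ z, (deriv (fun s => φ s z) t
        + inner ℝ (f t z.1) (gradX (φ t) z)) ∂(γ₀.map (flowProd f t₀ t)) := by
  obtain ⟨hφ1, K, hK⟩ := hφ
  have hφc : ∀ t, Continuous (φ t) := fun t =>
    hφ1.continuous.comp (by fun_prop : Continuous fun z => (t, z))
  have hφi : ∀ t (μ : Measure (Eucl d₁ × Eucl d₂)) [IsProbabilityMeasure μ],
      Integrable (φ t) μ := fun t μ _ =>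
    (integrable_const K).mono' (hφc t).aestronglyMeasurable
      (Eventually.of_forall fun z => (hK (t, z)).1)
  have hDc : Continuous (fderiv ℝ (Function.uncurry φ)) := hφ1.continuous_fderiv one_ne_zero
  have hflow := continuous_uncurry_flow hf t₀
  let v : ℝ → Eucl d₁ × Eucl d₂ → ℝ × Eucl d₁ × Eucl d₂ := fun r z =>
    (1, (f r (flow f t₀ z.1 r), 0))
  let g : ℝ → Eucl d₁ × Eucl d₂ → ℝ := fun r z =>
    fderiv ℝ (Function.uncurry φ) (r, flowProd f t₀ r z) (v r z)
  have hvk : ∀ r z, ‖v r z‖ ≤ 1 + k r := fun r z => by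
    simp only [v, Prod.norm_mk, norm_one, norm_zero]
    have := hfk r (flow f t₀ z.1 r)
    have := hf.nonneg r
    exact max_le (by linarith) (max_le (by linarith) (by linarith))
  have hk1 : ∀ a b, IntervalIntegrable (fun r => 1 + k r) volume a b := fun a b =>
    intervalIntegrable_const.add (hf.intervalIntegrable a b)
  have hvm : StronglyMeasurable fun p : ℝ × Eucl d₁ × Eucl d₂ => v p.1 p.2 := by
    have h1 : StronglyMeasurable fun p : ℝ × Eucl d₁ × Eucl d₂ => f p.1 (flow f t₀ p.2.1 p.1) := by
      have h2 : Continuous fun p : ℝ × Eucl d₁ × Eucl d₂ => (p.1, flow f t₀ p.2.1 p.1) :=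
        continuous_fst.prodMk (hflow.comp
          (by fun_prop : Continuous fun p : ℝ × Eucl d₁ × Eucl d₂ => (p.1, p.2.1)))
      exact hf.stronglyMeasurable_uncurry.comp_measurable h2.measurable
    exact stronglyMeasurable_const.prodMk (h1.prodMk stronglyMeasurable_const)
  have hpt : ∀ z, φ t₁ (flowProd f t₀ t₁ z) - φ t₀ z = ∫ r in t₀..t₁, g r z := by
    intro z
    have := (comp_sub_comp_eq_integral hφ1 (Z := fun r => (r, flowProd f t₀ r z))
      (v := fun r => v r z) hk1
      (hvm.comp_measurable (by fun_prop : Measurable fun r : ℝ => (r, z))).aestronglyMeasurable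
      (fun r => hvk r z) ?_ h01).2
    · have h0 : flowProd f t₀ t₀ z = z := by simp [flowProd, hf.flow_self]
      simpa [h0, Function.uncurry] using this
    · intro s t
      have i1 : IntervalIntegrable (fun r => f r (flow f t₀ z.1 r)) volume s t :=
        hf.intervalIntegrable_comp (hf.continuous_flow t₀ z.1) s t
      have hi : IntervalIntegrable (fun r => v r z) volume s t :=
        intervalIntegrable_of_norm_le hk1 (hvm.comp_measurable
          (by fun_prop : Measurable fun r : ℝ => (r, z))).aestronglyMeasurable
          (fun r => hvk r z) s t
      refine Prod.ext ?_ (Prod.ext ?_ ?_)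
      · have e := (ContinuousLinearMap.fst ℝ ℝ (Eucl d₁ × Eucl d₂)).intervalIntegral_comp_comm hi
        refine Eq.trans ?_ e
        simp [v]
      · have e := ((ContinuousLinearMap.fst ℝ (Eucl d₁) (Eucl d₂)).comp
          (ContinuousLinearMap.snd ℝ ℝ (Eucl d₁ × Eucl d₂))).intervalIntegral_comp_comm hi
        exact (hf.flow_sub t₀ z.1 s t).trans e
      · have e := ((ContinuousLinearMap.snd ℝ (Eucl d₁) (Eucl d₂)).comp
          (ContinuousLinearMap.snd ℝ ℝ (Eucl d₁ × Eucl d₂))).intervalIntegral_comp_comm hi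
        refine Eq.trans ?_ e
        simp [v, flowProd]
  have hgm : StronglyMeasurable (Function.uncurry g) := by
    have h1 : Continuous fun p : ℝ × Eucl d₁ × Eucl d₂ =>
        fderiv ℝ (Function.uncurry φ) (p.1, flowProd f t₀ p.1 p.2) := by
      refine hDc.comp (continuous_fst.prodMk ((hflow.comp
        (by fun_prop : Continuous fun p : ℝ × Eucl d₁ × Eucl d₂ => (p.1, p.2.1))).prodMk
          (continuous_snd.comp continuous_snd)))
    exact (isBoundedBilinearMap_apply.continuous).comp_stronglyMeasurable
      (h1.stronglyMeasurable.prodMk hvm)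
  have hgb : ∀ r z, ‖g r z‖ ≤ K * (1 + k r) := fun r z =>
    (ContinuousLinearMap.le_opNorm _ _).trans (mul_le_mul (hK _).2 (hvk r z) (norm_nonneg _)
      ((norm_nonneg _).trans (hK 0).2))
  have hgi : Integrable (Function.uncurry g) ((volume.restrict (Ioc t₀ t₁)).prod γ₀) := by
    have h1 : Integrable (fun r => K * (1 + k r)) (volume.restrict (Ioc t₀ t₁)) :=
      ((intervalIntegrable_iff_integrableOn_Ioc_of_le h01).1 (hk1 t₀ t₁)).const_mul K
    exact (h1.comp_fst γ₀).mono' hgm.aestronglyMeasurable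
      (Eventually.of_forall fun p => hgb p.1 p.2)
  have hswap : ∫ z, (∫ r in t₀..t₁, g r z) ∂γ₀ = ∫ r in t₀..t₁, ∫ z, g r z ∂γ₀ := by
    simp only [intervalIntegral.integral_of_le h01]
    exact (integral_integral_swap hgi).symm
  have hrhs : ∀ t, ∫ z, (deriv (fun s => φ s z) t + inner ℝ (f t z.1) (gradX (φ t) z))
      ∂(γ₀.map (flowProd f t₀ t)) = ∫ z, g t z ∂γ₀ := by
    intro t
    have e : (fun z : Eucl d₁ × Eucl d₂ => deriv (fun s => φ s z) t +
        inner ℝ (f t z.1) (gradX (φ t) z)) =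
        fun z => fderiv ℝ (Function.uncurry φ) (t, z) (1, (f t z.1, 0)) := by
      ext z; rw [fderiv_uncurry_apply hφ1]
    rw [e, integral_map (continuous_flowProd hf t₀ t).aemeasurable]
    · rfl
    · refine Continuous.aestronglyMeasurable ?_
      have := hf.continuous t
      exact (hDc.comp (by fun_prop : Continuous fun z : Eucl d₁ × Eucl d₂ => (t, z))).clm_apply
        (by fun_prop)
  simp only [hrhs]
  rw [← hswap, integral_map (continuous_flowProd hf t₀ t₁).aemeasurable
    (hφc t₁).aestronglyMeasurable, ← sub_eq_iff_eq_add', ← integral_sub]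
  · exact integral_congr_ae (Eventually.of_forall hpt)
  · exact (integrable_const K).mono'
      ((hφc t₁).comp (continuous_flowProd hf t₀ t₁)).aestronglyMeasurable
      (Eventually.of_forall fun z => (hK (t₁, _)).1)
  · exact hφi t₀ γ₀

theorem solvesContinuity_map {b : Eucl d₁ → Eucl m → Eucl d₁} {μ : ℝ → Measure (Eucl m)}
    {γ₀ : Measure (Eucl d₁ × Eucl d₂)} (hγ : IsPp 2 γ₀)
    (hf : IsCaratheodory (fun t x => avg b x (μ t)) k) (hfk : ∀ t x, ‖avg b x (μ t)‖ ≤ k t) :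
    SolvesContinuity b t₀ T γ₀ μ
      fun t => γ₀.map (flowProd (fun t x => avg b x (μ t)) t₀ t) where
  mem t _ := isPp_two_map hγ hf hfk t₀ t
  cont t _ := by
    have := hγ.1
    have h1 : Tendsto (fun s => ENNReal.ofReal (|∫ r in t..s, k r| ^ 2)) (𝓝 t) (𝓝 0) := by
      rw [← ENNReal.ofReal_zero]
      exact ENNReal.tendsto_ofReal ((((intervalIntegral.continuous_primitive
        hf.intervalIntegrable t).abs).pow 2).tendsto' _ _ (by simp))
    exact tendsto_of_tendsto_of_tendsto_of_le_of_le tendsto_const_nhds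
      (h1.mono_left nhdsWithin_le_nhds) (fun _ => zero_le) (transportCost_map_le hf hfk t₀ · t)
  init := by
    have : (flowProd (fun t x => avg b x (μ t)) t₀ t₀ : Eucl d₁ × Eucl d₂ → _) = id := by
      ext1 z; simp [flowProd, hf.flow_self]
    rw [this, Measure.map_id]
  weak φ hφ t₁ ht₁ := by
    have := hγ.1
    exact flowProd_weak hf hfk hφ ht₁.1

end PushForward

/-! ### Propagation of the third moment along weak solutions. -/

section Moments

variable {d₁ d₂ m : ℕ}

/-- The Japanese bracket `(1 + |x|² + |y|²)^{1/2}`. -/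
def bracket (z : Eucl d₁ × Eucl d₂) : ℝ := Real.sqrt (1 + ‖z.1‖ ^ 2 + ‖z.2‖ ^ 2)

theorem bracket_sq (z : Eucl d₁ × Eucl d₂) : bracket z ^ 2 = 1 + ‖z.1‖ ^ 2 + ‖z.2‖ ^ 2 :=
  Real.sq_sqrt (by positivity)

theorem one_le_bracket (z : Eucl d₁ × Eucl d₂) : 1 ≤ bracket z :=
  Real.one_le_sqrt.2 (by nlinarith [sq_nonneg ‖z.1‖, sq_nonneg ‖z.2‖])

theorem norm_fst_le_bracket (z : Eucl d₁ × Eucl d₂) : ‖z.1‖ ≤ bracket z :=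
  Real.le_sqrt_of_sq_le (by nlinarith [sq_nonneg ‖z.2‖])

theorem norm_snd_le_bracket (z : Eucl d₁ × Eucl d₂) : ‖z.2‖ ≤ bracket z :=
  Real.le_sqrt_of_sq_le (by nlinarith [sq_nonneg ‖z.1‖])

theorem contDiff_bracket : ContDiff ℝ 1 (bracket : Eucl d₁ × Eucl d₂ → ℝ) := by
  unfold bracket
  refine ContDiff.sqrt ?_ fun z => by positivity
  exact (contDiff_const.add (contDiff_fst.norm_sq ℝ)).add (contDiff_snd.norm_sq ℝ)

theorem continuous_bracket : Continuous (bracket : Eucl d₁ × Eucl d₂ → ℝ) :=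
  contDiff_bracket.continuous

/-- The bound exceeds 1 because the product carries the sup norm, so both components of a unit
vector may have norm one. -/
theorem norm_fderiv_bracket_le (z : Eucl d₁ × Eucl d₂) : ‖fderiv ℝ bracket z‖ ≤ 2 := by
  have hb := one_le_bracket z
  have h1 : HasFDerivAt (fun w : Eucl d₁ × Eucl d₂ => 1 + ‖w.1‖ ^ 2 + ‖w.2‖ ^ 2)
      ((2 • (innerSL ℝ z.1).comp (ContinuousLinearMap.fst ℝ _ _)) +
        (2 • (innerSL ℝ z.2).comp (ContinuousLinearMap.snd ℝ _ _))) z := by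
    have := ((hasFDerivAt_fst (𝕜 := ℝ) (p := z)).norm_sq.const_add 1).add
      (hasFDerivAt_snd (𝕜 := ℝ) (p := z)).norm_sq
    exact this
  have h2 := h1.sqrt (by positivity)
  have h3 : fderiv ℝ bracket z = _ := h2.fderiv
  rw [h3, norm_smul]
  have h4 : ‖(2 • (innerSL ℝ z.1).comp (ContinuousLinearMap.fst ℝ _ (Eucl d₂))) +
        (2 • (innerSL ℝ z.2).comp (ContinuousLinearMap.snd ℝ (Eucl d₁) _))‖ ≤ 4 * bracket z := by
    refine ContinuousLinearMap.opNorm_le_bound _ (by positivity) fun v => ?_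
    have e : ((2 • (innerSL ℝ z.1).comp (ContinuousLinearMap.fst ℝ _ (Eucl d₂))) +
        (2 • (innerSL ℝ z.2).comp (ContinuousLinearMap.snd ℝ (Eucl d₁) _))) v =
        2 * inner ℝ z.1 v.1 + 2 * inner ℝ z.2 v.2 := by
      simp [two_smul, two_mul]
    rw [e]
    have a1 := (abs_real_inner_le_norm z.1 v.1).trans (mul_le_mul (norm_fst_le_bracket z)
      (norm_fst_le v) (norm_nonneg _) (by positivity))
    have a2 := (abs_real_inner_le_norm z.2 v.2).trans (mul_le_mul (norm_snd_le_bracket z)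
      (norm_snd_le v) (norm_nonneg _) (by positivity))
    rw [abs_le] at a1 a2
    rw [Real.norm_eq_abs, abs_le]
    constructor <;> linarith
  have h5 : ‖1 / (2 * Real.sqrt (1 + ‖z.1‖ ^ 2 + ‖z.2‖ ^ 2))‖ = 1 / (2 * bracket z) := by
    rw [Real.norm_of_nonneg (by positivity)]; rfl
  rw [h5]
  calc _ ≤ 1 / (2 * bracket z) * (4 * bracket z) := mul_le_mul_of_nonneg_left h4 (by positivity)
    _ = 2 := by field_simp; norm_num

/-- A bounded approximation of the third power of the bracket. -/
def cutBracket (δ : ℝ) (z : Eucl d₁ × Eucl d₂) : ℝ := bracket z ^ 3 / (1 + δ * bracket z ^ 3)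

variable {δ : ℝ}

theorem cutBracket_nonneg (hδ : 0 ≤ δ) (z : Eucl d₁ × Eucl d₂) : 0 ≤ cutBracket δ z := by
  have := one_le_bracket z
  unfold cutBracket; positivity

theorem cutBracket_le (hδ : 0 ≤ δ) (z : Eucl d₁ × Eucl d₂) : cutBracket δ z ≤ bracket z ^ 3 := by
  have := one_le_bracket z
  exact div_le_self (by positivity) (le_add_of_nonneg_right (by positivity))

theorem cutBracket_le_inv (hδ : 0 < δ) (z : Eucl d₁ × Eucl d₂) : cutBracket δ z ≤ δ⁻¹ := by
  have := one_le_bracket z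
  unfold cutBracket
  rw [div_le_iff₀ (by positivity), mul_add, inv_mul_cancel_left₀ hδ.ne']
  have : 0 ≤ δ⁻¹ * 1 := by positivity
  linarith

theorem contDiff_cutBracket (hδ : 0 ≤ δ) :
    ContDiff ℝ 1 (cutBracket δ : Eucl d₁ × Eucl d₂ → ℝ) := by
  unfold cutBracket
  refine (contDiff_bracket.pow 3).div (contDiff_const.add
    (contDiff_const.mul (contDiff_bracket.pow 3))) fun z => ?_
  have := one_le_bracket z
  positivity

/-- The cutoff keeps the gradient bounded by a multiple of the function itself, with a factor
independent of `δ`. Hence Gronwall's constant is uniform as the cutoff is removed. -/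
theorem norm_fderiv_cutBracket_le (hδ : 0 ≤ δ) (z : Eucl d₁ × Eucl d₂) :
    ‖fderiv ℝ (cutBracket δ) z‖ ≤ 6 * cutBracket δ z := by
  have hb := one_le_bracket z
  set r := bracket z with hr
  have hden : 1 ≤ 1 + δ * r ^ 3 := le_add_of_nonneg_right (by positivity)
  have h1 : HasDerivAt (fun r : ℝ => r ^ 3 / (1 + δ * r ^ 3))
      (3 * r ^ 2 / (1 + δ * r ^ 3) ^ 2) r := by
    have h2 : HasDerivAt (fun r : ℝ => r ^ 3) (3 * r ^ 2) r := by simpa using hasDerivAt_pow 3 r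
    have := h2.div ((h2.const_mul δ).const_add 1) (by positivity)
    refine this.congr_deriv ?_
    congr 1; ring
  have h2 : HasFDerivAt (cutBracket δ) ((3 * r ^ 2 / (1 + δ * r ^ 3) ^ 2) • fderiv ℝ bracket z) z :=
    HasDerivAt.comp_hasFDerivAt (h₂ := fun r : ℝ => r ^ 3 / (1 + δ * r ^ 3)) z h1
      (contDiff_bracket.differentiable one_ne_zero z).hasFDerivAt
  rw [h2.fderiv, norm_smul, Real.norm_of_nonneg (by positivity)]
  calc _ ≤ 3 * r ^ 2 / (1 + δ * r ^ 3) ^ 2 * 2 :=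
        mul_le_mul_of_nonneg_left (norm_fderiv_bracket_le z) (by positivity)
    _ = 6 * (r ^ 2 / (1 + δ * r ^ 3) ^ 2) := by ring
    _ ≤ 6 * (r ^ 3 / (1 + δ * r ^ 3)) := by
        refine mul_le_mul_of_nonneg_left ?_ (by norm_num)
        refine div_le_div₀ (by positivity) (pow_le_pow_right₀ hb (by norm_num)) (by positivity) ?_
        exact le_self_pow₀ hden two_ne_zero

theorem isTest_cutBracket (hδ : 0 < δ) :
    IsTest fun (_ : ℝ) (z : Eucl d₁ × Eucl d₂) => cutBracket δ z := by
  have hc : ContDiff ℝ 1 (Function.uncurry fun (_ : ℝ) (z : Eucl d₁ × Eucl d₂) =>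
    cutBracket δ z) := (contDiff_cutBracket hδ.le).comp contDiff_snd
  refine ⟨hc, 6 * δ⁻¹, fun p => ⟨?_, ?_⟩⟩
  · simp only [Function.uncurry]
    rw [abs_of_nonneg (cutBracket_nonneg hδ.le _)]
    have h1 := cutBracket_le_inv hδ p.2
    have : 0 < δ⁻¹ := by positivity
    linarith
  · have h1 : HasFDerivAt (Function.uncurry fun (_ : ℝ) (z : Eucl d₁ × Eucl d₂) => cutBracket δ z)
        ((fderiv ℝ (cutBracket δ) p.2).comp (ContinuousLinearMap.snd ℝ ℝ _)) p :=
      (((contDiff_cutBracket hδ.le).differentiable one_ne_zero p.2).hasFDerivAt).comp p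
        hasFDerivAt_snd
    rw [h1.fderiv]
    refine (ContinuousLinearMap.opNorm_comp_le _ _).trans ?_
    have h2 := ContinuousLinearMap.norm_snd_le (𝕜 := ℝ) (E := ℝ) (F := Eucl d₁ × Eucl d₂)
    have h3 := (norm_fderiv_cutBracket_le hδ.le p.2).trans
      (mul_le_mul_of_nonneg_left (cutBracket_le_inv hδ p.2) (by norm_num))
    exact (mul_le_of_le_one_right (norm_nonneg _) h2).trans h3

theorem bracket_pow_three_le (z : Eucl d₁ × Eucl d₂) :
    bracket z ^ 3 ≤ 4 * (1 + normPow 3 z) := by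
  rw [normPow_three]
  set ρ := Real.sqrt (‖z.1‖ ^ 2 + ‖z.2‖ ^ 2) with hρ
  have hρ0 : 0 ≤ ρ := Real.sqrt_nonneg _
  have hρ2 : ρ ^ 2 = ‖z.1‖ ^ 2 + ‖z.2‖ ^ 2 := Real.sq_sqrt (by positivity)
  have h1 : bracket z ≤ 1 + ρ := by
    refine Real.sqrt_le_iff.2 ⟨by positivity, ?_⟩
    nlinarith
  refine (pow_le_pow_left₀ (by linarith [one_le_bracket z]) h1 3).trans ?_
  nlinarith [mul_nonneg (add_nonneg zero_le_one hρ0) (sq_nonneg (ρ - 1))]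

theorem integrable_bracket_pow_three {γ : Measure (Eucl d₁ × Eucl d₂)} (hγ : IsPp 3 γ) :
    Integrable (fun z => bracket z ^ 3) γ := by
  have := hγ.1
  refine (((integrable_const 1).add hγ.2).const_mul 4).mono'
    (continuous_bracket.pow 3).aestronglyMeasurable (Eventually.of_forall fun z => ?_)
  have := one_le_bracket z
  rw [Real.norm_of_nonneg (by positivity)]
  exact bracket_pow_three_le z

variable {b : Eucl d₁ → Eucl m → Eucl d₁} {μ : ℝ → Measure (Eucl m)} {k : ℝ → ℝ} {t₀ T : ℝ}
  {γ₀ : Measure (Eucl d₁ × Eucl d₂)} {γ : ℝ → Measure (Eucl d₁ × Eucl d₂)}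

/-- The truncated bracket is an admissible test function, and its integral grows at rate at most `6
* k`. Boundedness by `δ⁻¹` provides the a priori bound that Gronwall needs, so the estimate holds
for an arbitrary weak solution. -/
theorem SolvesContinuity.integral_cutBracket_le (h : SolvesContinuity b t₀ T γ₀ μ γ)
    (hk : Integrable k) (hk0 : ∀ t, 0 ≤ k t) (hbk : ∀ t x, ‖avg b x (μ t)‖ ≤ k t)
    (hγ₀ : IsPp 3 γ₀) (hδ : 0 < δ) {t : ℝ} (ht : t ∈ Icc t₀ T) :
    ∫ z, cutBracket δ z ∂(γ t) ≤ 2 * (∫ z, bracket z ^ 3 ∂γ₀) * Real.exp (12 * ∫ r, k r) := by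
  have hp₀ := hγ₀.1
  have hint : ∀ (ρ : Measure (Eucl d₁ × Eucl d₂)) [IsProbabilityMeasure ρ],
      Integrable (cutBracket δ) ρ := fun ρ _ =>
    (integrable_const δ⁻¹).mono' (contDiff_cutBracket hδ.le).continuous.aestronglyMeasurable
      (Eventually.of_forall fun z => by
        rw [Real.norm_of_nonneg (cutBracket_nonneg hδ.le z)]; exact cutBracket_le_inv hδ z)
  have hm0 : 0 ≤ ∫ z, bracket z ^ 3 ∂γ₀ := integral_nonneg fun z => by
    have := one_le_bracket z; positivity
  have hk6 : ∀ a b, IntervalIntegrable (fun r => 6 * k r) volume a b := fun a b =>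
    hk.intervalIntegrable.const_mul 6
  have h60 : ∀ r, 0 ≤ 6 * k r := fun r => mul_nonneg (by norm_num) (hk0 r)
  have key := gronwall_weight (k := fun r => 6 * k r) (s := t₀) (I := Icc t₀ T)
    (m := fun r => ∫ z, cutBracket δ z ∂(γ r)) (B := δ⁻¹) hk6 h60 ?_ hm0 ?_ t ht
  · refine key.trans (mul_le_mul_of_nonneg_left ?_ (by positivity))
    refine (weight_le (hk.const_mul 6) h60 t₀ t).trans_eq ?_
    rw [integral_const_mul]; congr 1; ring
  · intro r hr
    have := (h.mem r hr).1
    refine (integral_mono (hint (γ r)) (integrable_const δ⁻¹) (cutBracket_le_inv hδ)).trans_eq ?_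
    simp
  · intro S hS hSw s hs
    have hw := h.weak _ (isTest_cutBracket hδ) s hs
    simp only [deriv_const, zero_add] at hw
    have h1 : ∫ z, cutBracket δ z ∂γ₀ ≤ ∫ z, bracket z ^ 3 ∂γ₀ :=
      integral_mono (hint γ₀) (integrable_bracket_pow_three hγ₀) (cutBracket_le hδ.le)
    have h2 := norm_intervalIntegral_le_abs (s := t₀) (t := s)
      (v := fun r => ∫ z, inner ℝ (avg b z.1 (μ r)) (gradX (cutBracket δ) z) ∂(γ r))
      (k := fun r => S * (6 * k r * weight (fun r => 6 * k r) t₀ r))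
      (fun a b => (intervalIntegrable_mul_weight hk6 t₀ a b).const_mul S) ?_
    · rw [intervalIntegral.integral_const_mul, abs_mul, abs_of_nonneg hS] at h2
      have h3 := (le_abs_self _).trans h2
      linarith
    intro r hr
    rw [uIcc_of_le hs.1] at hr
    have hr' : r ∈ Icc t₀ T := ⟨hr.1, hr.2.trans hs.2⟩
    have := (h.mem r hr').1
    have h4 : ‖∫ z, inner ℝ (avg b z.1 (μ r)) (gradX (cutBracket δ) z) ∂(γ r)‖ ≤
        ∫ z, 6 * k r * cutBracket δ z ∂(γ r) := by
      refine norm_integral_le_of_norm_le ((hint (γ r)).const_mul _)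
        (Eventually.of_forall fun z => ?_)
      refine (norm_inner_le_norm _ _).trans ?_
      have h5 := (norm_gradX_le ((contDiff_cutBracket hδ.le).differentiable one_ne_zero z)).trans
        (norm_fderiv_cutBracket_le hδ.le z)
      refine (mul_le_mul (hbk r z.1) h5 (norm_nonneg _) (hk0 r)).trans_eq ?_
      ring
    rw [integral_const_mul] at h4
    refine h4.trans ((mul_le_mul_of_nonneg_left (hSw r hr') (h60 r)).trans_eq ?_)
    ring

/-- Propagation of the third moment along solutions of the continuity equation. -/
theorem SolvesContinuity.integral_bracket_le (h : SolvesContinuity b t₀ T γ₀ μ γ)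
    (hk : Integrable k) (hk0 : ∀ t, 0 ≤ k t) (hbk : ∀ t x, ‖avg b x (μ t)‖ ≤ k t)
    (hγ₀ : IsPp 3 γ₀) {t : ℝ} (ht : t ∈ Icc t₀ T) :
    Integrable (fun z => bracket z ^ 3) (γ t) ∧ ∫ z, bracket z ^ 3 ∂(γ t) ≤
      2 * (∫ z, bracket z ^ 3 ∂γ₀) * Real.exp (12 * ∫ r, k r) := by
  have hp := (h.mem t ht).1
  set M := 2 * (∫ z, bracket z ^ 3 ∂γ₀) * Real.exp (12 * ∫ r, k r) with hM
  have hb0 : ∀ z : Eucl d₁ × Eucl d₂, 0 ≤ bracket z ^ 3 := fun z => by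
    have := one_le_bracket z; positivity
  have hM0 : 0 ≤ M := mul_nonneg (mul_nonneg two_pos.le (integral_nonneg hb0)) (Real.exp_nonneg _)
  have hl : ∫⁻ z, ENNReal.ofReal (bracket z ^ 3) ∂(γ t) ≤ ENNReal.ofReal M := by
    have hδ : ∀ n : ℕ, 0 < (1 : ℝ) / (n + 1) := fun n => by positivity
    have hlim : ∀ z : Eucl d₁ × Eucl d₂, Tendsto
        (fun n : ℕ => ENNReal.ofReal (cutBracket (1 / (n + 1)) z)) atTop
        (𝓝 (ENNReal.ofReal (bracket z ^ 3))) := fun z => by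
      refine ENNReal.tendsto_ofReal ?_
      have h1 : Tendsto (fun n : ℕ => bracket z ^ 3 / (1 + (1 / ((n : ℝ) + 1)) * bracket z ^ 3))
          atTop (𝓝 (bracket z ^ 3 / (1 + 0 * bracket z ^ 3))) := by
        refine tendsto_const_nhds.div (tendsto_const_nhds.add
          (tendsto_one_div_add_atTop_nhds_zero_nat.mul_const _)) (by simp)
      rw [zero_mul, add_zero, div_one] at h1
      exact h1
    -- Fatou's lemma along `δ = 1 / (n + 1)`, the bounds being uniform in `n`.
    calc ∫⁻ z, ENNReal.ofReal (bracket z ^ 3) ∂(γ t)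
        = ∫⁻ z, liminf (fun n : ℕ => ENNReal.ofReal (cutBracket (1 / (n + 1)) z)) atTop ∂(γ t) :=
          lintegral_congr fun z => (hlim z).liminf_eq.symm
      _ ≤ liminf (fun n : ℕ => ∫⁻ z, ENNReal.ofReal (cutBracket (1 / (n + 1)) z) ∂(γ t)) atTop :=
          lintegral_liminf_le fun n =>
            (contDiff_cutBracket (hδ n).le).continuous.measurable.ennreal_ofReal
      _ ≤ liminf (fun _ : ℕ => ENNReal.ofReal M) atTop := by
          refine liminf_le_liminf (Eventually.of_forall fun n => ?_)
          rw [← ofReal_integral_eq_lintegral_ofReal]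
          · exact ENNReal.ofReal_le_ofReal (h.integral_cutBracket_le hk hk0 hbk hγ₀ (hδ n) ht)
          · exact (integrable_const (1 / ((n : ℝ) + 1))⁻¹).mono'
              (contDiff_cutBracket (hδ n).le).continuous.aestronglyMeasurable
              (Eventually.of_forall fun z => by
                rw [Real.norm_of_nonneg (cutBracket_nonneg (hδ n).le z)]
                exact cutBracket_le_inv (hδ n) z)
          · exact Eventually.of_forall (cutBracket_nonneg (hδ n).le)
      _ = _ := by simp
  have hmeas : AEStronglyMeasurable (fun z : Eucl d₁ × Eucl d₂ => bracket z ^ 3) (γ t) :=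
    (continuous_bracket.pow 3).aestronglyMeasurable
  constructor
  · refine ⟨hmeas, ?_⟩
    rw [hasFiniteIntegral_iff_ofReal (Eventually.of_forall hb0)]
    exact hl.trans_lt ENNReal.ofReal_lt_top
  · rw [integral_eq_lintegral_of_nonneg_ae (Eventually.of_forall hb0) hmeas]
    exact ENNReal.toReal_le_of_le_ofReal hM0 hl

end Moments

/-! ### Changing the control on a null set of times. -/

section Congruence

variable {d₁ d₂ m : ℕ} {b : Eucl d₁ → Eucl m → Eucl d₁} {L : Eucl d₁ × Eucl d₂ → ℝ}
  {ν μ : ℝ → Measure (Eucl m)} {t₀ T : ℝ}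

theorem integral_congr_of_ae_Icc {F : Type*} [NormedAddCommGroup F] [NormedSpace ℝ F]
    {g h : ℝ → F} {s t : ℝ} (hs : s ∈ Icc t₀ T) (ht : t ∈ Icc t₀ T)
    (hνμ : ∀ᵐ r, r ∈ Icc t₀ T → ν r = μ r) (hgh : ∀ r, ν r = μ r → g r = h r) :
    ∫ r in s..t, g r = ∫ r in s..t, h r := by
  refine intervalIntegral.integral_congr_ae ?_
  filter_upwards [hνμ] with r hr hrs
  exact hgh r (hr (uIcc_subset_Icc hs ht (uIoc_subset_uIcc hrs)))

/-- The control enters only through integrals over time. This permits replacing it by one with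
finite fourth moments at every time, and returning to the original control afterwards. -/
theorem SolvesTransport.congr {u : ℝ → Eucl d₁ × Eucl d₂ → ℝ}
    (hνμ : ∀ᵐ r, r ∈ Icc t₀ T → ν r = μ r) (h : SolvesTransport b L t₀ T ν u) :
    SolvesTransport b L t₀ T μ u := by
  refine ⟨h.mem, h.holder, fun t ht z => ?_⟩
  rw [h.eqn t ht z, integral_congr_of_ae_Icc ht (right_mem_Icc.2 (ht.1.trans ht.2)) hνμ]
  intro r hr
  rw [hr]

theorem SolvesContinuity.congr {γ₀ : Measure (Eucl d₁ × Eucl d₂)}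
    {γ : ℝ → Measure (Eucl d₁ × Eucl d₂)}
    (hνμ : ∀ᵐ r, r ∈ Icc t₀ T → ν r = μ r) (h : SolvesContinuity b t₀ T γ₀ ν γ) :
    SolvesContinuity b t₀ T γ₀ μ γ := by
  refine ⟨h.mem, h.cont, h.init, fun φ hφ t ht => ?_⟩
  rw [h.weak φ hφ t ht, integral_congr_of_ae_Icc (left_mem_Icc.2 (ht.1.trans ht.2)) ht hνμ]
  intro r hr
  rw [hr]

end Congruence

/-! ### Convexity from Hessian bounds, and integrability of log-concave densities. -/

section Convexity

variable {E : Type*} [NormedAddCommGroup E] [InnerProductSpace ℝ E]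

theorem convexOn_univ_of_line {F : E → ℝ}
    (h : ∀ a v : E, ConvexOn ℝ univ fun t : ℝ => F (a + t • v)) : ConvexOn ℝ univ F := by
  refine ⟨convex_univ, fun x _ y _ p q hp hq hpq => ?_⟩
  have := (h x (y - x)).2 (mem_univ 0) (mem_univ 1) hp hq hpq
  have e : x + (p • (0 : ℝ) + q • (1 : ℝ)) • (y - x) = p • x + q • y := by
    rw [smul_zero, zero_add, smul_eq_mul, mul_one, smul_sub, ← add_sub_assoc, add_sub_right_comm]
    congr 1
    rw [eq_sub_iff_add_eq.2 hpq, sub_smul, one_smul]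
  simpa only [e, zero_smul, one_smul, add_zero, add_sub_cancel] using this

theorem hasDerivAt_line (a v : E) (t : ℝ) : HasDerivAt (fun t : ℝ => a + t • v) v t := by
  simpa using ((hasDerivAt_id t).smul_const v).const_add a

/-- Convexity from a lower bound of the Hessian by that of a polynomial in the norm. -/
theorem convexOn_add_norm_pow {F : E → ℝ} (hF : ContDiff ℝ 2 F) {α β : ℝ}
    (h : ∀ a v : E, 0 ≤ iteratedFDeriv ℝ 2 F a ![v, v] + α * ‖v‖ ^ 2 +
      β * (‖a‖ ^ 2 * ‖v‖ ^ 2 + 2 * (inner ℝ a v) ^ 2)) :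
    ConvexOn ℝ univ fun a => F a + α / 2 * ‖a‖ ^ 2 + β / 4 * ‖a‖ ^ 4 := by
  refine convexOn_univ_of_line fun a v => ?_
  have hF1 : ContDiff ℝ 1 (fderiv ℝ F) := hF.fderiv_right (by norm_num)
  have d1 : ∀ t : ℝ, HasDerivAt (fun t : ℝ => F (a + t • v)) (fderiv ℝ F (a + t • v) v) t :=
    fun t => (hF.differentiable two_ne_zero _).hasFDerivAt.comp_hasDerivAt t (hasDerivAt_line a v t)
  have d2 : ∀ t : ℝ, HasDerivAt (fun t : ℝ => fderiv ℝ F (a + t • v) v)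
      (iteratedFDeriv ℝ 2 F (a + t • v) ![v, v]) t := fun t => by
    have := (hF1.differentiable one_ne_zero (a + t • v)).hasFDerivAt.comp_hasDerivAt t
      (hasDerivAt_line a v t)
    have := this.clm_apply (hasDerivAt_const t v)
    simpa [iteratedFDeriv_two_apply] using this
  have n1 : ∀ t : ℝ, HasDerivAt (fun t : ℝ => ‖a + t • v‖ ^ 2) (2 * inner ℝ (a + t • v) v) t :=
    fun t => (hasDerivAt_line a v t).norm_sq
  have n2 : ∀ t : ℝ, HasDerivAt (fun t : ℝ => 2 * inner ℝ (a + t • v) v) (2 * ‖v‖ ^ 2) t :=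
    fun t => by
      have := ((hasDerivAt_line a v t).inner ℝ (hasDerivAt_const t v)).const_mul 2
      simpa [real_inner_self_eq_norm_sq] using this
  have e1 : ∀ t : ℝ, HasDerivAt (fun t : ℝ => F (a + t • v) + α / 2 * ‖a + t • v‖ ^ 2 +
      β / 4 * ‖a + t • v‖ ^ 4) (fderiv ℝ F (a + t • v) v + α / 2 * (2 * inner ℝ (a + t • v) v) +
      β / 4 * (2 * ‖a + t • v‖ ^ 2 * (2 * inner ℝ (a + t • v) v))) t := fun t => by
    have h4 : (fun t : ℝ => ‖a + t • v‖ ^ 4) = fun t : ℝ => (‖a + t • v‖ ^ 2) ^ 2 := by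
      ext t; rw [← pow_mul]
    have := ((n1 t).pow 2).const_mul (β / 4)
    have h5 := ((d1 t).add ((n1 t).const_mul (α / 2))).add this
    refine (h5.congr_of_eventuallyEq (Eventually.of_forall fun t => ?_)).congr_deriv ?_
    · simp [← pow_mul]
    · simp
  have e2 : ∀ t : ℝ, HasDerivAt (fun t : ℝ => fderiv ℝ F (a + t • v) v +
      α / 2 * (2 * inner ℝ (a + t • v) v) +
      β / 4 * (2 * ‖a + t • v‖ ^ 2 * (2 * inner ℝ (a + t • v) v)))
      (iteratedFDeriv ℝ 2 F (a + t • v) ![v, v] + α * ‖v‖ ^ 2 +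
      β * (‖a + t • v‖ ^ 2 * ‖v‖ ^ 2 + 2 * (inner ℝ (a + t • v) v) ^ 2)) t := fun t => by
    refine (((d2 t).add ((n2 t).const_mul (α / 2))).add
      ((((n1 t).const_mul 2).mul (n2 t)).const_mul (β / 4))).congr_deriv ?_
    ring
  refine convexOn_of_hasDerivWithinAt2_nonneg convex_univ
    (fun t _ => (e1 t).continuousAt.continuousWithinAt) (fun t _ => (e1 t).hasDerivWithinAt)
    (fun t _ => (e2 t).hasDerivWithinAt) fun t _ => h _ _

/-- A convex function is bounded from below by an affine function of the norm. -/
theorem _root_.ConvexOn.exists_affine_le_norm [FiniteDimensional ℝ E] {g : E → ℝ}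
    (hg : ConvexOn ℝ univ g) : ∃ A, 0 ≤ A ∧ ∀ a, -(A * (1 + ‖a‖)) ≤ g a := by
  have hc : Continuous g := continuousOn_univ.1 (hg.continuousOn isOpen_univ)
  obtain ⟨M, hM⟩ := (isCompact_closedBall (0 : E) 1).exists_bound_of_continuousOn hc.continuousOn
  have hM0 : 0 ≤ M := (norm_nonneg _).trans (hM 0 (by simp))
  refine ⟨2 * M, by positivity, fun a => ?_⟩
  rcases le_or_gt ‖a‖ 1 with h | h
  · have := (abs_le.1 (hM a (by simpa using h))).1
    have := mul_nonneg hM0 (norm_nonneg a)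
    linarith
  · set r := ‖a‖ with hr
    -- The origin is a convex combination of `a` and of the unit vector opposite to it, with weights
    -- `1 / (1 + r)` and `r / (1 + r)`. Bounds for `g` on the unit ball then give a lower bound at
    -- `a`.
    have hr0 : 0 < r := by linarith
    have h1 := hg.2 (mem_univ (-(r⁻¹ • a))) (mem_univ a)
      (by positivity : 0 ≤ r / (1 + r)) (by positivity : 0 ≤ 1 / (1 + r)) (by field_simp; ring)
    have h2 : (r / (1 + r)) • -(r⁻¹ • a) + (1 / (1 + r)) • a = 0 := by
      rw [smul_neg, smul_smul, neg_add_eq_zero]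
      congr 1
      field_simp
    have h3 := (abs_le.1 (hM 0 (by simp))).1
    have h4 := (abs_le.1 (hM (-(r⁻¹ • a)) (by
      rw [mem_closedBall_zero_iff, norm_neg, norm_smul, norm_inv, Real.norm_of_nonneg hr0.le, ← hr,
        inv_mul_cancel₀ hr0.ne']))).2
    rw [h2, smul_eq_mul, smul_eq_mul] at h1
    have h5 : (1 + r) * g 0 ≤ r * g (-(r⁻¹ • a)) + g a := by
      have := mul_le_mul_of_nonneg_left h1 (by positivity : 0 ≤ 1 + r)
      refine this.trans_eq ?_
      field_simp
    have h6 := mul_le_mul_of_nonneg_left h3 (by positivity : 0 ≤ 1 + r)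
    have h7 := mul_le_mul_of_nonneg_left h4 hr0.le
    nlinarith

theorem integrable_exp_neg_mul_norm_sq {m : ℕ} {c : ℝ} (hc : 0 < c) :
    Integrable fun a : Eucl m => Real.exp (-c * ‖a‖ ^ 2) := by
  have := (GaussianFourier.integrable_cexp_neg_mul_sq_norm_add (V := Eucl m) (b := (c : ℂ))
    (by simpa using hc) 0 0).re
  refine this.congr (Eventually.of_forall fun a => ?_)
  simp only [zero_mul, add_zero]
  have : (-(c : ℂ) * (‖a‖ : ℂ) ^ 2) = ((-c * ‖a‖ ^ 2 : ℝ) : ℂ) := by push_cast; ring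
  rw [this, ← Complex.ofReal_exp]
  rfl

/-- The exponential of minus a strongly convex function is integrable. -/
theorem integrable_exp_neg_of_convexOn {m : ℕ} {c : ℝ} (hc : 0 < c) {g : Eucl m → ℝ}
    (hg : ConvexOn ℝ univ g) : Integrable fun a : Eucl m => Real.exp (-(g a + c * ‖a‖ ^ 2)) := by
  have hgc : Continuous g := continuousOn_univ.1 (hg.continuousOn isOpen_univ)
  obtain ⟨A, hA0, hA⟩ := hg.exists_affine_le_norm
  refine ((integrable_exp_neg_mul_norm_sq (m := m) (half_pos hc)).const_mul
    (Real.exp (A + A ^ 2 / (2 * c)))).mono' (by fun_prop) (Eventually.of_forall fun a => ?_)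
  rw [Real.norm_of_nonneg (Real.exp_nonneg _), ← Real.exp_add]
  refine Real.exp_le_exp.2 ?_
  have h1 := hA a
  have h2 : A * ‖a‖ ≤ A ^ 2 / (2 * c) + c / 2 * ‖a‖ ^ 2 := by
    have : A ^ 2 / (2 * c) + c / 2 * ‖a‖ ^ 2 - A * ‖a‖ = (A - c * ‖a‖) ^ 2 / (2 * c) := by
      field_simp; ring
    have : 0 ≤ (A - c * ‖a‖) ^ 2 / (2 * c) := by positivity
    linarith
  linarith

end Convexity

/-! ### Convexity of the prior potential and of the averaged interaction. -/

section Potential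

variable {d₁ d₂ m : ℕ} {b : Eucl d₁ → Eucl m → Eucl d₁} {C c : ℝ} {ℓ : Eucl m → ℝ}

/-- The Hessian of `c / 12 * ‖a‖ ^ 4` in the direction `v` is `c / 3 * (|a|² |v|² + 2 ⟨a, v⟩²)`,
which is at most `c |a|² |v|²` by Cauchy-Schwarz. This explains the coefficient `c / 12`. -/
theorem convexOn_prior_potential (hℓ : ContDiff ℝ 2 ℓ)
    (h : ∀ a v : Eucl m, c * (1 + ‖a‖ ^ 2) * ‖v‖ ^ 2 ≤ iteratedFDeriv ℝ 2 ℓ a ![v, v])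
    (hc : 0 ≤ c) :
    ConvexOn ℝ univ fun a => ℓ a - c / 2 * ‖a‖ ^ 2 - c / 12 * ‖a‖ ^ 4 := by
  have := convexOn_add_norm_pow hℓ (α := -c) (β := -(c / 3)) fun a v => ?_
  · refine this.congr fun a _ => ?_
    beta_reduce
    ring
  have h1 := h a v
  have h2 : (inner ℝ a v) ^ 2 ≤ ‖a‖ ^ 2 * ‖v‖ ^ 2 := by
    rw [← mul_pow, ← sq_abs]
    exact pow_le_pow_left₀ (abs_nonneg _) (abs_real_inner_le_norm a v) 2
  have := mul_le_mul_of_nonneg_left h2 hc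
  linarith

/-- The Hessian in `a` is at least `-N (1 + |a|)`, and Young's inequality `|a| ≤ 1 / (4 β) + β |a|²`
lets that of the added polynomial absorb it. The free `β` later makes the quartic coefficient a
fraction of the one supplied by `ℓ`. -/
theorem FieldBounds.convexOn_inner (hb : FieldBounds b C) (x p : Eucl d₁) {β : ℝ} (hβ : 0 < β) :
    ConvexOn ℝ univ fun a => inner ℝ (b x a) p + C * (1 + ‖x‖ ^ 2) * ‖p‖ *
      ((1 + 1 / (4 * β)) / 2 * ‖a‖ ^ 2 + β / 4 * ‖a‖ ^ 4) := by
  set N := C * (1 + ‖x‖ ^ 2) * ‖p‖ with hN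
  have hC := hb.nonneg
  have hN0 : 0 ≤ N := by positivity
  have hbx : ContDiff ℝ 2 (b x) := hb.contDiff.comp (contDiff_const.prodMk contDiff_id)
  have hF : ContDiff ℝ 2 fun a => inner ℝ (b x a) p := hbx.inner ℝ contDiff_const
  have := convexOn_add_norm_pow hF (α := N * (1 + 1 / (4 * β))) (β := N * β) fun a v => ?_
  · refine this.congr fun a _ => ?_
    beta_reduce
    ring
  have e : (fun a => inner ℝ (b x a) p) = innerSL ℝ p ∘ b x := by
    ext a; rw [Function.comp_apply, innerSL_apply_apply, real_inner_comm]
  have h1 : |iteratedFDeriv ℝ 2 (fun a => inner ℝ (b x a) p) a ![v, v]| ≤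
      N * (1 + ‖a‖) * ‖v‖ ^ 2 := by
    rw [e, ContinuousLinearMap.iteratedFDeriv_comp_left _ hbx.contDiffAt le_rfl,
      ContinuousLinearMap.compContinuousMultilinearMap_coe, Function.comp_apply,
      innerSL_apply_apply]
    have h2 := (iteratedFDeriv ℝ 2 (b x) a).le_opNorm ![v, v]
    rw [Fin.prod_univ_two] at h2
    simp only [Matrix.cons_val_zero, Matrix.cons_val_one] at h2
    have h3 := h2.trans (mul_le_mul_of_nonneg_right (hb.hess_bound x a) (by positivity))
    refine (abs_real_inner_le_norm _ _).trans
      ((mul_le_mul_of_nonneg_left h3 (norm_nonneg p)).trans_eq ?_)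
    rw [hN]; ring
  have h4 := (abs_le.1 h1).1
  have h5 : 1 + ‖a‖ ≤ (1 + 1 / (4 * β)) + β * ‖a‖ ^ 2 := by
    have : (1 / (4 * β)) + β * ‖a‖ ^ 2 - ‖a‖ = (1 - 2 * β * ‖a‖) ^ 2 / (4 * β) := by
      field_simp; ring
    have : 0 ≤ (1 - 2 * β * ‖a‖) ^ 2 / (4 * β) := by positivity
    linarith
  have h6 := mul_le_mul_of_nonneg_left h5 (mul_nonneg hN0 (sq_nonneg ‖v‖))
  have h7 : 0 ≤ N * β * (inner ℝ a v) ^ 2 := by positivity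
  linarith

/-- Convexity, up to a polynomial, of the averaged interaction. -/
theorem FieldBounds.convexOn_integral_inner (hb : FieldBounds b C)
    {γ : Measure (Eucl d₁ × Eucl d₂)} {p : Eucl d₁ × Eucl d₂ → Eucl d₁}
    (hp : ∀ a, Integrable (fun z => inner ℝ (b z.1 a) (p z)) γ)
    (hp2 : Integrable (fun z => (1 + ‖z.1‖ ^ 2) * ‖p z‖) γ) {β : ℝ} (hβ : 0 < β) {N : ℝ}
    (hN : C * ∫ z, (1 + ‖z.1‖ ^ 2) * ‖p z‖ ∂γ ≤ N) :
    ConvexOn ℝ univ fun a => ∫ z, inner ℝ (b z.1 a) (p z) ∂γ + N *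
      ((1 + 1 / (4 * β)) / 2 * ‖a‖ ^ 2 + β / 4 * ‖a‖ ^ 4) := by
  set I := ∫ z, (1 + ‖z.1‖ ^ 2) * ‖p z‖ ∂γ with hI
  set Q : Eucl m → ℝ := fun a => (1 + 1 / (4 * β)) / 2 * ‖a‖ ^ 2 + β / 4 * ‖a‖ ^ 4 with hQ
  -- Convexity of the integrand passes to the integral, so no differentiation under the integral
  -- sign is needed. The polynomial `Q` is convex as well, which allows its coefficient to be raised
  -- to `N`.
  have h1 : ConvexOn ℝ univ fun a => ∫ z, (inner ℝ (b z.1 a) (p z) +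
      C * (1 + ‖z.1‖ ^ 2) * ‖p z‖ * Q a) ∂γ := by
    refine integral_convexOn_of_integrand_ae
      (f := fun z a => inner ℝ (b z.1 a) (p z) + C * (1 + ‖z.1‖ ^ 2) * ‖p z‖ * Q a) convex_univ
      (Eventually.of_forall fun z => hb.convexOn_inner z.1 (p z) hβ) fun a _ => ?_
    refine (hp a).add (((hp2.const_mul C).mul_const (Q a)).congr
      (Eventually.of_forall fun z => ?_))
    simp only; ring
  have h2 : (fun a => ∫ z, (inner ℝ (b z.1 a) (p z) +
      C * (1 + ‖z.1‖ ^ 2) * ‖p z‖ * Q a) ∂γ) =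
      fun a => ∫ z, inner ℝ (b z.1 a) (p z) ∂γ + C * I * Q a := by
    ext a
    rw [integral_add (hp a), integral_mul_const]
    · simp only [mul_assoc, integral_const_mul, hI]
    · refine ((hp2.const_mul C).mul_const (Q a)).congr (Eventually.of_forall fun z => ?_)
      simp only; ring
  rw [h2] at h1
  have h3 : ConvexOn ℝ univ Q := by
    have := convexOn_add_norm_pow (E := Eucl m) (F := fun _ => (0 : ℝ)) contDiff_const
      (α := 1 + 1 / (4 * β)) (β := β) fun a v => by
        rw [iteratedFDeriv_two_apply]
        have e : fderiv ℝ (fderiv ℝ fun _ : Eucl m => (0 : ℝ)) a = 0 := by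
          simp
        rw [e]
        simp only [_root_.zero_apply]
        positivity
    refine this.congr fun a _ => ?_
    simp [hQ]
  have h4 := h1.add (h3.smul (sub_nonneg.2 hN))
  refine h4.congr fun a _ => ?_
  simp only [Pi.add_apply, smul_eq_mul]
  ring

end Potential

/-! ### Fourth moments of admissible controls from their relative entropy. -/

section Entropy

/-- The entropy inequality. -/
theorem lintegral_le_klDiv_add {α : Type*} [MeasurableSpace α] (ν π : Measure α)
    [IsProbabilityMeasure ν] [IsProbabilityMeasure π] {g : α → ℝ} (hg : Measurable g) :
    ∫⁻ a, ENNReal.ofReal (g a) ∂ν ≤ InformationTheory.klDiv ν π +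
      ∫⁻ a, ENNReal.ofReal (Real.exp (g a)) ∂π := by
  by_cases hac : ν ≪ π
  swap
  · rw [InformationTheory.klDiv_of_not_ac hac, top_add]; exact le_top
  rw [InformationTheory.klDiv_eq_lintegral_klFun_of_ac hac,
    ← lintegral_add_right _ hg.exp.ennreal_ofReal,
    ← lintegral_rnDeriv_mul hac hg.ennreal_ofReal.aemeasurable]
  refine lintegral_mono_ae ?_
  filter_upwards [Measure.rnDeriv_ne_top ν π] with a ha
  set ρ := (ν.rnDeriv π a).toReal with hρ
  have hρ0 : 0 ≤ ρ := ENNReal.toReal_nonneg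
  -- Young's inequality for the Legendre pair formed by the entropy function and the exponential.
  have h1 : ρ * g a ≤ InformationTheory.klFun ρ + Real.exp (g a) := by
    unfold InformationTheory.klFun
    rcases hρ0.eq_or_lt with h | h
    · rw [← h]
      have := Real.exp_pos (g a)
      simp; linarith
    · have h2 := Real.add_one_le_exp (g a - Real.log ρ)
      rw [Real.exp_sub, Real.exp_log h, le_div_iff₀ h] at h2
      linarith
  rw [← ENNReal.ofReal_add (InformationTheory.klFun_nonneg hρ0) (Real.exp_nonneg _),
    ← ENNReal.ofReal_toReal ha, ← hρ, ← ENNReal.ofReal_mul hρ0]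
  exact ENNReal.ofReal_le_ofReal h1

variable {m : ℕ} {ℓ : Eucl m → ℝ} {c t₀ T : ℝ} {ν : ℝ → Measure (Eucl m)}

theorem integrable_exp_neg_prior_potential (hc : 0 < c)
    (h : ConvexOn ℝ univ fun a => ℓ a - c / 2 * ‖a‖ ^ 2 - c / 12 * ‖a‖ ^ 4) :
    Integrable fun a => Real.exp (-ℓ a + c / 12 * ‖a‖ ^ 4) := by
  refine (integrable_exp_neg_of_convexOn (half_pos hc) h).congr (Eventually.of_forall fun a => ?_)
  simp only
  congr 1; ring

theorem integrable_exp_neg_prior (hℓ : Continuous ℓ) (hc : 0 < c)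
    (h : ConvexOn ℝ univ fun a => ℓ a - c / 2 * ‖a‖ ^ 2 - c / 12 * ‖a‖ ^ 4) :
    Integrable fun a => Real.exp (-ℓ a) := by
  refine (integrable_exp_neg_prior_potential hc h).mono' (by fun_prop)
    (Eventually.of_forall fun a => ?_)
  rw [Real.norm_of_nonneg (Real.exp_nonneg _)]
  exact Real.exp_le_exp.2 (le_add_of_nonneg_right (by positivity))

/-- The entropy inequality is applied with `g = η |a|⁴` and `η = c / 12`. The exponential of `g` is
integrable for the prior because `ℓ - c / 2 |a|² - c / 12 |a|⁴` is convex, hence bounded from below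
by an affine function of the norm. -/
theorem Admissible.lintegral_moment_lt_top (hν : Admissible ℓ t₀ T ν) (hℓ : Continuous ℓ)
    (hc : 0 < c) (h : ConvexOn ℝ univ fun a => ℓ a - c / 2 * ‖a‖ ^ 2 - c / 12 * ‖a‖ ^ 4) :
    ∫⁻ t in Icc t₀ T, ∫⁻ a, ENNReal.ofReal (1 + ‖a‖ ^ 4) ∂(ν t) < ⊤ := by
  have hi := integrable_exp_neg_prior hℓ hc h
  have hπ : IsProbabilityMeasure (prior ℓ) := isProbabilityMeasure_tilted hi
  set η := c / 12 with hη
  have hη0 : 0 < η := by positivity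
  set D := ∫⁻ a, ENNReal.ofReal (Real.exp (η * ‖a‖ ^ 4)) ∂(prior ℓ) with hD
  have hDtop : D < ⊤ := by
    have : Integrable (fun a => Real.exp (η * ‖a‖ ^ 4)) (prior ℓ) := by
      rw [prior, integrable_tilted_iff hi]
      refine (integrable_exp_neg_prior_potential hc h).congr (Eventually.of_forall fun a => ?_)
      simp only [smul_eq_mul, Real.exp_add, hη]
    have := this.2
    rwa [hasFiniteIntegral_iff_ofReal (Eventually.of_forall fun a => Real.exp_nonneg _)] at this
  have hpt : ∀ t ∈ Icc t₀ T, ∫⁻ a, ENNReal.ofReal (1 + ‖a‖ ^ 4) ∂(ν t) ≤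
      1 + ENNReal.ofReal η⁻¹ * (InformationTheory.klDiv (ν t) (prior ℓ) + D) := by
    intro t ht
    have := hν.prob t ht
    have h1 := lintegral_le_klDiv_add (ν t) (prior ℓ) (g := fun a => η * ‖a‖ ^ 4) (by fun_prop)
    have h2 : ∀ a : Eucl m, ENNReal.ofReal (1 + ‖a‖ ^ 4) =
        1 + ENNReal.ofReal η⁻¹ * ENNReal.ofReal (η * ‖a‖ ^ 4) := fun a => by
      rw [← ENNReal.ofReal_mul (by positivity), inv_mul_cancel_left₀ hη0.ne',
        ENNReal.ofReal_add zero_le_one (by positivity), ENNReal.ofReal_one]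
    simp only [h2]
    rw [lintegral_add_left measurable_const, lintegral_const_mul _ (by fun_prop), lintegral_const,
      measure_univ, mul_one]
    gcongr
  calc ∫⁻ t in Icc t₀ T, ∫⁻ a, ENNReal.ofReal (1 + ‖a‖ ^ 4) ∂(ν t)
      ≤ ∫⁻ t in Icc t₀ T, (1 + ENNReal.ofReal η⁻¹ *
        (InformationTheory.klDiv (ν t) (prior ℓ) + D)) := setLIntegral_mono' measurableSet_Icc hpt
    _ = volume (Icc t₀ T) + ENNReal.ofReal η⁻¹ *
        ((∫⁻ t in Icc t₀ T, InformationTheory.klDiv (ν t) (prior ℓ)) + D * volume (Icc t₀ T)) := by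
      rw [lintegral_add_left measurable_const, lintegral_const_mul' _ _ ENNReal.ofReal_ne_top,
        lintegral_add_right _ measurable_const]
      simp
    _ < ⊤ := by
      have hv : volume (Icc t₀ T) < ⊤ := by simp
      refine ENNReal.add_lt_top.2 ⟨hv, ENNReal.mul_lt_top ENNReal.ofReal_lt_top
        (ENNReal.add_lt_top.2 ⟨hν.entropy, ENNReal.mul_lt_top hDtop hv⟩)⟩

/-- An admissible control coincides, at almost all times, with a control that has finite moments
of order four at all times. -/
theorem Admissible.exists_isControlFlow (hν : Admissible ℓ t₀ T ν) (hℓ : Continuous ℓ)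
    (h0T : t₀ ≤ T) (hc : 0 < c)
    (h : ConvexOn ℝ univ fun a => ℓ a - c / 2 * ‖a‖ ^ 2 - c / 12 * ‖a‖ ^ 4) :
    ∃ μ : ℝ → Measure (Eucl m), IsControlFlow μ ∧ (∀ᵐ r, r ∈ Icc t₀ T → ν r = μ r) ∧
      ∫ r, ∫ a, (1 + ‖a‖ ^ 4) ∂(μ r) = (T - t₀) + ∫ t in t₀..T, ∫ a, ‖a‖ ^ 4 ∂(ν t) := by
  classical
  set g : Eucl m → ENNReal := fun a => ENNReal.ofReal (1 + ‖a‖ ^ 4) with hg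
  have hgm : Measurable g := by fun_prop
  let ν₁ : ℝ → Measure (Eucl m) := fun t => if t ∈ Icc t₀ T then ν t else 0
  have hν₁ : Measurable ν₁ := by
    have h1 := (MeasurableEmbedding.subtype_coe (measurableSet_Icc (a := t₀) (b := T))).measurable_extend
      hν.meas (g' := fun _ => 0) measurable_const
    convert h1 using 1
    ext1 t
    by_cases ht : t ∈ Icc t₀ T
    · simp only [ν₁, if_pos ht]
      exact (Subtype.val_injective.extend_apply (fun t : Icc t₀ T => ν t) _ ⟨t, ht⟩).symm
    · simp only [ν₁, if_neg ht]
      rw [Function.extend_apply' _ _ _ (by rintro ⟨s, rfl⟩; exact ht s.2)]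
  have hmom : Measurable fun t => ∫⁻ a, g a ∂(ν₁ t) :=
    (Measure.measurable_lintegral hgm).comp hν₁
  -- The good times are those with a finite fourth moment, and they have full measure in `[t₀, T]`.
  -- At all other times the new control is the zero measure, which is why control flows are only
  -- required to have mass at most one.
  let G : Set ℝ := {t | t ∈ Icc t₀ T ∧ ∫⁻ a, g a ∂(ν₁ t) < ⊤}
  have hG : MeasurableSet G :=
    measurableSet_Icc.inter (measurableSet_lt hmom measurable_const)
  let μ : ℝ → Measure (Eucl m) := fun t => if t ∈ G then ν t else 0
  have hμm : Measurable μ := by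
    have : μ = fun t => if t ∈ G then ν₁ t else 0 := by
      ext1 t
      by_cases ht : t ∈ G
      · simp only [μ, ν₁, if_pos ht, if_pos ht.1]
      · simp only [μ, if_neg ht]
    rw [this]
    exact Measurable.ite hG hν₁ measurable_const
  have hae : ∀ᵐ r, r ∈ Icc t₀ T → ν r = μ r := by
    have h1 : ∀ᵐ r ∂(volume.restrict (Icc t₀ T)), ∫⁻ a, g a ∂(ν₁ r) < ⊤ := by
      refine ae_lt_top hmom (ne_of_lt ?_)
      refine (setLIntegral_congr_fun measurableSet_Icc fun t ht => ?_).trans_lt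
        (hν.lintegral_moment_lt_top hℓ hc h)
      simp only [ν₁, if_pos ht, hg]
    filter_upwards [(ae_restrict_iff' measurableSet_Icc).1 h1] with r hr hrI
    have : r ∈ G := ⟨hrI, hr hrI⟩
    simp only [μ, if_pos this]
  have hnn : ∀ a : Eucl m, 0 ≤ 1 + ‖a‖ ^ 4 := fun a => by positivity
  have hfin : ∀ t, Integrable (fun a : Eucl m => 1 + ‖a‖ ^ 4) (μ t) := by
    intro t
    refine ⟨by fun_prop, ?_⟩
    rw [hasFiniteIntegral_iff_ofReal (Eventually.of_forall hnn)]
    by_cases ht : t ∈ G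
    · have := ht.2
      simp only [μ, if_pos ht]
      simpa only [ν₁, if_pos ht.1] using this
    · simp only [μ, if_neg ht]; simp
  have hmass : ∀ t, μ t univ ≤ 1 := by
    intro t
    by_cases ht : t ∈ G
    · have := hν.prob t ht.1
      simp only [μ, if_pos ht]; exact prob_le_one
    · simp only [μ, if_neg ht]; simp
  have hlin : ∫⁻ t, ∫⁻ a, g a ∂(μ t) ≤
      ∫⁻ t in Icc t₀ T, ∫⁻ a, ENNReal.ofReal (1 + ‖a‖ ^ 4) ∂(ν t) := by
    rw [← lintegral_indicator measurableSet_Icc]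
    refine lintegral_mono fun t => ?_
    by_cases ht : t ∈ G
    · simp only [μ, if_pos ht, indicator_of_mem ht.1]; exact le_rfl
    · simp only [μ, if_neg ht]; simp
  have heq : ∀ t, ENNReal.ofReal (∫ a, (1 + ‖a‖ ^ 4) ∂(μ t)) = ∫⁻ a, g a ∂(μ t) := fun t =>
    ofReal_integral_eq_lintegral_ofReal (hfin t) (Eventually.of_forall hnn)
  have hint : Integrable fun t => ∫ a, (1 + ‖a‖ ^ 4) ∂(μ t) := by
    constructor
    · have : (fun t => ∫ a, (1 + ‖a‖ ^ 4) ∂(μ t)) = fun t => (∫⁻ a, g a ∂(μ t)).toReal := by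
        ext t; rw [← heq t, ENNReal.toReal_ofReal (integral_nonneg hnn)]
      rw [this]
      exact ((Measure.measurable_lintegral hgm).comp hμm).ennreal_toReal.aestronglyMeasurable
    · rw [hasFiniteIntegral_iff_ofReal (Eventually.of_forall fun t => integral_nonneg hnn)]
      simp only [heq]
      exact hlin.trans_lt (hν.lintegral_moment_lt_top hℓ hc h)
  refine ⟨μ, ⟨hμm, hmass, hfin, hint⟩, hae, ?_⟩
  have hzero : ∀ t, t ∉ Icc t₀ T → ∫ a, (1 + ‖a‖ ^ 4) ∂(μ t) = 0 := fun t ht => by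
    have : t ∉ G := fun h => ht h.1
    simp only [μ, if_neg this, integral_zero_measure]
  rw [← setIntegral_eq_integral_of_forall_compl_eq_zero hzero, integral_Icc_eq_integral_Ioc,
    ← intervalIntegral.integral_of_le h0T]
  have hlast : ∫ t in t₀..T, ∫ a, (1 + ‖a‖ ^ 4) ∂(μ t) =
      ∫ t in t₀..T, (1 + ∫ a, ‖a‖ ^ 4 ∂(ν t)) := by
    refine intervalIntegral.integral_congr_ae ?_
    filter_upwards [hae] with t ht htI
    have htI' : t ∈ Icc t₀ T := by
      rw [uIoc_of_le h0T] at htI; exact ⟨htI.1.le, htI.2⟩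
    have hp := hν.prob t htI'
    have hf := hfin t
    rw [← ht htI'] at hf ⊢
    have h4 : Integrable (fun a : Eucl m => ‖a‖ ^ 4) (ν t) := by
      exact (hf.sub (integrable_const 1)).congr (Eventually.of_forall fun a => by simp)
    rw [integral_add (integrable_const 1) h4]
    simp
  have hi4 : IntervalIntegrable (fun t => ∫ a, ‖a‖ ^ 4 ∂(ν t)) volume t₀ T := by
    have h1 : IntervalIntegrable (fun t => ∫ a, (1 + ‖a‖ ^ 4) ∂(μ t) - 1) volume t₀ T :=
      hint.intervalIntegrable.sub intervalIntegrable_const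
    refine h1.congr_ae ?_
    refine (ae_restrict_iff' measurableSet_uIoc).2 ?_
    filter_upwards [hae] with t ht htI
    have htI' : t ∈ Icc t₀ T := by
      rw [uIoc_of_le h0T] at htI; exact ⟨htI.1.le, htI.2⟩
    have hp := hν.prob t htI'
    have hf := hfin t
    rw [← ht htI'] at hf ⊢
    have h4 : Integrable (fun a : Eucl m => ‖a‖ ^ 4) (ν t) := by
      exact (hf.sub (integrable_const 1)).congr (Eventually.of_forall fun a => by simp)
    rw [integral_add (integrable_const 1) h4]
    simp
  rw [hlast, intervalIntegral.integral_add intervalIntegrable_const hi4]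
  simp

end Entropy

/-! ### The Prékopa-Leindler inequality. -/

section PrekopaLeindler

open scoped Pointwise in
theorem volume_image_affine (K : Set ℝ) {t : ℝ} (ht : 0 < t) (c : ℝ) :
    volume ((fun x => t * x + c) '' K) = ENNReal.ofReal t * volume K := by
  have : (fun x => t * x + c) '' K = c +ᵥ (t • K) := by
    ext y
    simp only [mem_image, mem_vadd_set, mem_smul_set, smul_eq_mul, vadd_eq_add,
      exists_exists_and_eq_and, add_comm c]
  rw [this, measure_vadd, Measure.addHaar_smul]
  simp [abs_of_pos ht]

/-- With `a` the maximum of `K` and `b` the minimum of `K'`, the sets `t K + s b` and `t a + s K'`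
both lie in `C` and on opposite sides of `p = t a + s b`. They can share only the point `p`, which
is null. -/
theorem volume_add_le_of_isCompact {K K' C : Set ℝ} {s t : ℝ} (hs : 0 < s) (ht : 0 < t)
    (hK : IsCompact K) (hK' : IsCompact K') (hKn : K.Nonempty) (hKn' : K'.Nonempty)
    (h : ∀ a ∈ K, ∀ b ∈ K', t * a + s * b ∈ C) :
    ENNReal.ofReal t * volume K + ENNReal.ofReal s * volume K' ≤ volume C := by
  obtain ⟨a, ha, ha'⟩ := hK.exists_isGreatest hKn
  obtain ⟨b, hb, hb'⟩ := hK'.exists_isLeast hKn'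
  set p := t * a + s * b with hp
  rw [← volume_image_affine K ht (s * b), ← volume_image_affine K' hs (t * a),
    ← measure_inter_add_sdiff C (measurableSet_Iic (a := p))]
  refine add_le_add (measure_mono ?_) ?_
  · rintro _ ⟨x, hx, rfl⟩
    refine ⟨h x hx b hb, ?_⟩
    have := mul_le_mul_of_nonneg_left (ha' hx) ht.le
    simp only [mem_Iic, hp]; linarith
  · refine (measure_mono (t := (C \ Iic p) ∪ {p}) ?_).trans ((measure_union_le _ _).trans ?_)
    · rintro _ ⟨x, hx, rfl⟩
      have h1 := mul_le_mul_of_nonneg_left (hb' hx) hs.le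
      by_cases he : s * x + t * a = p
      · exact Or.inr he
      · refine Or.inl ⟨by have := h a ha x hx; rwa [add_comm] at this, fun hle => he ?_⟩
        simp only [mem_Iic] at hle
        linarith
    · simp

/-- The Brunn-Minkowski inequality on the line. -/
theorem volume_add_le {A B C : Set ℝ} {s t : ℝ} (hs : 0 < s) (ht : 0 < t)
    (hA : MeasurableSet A) (hB : MeasurableSet B) (hAn : A.Nonempty) (hBn : B.Nonempty)
    (h : ∀ a ∈ A, ∀ b ∈ B, t * a + s * b ∈ C) :
    ENNReal.ofReal t * volume A + ENNReal.ofReal s * volume B ≤ volume C := by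
  obtain ⟨a₀, ha₀⟩ := hAn
  obtain ⟨b₀, hb₀⟩ := hBn
  rw [hA.measure_eq_iSup_isCompact, hB.measure_eq_iSup_isCompact]
  simp only [ENNReal.mul_iSup, iSup_and']
  -- Inner regularity may produce empty compact sets; adjoining the points `a₀` and `b₀` makes them
  -- nonempty without leaving `A` and `B`.
  refine ENNReal.biSup_add_biSup_le' ⟨∅, by simp⟩ ⟨∅, by simp⟩ fun K hK K' hK' => ?_
  refine (add_le_add (mul_le_mul_right (measure_mono (subset_insert a₀ K)) _)
    (mul_le_mul_right (measure_mono (subset_insert b₀ K')) _)).trans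
    (volume_add_le_of_isCompact hs ht (hK.2.insert a₀) (hK'.2.insert b₀) ⟨a₀, by simp⟩
      ⟨b₀, by simp⟩ fun a ha b hb => h a (insert_subset ha₀ hK.1 ha) b (insert_subset hb₀ hK'.1 hb))

/-- Layer-cake formula: for every level `r` in `(0, 1)` the superlevel sets of `f` and `g` are
nonempty, since neither function is bounded by a number below 1, and the Brunn-Minkowski inequality
applies level by level. -/
theorem lintegral_add_le_of_sup_eq_one {f g h : ℝ → ℝ} {s t : ℝ} (hs : 0 < s) (ht : 0 < t)
    (hf : Measurable f) (hg : Measurable g) (hh : Measurable h)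
    (hf0 : ∀ x, 0 ≤ f x) (hg0 : ∀ x, 0 ≤ g x) (hh0 : ∀ x, 0 ≤ h x)
    (hf1 : ∀ x, f x ≤ 1) (hg1 : ∀ x, g x ≤ 1)
    (hf2 : ∀ r < 1, ∃ x, r < f x) (hg2 : ∀ r < 1, ∃ x, r < g x)
    (hfgh : ∀ x y r, r < f x → r < g y → r < h (t * x + s * y)) :
    ENNReal.ofReal t * (∫⁻ x, ENNReal.ofReal (f x)) +
      ENNReal.ofReal s * (∫⁻ x, ENNReal.ofReal (g x))
      ≤ ∫⁻ x, ENNReal.ofReal (h x) := by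
  have hcut : ∀ {F : ℝ → ℝ}, (∀ x, F x ≤ 1) → ∫⁻ r in Ioi (0 : ℝ), volume {x | r < F x} =
      ∫⁻ r in Ioo (0 : ℝ) 1, volume {x | r < F x} := by
    intro F hF
    rw [← lintegral_indicator measurableSet_Ioi, ← lintegral_indicator measurableSet_Ioo]
    congr 1
    ext r
    by_cases hr : r ∈ Ioo (0 : ℝ) 1
    · rw [indicator_of_mem hr, indicator_of_mem (show r ∈ Ioi (0 : ℝ) from hr.1)]
    · rw [indicator_of_notMem hr]
      by_cases hr0 : r ∈ Ioi (0 : ℝ)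
      · rw [indicator_of_mem hr0]
        have hr1 : 1 ≤ r := not_lt.1 fun h => hr ⟨hr0, h⟩
        have : {x | r < F x} = ∅ := by
          ext x; simpa using (hF x).trans hr1
        rw [this, measure_empty]
      · rw [indicator_of_notMem hr0]
  have hm : ∀ {F : ℝ → ℝ}, Measurable fun r => volume {x | r < F x} := fun {F} =>
    Antitone.measurable fun r r' hrr => measure_mono fun x hx => lt_of_le_of_lt hrr hx
  rw [lintegral_eq_lintegral_meas_lt (f := f) volume (Eventually.of_forall hf0) hf.aemeasurable,
    lintegral_eq_lintegral_meas_lt (f := g) volume (Eventually.of_forall hg0) hg.aemeasurable,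
    lintegral_eq_lintegral_meas_lt (f := h) volume (Eventually.of_forall hh0) hh.aemeasurable,
    hcut hf1, hcut hg1, ← lintegral_const_mul _ hm, ← lintegral_const_mul _ hm,
    ← lintegral_add_left (hm.const_mul _)]
  refine (setLIntegral_mono' measurableSet_Ioo fun r hr => ?_).trans
    (lintegral_mono_set Ioo_subset_Ioi_self)
  exact volume_add_le hs ht (measurableSet_lt measurable_const hf)
    (measurableSet_lt measurable_const hg) (hf2 r hr.2) (hg2 r hr.2) fun x hx y hy =>
      hfgh x y r hx hy

/-- The measure `μ` satisfies the Prékopa-Leindler inequality. -/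
def PrekopaLeindler {E : Type*} [AddCommGroup E] [Module ℝ E] [MeasurableSpace E]
    (μ : Measure E) : Prop :=
  ∀ s t : ℝ, 0 < s → 0 < t → s + t = 1 → ∀ f g h : E → ENNReal, Measurable f → Measurable g →
    Measurable h → (∀ x y, f x ^ t * g y ^ s ≤ h (t • x + s • y)) →
    (∫⁻ x, f x ∂μ) ^ t * (∫⁻ x, g x ∂μ) ^ s ≤ ∫⁻ x, h x ∂μ

theorem rpow_mul_rpow_le {s t : ℝ} (hs : 0 < s) (ht : 0 < t) (hst : s + t = 1)
    (a b : ENNReal) : a ^ t * b ^ s ≤ ENNReal.ofReal t * a + ENNReal.ofReal s * b := by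
  by_cases ha : a = ⊤
  · rw [ha, ENNReal.mul_top (by simpa using ht), top_add]; exact le_top
  by_cases hb : b = ⊤
  · rw [hb, ENNReal.mul_top (by simpa using hs), add_top]; exact le_top
  lift a to NNReal using ha
  lift b to NNReal using hb
  have h := NNReal.geom_mean_le_arith_mean2_weighted ⟨t, ht.le⟩ ⟨s, hs.le⟩ a b
    (NNReal.coe_inj.1 ((add_comm t s).trans hst))
  rw [← ENNReal.coe_rpow_of_nonneg _ ht.le, ← ENNReal.coe_rpow_of_nonneg _ hs.le,
    ENNReal.ofReal_eq_coe_nnreal ht.le, ENNReal.ofReal_eq_coe_nnreal hs.le]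
  exact_mod_cast h

theorem prekopaLeindler_real_of_sup_eq_one {s t : ℝ} (hs : 0 < s) (ht : 0 < t) (hst : s + t = 1)
    {f g h : ℝ → ENNReal} (hf : Measurable f) (hg : Measurable g) (hh : Measurable h)
    (hf1 : ⨆ x, f x = 1) (hg1 : ⨆ x, g x = 1)
    (hfgh : ∀ x y, f x ^ t * g y ^ s ≤ h (t * x + s * y)) :
    (∫⁻ x, f x) ^ t * (∫⁻ x, g x) ^ s ≤ ∫⁻ x, h x := by
  have hf1' : ∀ x, f x ≤ 1 := fun x => hf1 ▸ le_iSup f x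
  have hg1' : ∀ x, g x ≤ 1 := fun x => hg1 ▸ le_iSup g x
  have hof : ∀ {F : ℝ → ENNReal}, (∀ x, F x ≤ 1) → ∀ x, ENNReal.ofReal (F x).toReal = F x :=
    fun hF x => ENNReal.ofReal_toReal ((hF x).trans_lt ENNReal.one_lt_top).ne
  have hle : ∀ {F : ℝ → ENNReal}, (∀ x, F x ≤ 1) → ∀ x, (F x).toReal ≤ 1 := fun hF x => by
    have := ENNReal.toReal_mono ENNReal.one_ne_top (hF x)
    simpa using this
  have hsup : ∀ {F : ℝ → ENNReal}, (∀ x, F x ≤ 1) → ⨆ x, F x = 1 →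
      ∀ r < 1, ∃ x, r < (F x).toReal := by
    intro F hF hF1 r hr
    have h1 : ENNReal.ofReal r < ⨆ x, F x := by
      rw [hF1, ← ENNReal.ofReal_one]
      exact (ENNReal.ofReal_lt_ofReal_iff one_pos).2 hr
    obtain ⟨x, hx⟩ := lt_iSup_iff.1 h1
    refine ⟨x, ?_⟩
    rw [← hof hF x] at hx
    exact lt_of_not_ge fun h => hx.not_ge (ENNReal.ofReal_le_ofReal h)
  -- Truncating `h` at 1 preserves the hypothesis, because `f` and `g` are at most 1, and it allows
  -- passing to real-valued functions. The arithmetic form of the conclusion then implies the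
  -- geometric one.
  set k : ℝ → ENNReal := fun x => min (h x) 1 with hk
  have hk1 : ∀ x, k x ≤ 1 := fun x => min_le_right _ _
  have key := lintegral_add_le_of_sup_eq_one hs ht hf.ennreal_toReal hg.ennreal_toReal
    (hh.min measurable_const).ennreal_toReal (fun _ => ENNReal.toReal_nonneg)
    (fun _ => ENNReal.toReal_nonneg) (h := fun x => (k x).toReal)
    (fun _ => ENNReal.toReal_nonneg) (hle hf1') (hle hg1') (hsup hf1' hf1) (hsup hg1' hg1) ?_
  · simp only [hof hf1', hof hg1', hof hk1] at key
    refine le_trans ?_ (key.trans (lintegral_mono fun x => min_le_left _ _))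
    exact rpow_mul_rpow_le hs ht hst _ _
  · intro x y r hrx hry
    rcases lt_or_ge r 0 with hr0 | hr0
    · exact hr0.trans_le ENNReal.toReal_nonneg
    have hne : ∀ {F : ℝ → ENNReal}, (∀ x, F x ≤ 1) → ∀ x, F x ≠ ⊤ :=
      fun hF x => ((hF x).trans_lt ENNReal.one_lt_top).ne
    have hr1 : ∀ {q : ENNReal}, q ≠ ⊤ → r < q.toReal → ENNReal.ofReal r < q := fun hq hr =>
      (ENNReal.ofReal_lt_iff_lt_toReal hr0 hq).2 hr
    refine (ENNReal.ofReal_lt_iff_lt_toReal hr0 (hne hk1 _)).1 ?_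
    have h1 : ENNReal.ofReal r < f x ^ t * g y ^ s := by
      have e : ENNReal.ofReal r = ENNReal.ofReal r ^ t * ENNReal.ofReal r ^ s := by
        rw [← ENNReal.rpow_add_of_nonneg _ _ ht.le hs.le, add_comm, hst, ENNReal.rpow_one]
      rw [e]
      exact ENNReal.mul_lt_mul (ENNReal.rpow_lt_rpow (hr1 (hne hf1' x) hrx) ht)
        (ENNReal.rpow_lt_rpow (hr1 (hne hg1' y) hry) hs)
    refine lt_min (h1.trans_le (hfgh x y)) (h1.trans_le ?_)
    exact mul_le_one' (ENNReal.rpow_le_one (hf1' x) ht.le) (ENNReal.rpow_le_one (hg1' y) hs.le)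

theorem prekopaLeindler_real_of_bounded {s t : ℝ} (hs : 0 < s) (ht : 0 < t) (hst : s + t = 1)
    {f g h : ℝ → ENNReal} (hf : Measurable f) (hg : Measurable g) (hh : Measurable h)
    (hf1 : ⨆ x, f x ≠ ⊤) (hg1 : ⨆ x, g x ≠ ⊤)
    (hfgh : ∀ x y, f x ^ t * g y ^ s ≤ h (t * x + s * y)) :
    (∫⁻ x, f x) ^ t * (∫⁻ x, g x) ^ s ≤ ∫⁻ x, h x := by
  set F := ⨆ x, f x with hF
  set G := ⨆ x, g x with hG
  by_cases hF0 : F = 0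
  · have : ∀ x, f x = 0 := fun x => le_zero_iff.1 (hF0 ▸ le_iSup f x)
    simp [this, ht]
  by_cases hG0 : G = 0
  · have : ∀ x, g x = 0 := fun x => le_zero_iff.1 (hG0 ▸ le_iSup g x)
    simp [this, hs]
  have hA0 : F ^ t * G ^ s ≠ 0 := mul_ne_zero
    (fun h => hF0 (((ENNReal.rpow_eq_zero_iff_of_pos ht).1 h)))
    (fun h => hG0 (((ENNReal.rpow_eq_zero_iff_of_pos hs).1 h)))
  have hAt : F ^ t * G ^ s ≠ ⊤ := ENNReal.mul_ne_top (ENNReal.rpow_ne_top_of_nonneg ht.le hf1)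
    (ENNReal.rpow_ne_top_of_nonneg hs.le hg1)
  have hinv : (F ^ t * G ^ s)⁻¹ = F⁻¹ ^ t * G⁻¹ ^ s := by
    rw [ENNReal.mul_inv (Or.inr (ENNReal.rpow_ne_top_of_nonneg hs.le hg1))
      (Or.inl (ENNReal.rpow_ne_top_of_nonneg ht.le hf1)), ENNReal.inv_rpow, ENNReal.inv_rpow]
  have hm : ∀ a b : ENNReal, (F⁻¹ * a) ^ t * (G⁻¹ * b) ^ s =
      (F ^ t * G ^ s)⁻¹ * (a ^ t * b ^ s) := fun a b => by
    rw [hinv, ENNReal.mul_rpow_of_nonneg _ _ ht.le, ENNReal.mul_rpow_of_nonneg _ _ hs.le]; ring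
  have key := prekopaLeindler_real_of_sup_eq_one hs ht hst (f := fun x => F⁻¹ * f x)
    (g := fun x => G⁻¹ * g x) (h := fun x => (F ^ t * G ^ s)⁻¹ * h x) (hf.const_mul _)
    (hg.const_mul _) (hh.const_mul _) (by rw [← ENNReal.mul_iSup, ENNReal.inv_mul_cancel hF0 hf1])
    (by rw [← ENNReal.mul_iSup, ENNReal.inv_mul_cancel hG0 hg1])
    (fun x y => by rw [hm]; exact mul_le_mul_right (hfgh x y) _)
  rw [lintegral_const_mul _ hf, lintegral_const_mul _ hg, lintegral_const_mul _ hh, hm] at key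
  exact (ENNReal.mul_le_mul_iff_right (ENNReal.inv_ne_zero.2 hAt)
    (ENNReal.inv_ne_top.2 hA0)).1 key

theorem tendsto_lintegral_min_nat {α : Type*} [MeasurableSpace α] {μ : Measure α}
    {f : α → ENNReal} (hf : Measurable f) :
    Tendsto (fun n : ℕ => ∫⁻ x, min (f x) n ∂μ) atTop (𝓝 (∫⁻ x, f x ∂μ)) := by
  refine lintegral_tendsto_of_tendsto_of_monotone
    (fun n => (hf.min measurable_const).aemeasurable)
    (Eventually.of_forall fun x n n' hnn => min_le_min le_rfl (by exact_mod_cast hnn))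
    (Eventually.of_forall fun x => ?_)
  have : Tendsto (fun n : ℕ => min (f x) (n : ENNReal)) atTop (𝓝 (min (f x) ⊤)) :=
    tendsto_const_nhds.min ENNReal.tendsto_nat_nhds_top
  simpa using this

theorem prekopaLeindler_real : PrekopaLeindler (volume : Measure ℝ) := by
  intro s t hs ht hst f g h hf hg hh hfgh
  by_cases hf0 : ∫⁻ x, f x = 0
  · simp [hf0, ht]
  by_cases hg0 : ∫⁻ x, g x = 0
  · simp [hg0, hs]
  have hlim := ENNReal.Tendsto.mul ((tendsto_lintegral_min_nat (μ := volume) hf).ennrpow_const t)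
    (Or.inl fun h => hf0 ((ENNReal.rpow_eq_zero_iff_of_pos ht).1 h))
    ((tendsto_lintegral_min_nat (μ := volume) hg).ennrpow_const s)
    (Or.inl fun h => hg0 ((ENNReal.rpow_eq_zero_iff_of_pos hs).1 h))
  refine le_of_tendsto' hlim fun n => ?_
  have hb : ∀ F : ℝ → ENNReal, ⨆ x, min (F x) (n : ENNReal) ≠ ⊤ := fun F =>
    ((iSup_le fun x => min_le_right _ _).trans_lt (ENNReal.natCast_lt_top n)).ne
  refine prekopaLeindler_real_of_bounded hs ht hst (hf.min measurable_const)
    (hg.min measurable_const) hh (hb f) (hb g) fun x y => ?_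
  refine le_trans ?_ (hfgh x y)
  gcongr <;> exact min_le_left _ _

/-- Tensorization: the inequality on the fibres is exactly the hypothesis required of the marginals.
-/
theorem PrekopaLeindler.prod {E F : Type*} [AddCommGroup E] [Module ℝ E] [MeasurableSpace E]
    [AddCommGroup F] [Module ℝ F] [MeasurableSpace F] {μ : Measure E} {ν : Measure F}
    [SFinite μ] [SFinite ν] (hμ : PrekopaLeindler μ) (hν : PrekopaLeindler ν) :
    PrekopaLeindler (μ.prod ν) := by
  intro s t hs ht hst f g h hf hg hh hfgh
  rw [lintegral_prod _ hf.aemeasurable, lintegral_prod _ hg.aemeasurable,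
    lintegral_prod _ hh.aemeasurable]
  refine hμ s t hs ht hst _ _ _ hf.lintegral_prod_right' hg.lintegral_prod_right'
    hh.lintegral_prod_right' fun x y => ?_
  exact hν s t hs ht hst _ _ _ (hf.comp measurable_prodMk_left) (hg.comp measurable_prodMk_left)
    (hh.comp measurable_prodMk_left) fun x' y' => hfgh (x, x') (y, y')

theorem PrekopaLeindler.of_measurePreserving {E F : Type*} [AddCommGroup E] [Module ℝ E]
    [MeasurableSpace E] [AddCommGroup F] [Module ℝ F] [MeasurableSpace F] {μ : Measure E}
    {ν : Measure F} (hμ : PrekopaLeindler μ) {e : E → F} (he : MeasurePreserving e μ ν)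
    (hlin : ∀ (s t : ℝ) x y, e (t • x + s • y) = t • e x + s • e y) : PrekopaLeindler ν := by
  intro s t hs ht hst f g h hf hg hh hfgh
  rw [← he.lintegral_comp hf, ← he.lintegral_comp hg, ← he.lintegral_comp hh]
  exact hμ s t hs ht hst _ _ _ (hf.comp he.measurable) (hg.comp he.measurable)
    (hh.comp he.measurable) fun x y => by rw [hlin]; exact hfgh _ _

theorem prekopaLeindler_pi (n : ℕ) : PrekopaLeindler (volume : Measure (Fin n → ℝ)) := by
  induction n with
  | zero =>
    intro s t hs ht hst f g h hf hg hh hfgh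
    rw [Measure.volume_pi_eq_dirac 0, lintegral_dirac, lintegral_dirac, lintegral_dirac]
    have := hfgh 0 0
    rwa [smul_zero, smul_zero, add_zero] at this
  | succ n ih =>
    refine PrekopaLeindler.of_measurePreserving (prekopaLeindler_real.prod ih)
      (volume_preserving_piFinSuccAbove (fun _ => ℝ) 0).symm fun s t x y => ?_
    ext i
    refine Fin.cases ?_ (fun j => ?_) i <;> simp [MeasurableEquiv.piFinSuccAbove]

/-- The Prékopa-Leindler inequality in Euclidean space. -/
theorem prekopaLeindler_eucl (n : ℕ) : PrekopaLeindler (volume : Measure (Eucl n)) :=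
  (prekopaLeindler_pi n).of_measurePreserving (PiLp.volume_preserving_toLp (Fin n))
    fun _ _ _ _ => rfl

end PrekopaLeindler

/-! ### Log-Sobolev inequality for strongly log-concave measures. -/

section Entropy

variable {m : ℕ}

theorem ofReal_exp_rpow (a t : ℝ) :
    ENNReal.ofReal (Real.exp a) ^ t = ENNReal.ofReal (Real.exp (t * a)) := by
  rw [ENNReal.ofReal_rpow_of_pos (Real.exp_pos a), mul_comm, Real.exp_mul]

/-- A functional inequality for strongly log-concave measures, from the Prékopa-Leindler
inequality. -/
theorem integral_exp_rpow_le {U : Eucl m → ℝ} {κ s t : ℝ} (hUc : Continuous U)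
    (hU : Integrable fun a => Real.exp (-U a)) (hs : 0 < s) (ht : 0 < t) (hst : s + t = 1)
    (hconv : ∀ x y, U (t • x + s • y) + κ * (t * s) * ‖x - y‖ ^ 2 ≤ t * U x + s * U y)
    {g w : Eucl m → ℝ} (hg : Continuous g) (hw : Continuous w)
    (hgi : Integrable (fun a => Real.exp (g a / t)) (volume.tilted fun a => -U a))
    (hwi : Integrable (fun a => Real.exp (w a)) (volume.tilted fun a => -U a))
    (h : ∀ x y, g x ≤ w (t • x + s • y) + κ * (t * s) * ‖x - y‖ ^ 2) :
    (∫ a, Real.exp (g a / t) ∂(volume.tilted fun a => -U a)) ^ t ≤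
      ∫ a, Real.exp (w a) ∂(volume.tilted fun a => -U a) := by
  set μ := (volume : Measure (Eucl m)).tilted fun a => -U a with hμ
  have hprob : IsProbabilityMeasure μ := isProbabilityMeasure_tilted hU
  set Z := ∫ a, Real.exp (-U a) with hZ
  have hZ0 : 0 < Z := integral_exp_pos hU
  have hdens : ∀ F : Eucl m → ℝ, ∫⁻ a, ENNReal.ofReal (Real.exp (F a)) ∂μ =
      ∫⁻ a, ENNReal.ofReal (Real.exp (F a - U a - Real.log Z)) := fun F => by
    rw [hμ, lintegral_tilted]
    refine lintegral_congr fun a => ?_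
    rw [← ENNReal.ofReal_mul (by positivity)]
    congr 1
    rw [Real.exp_sub, Real.exp_sub, Real.exp_log hZ0, Real.exp_neg]
    ring
  have hone : ∫⁻ a, ENNReal.ofReal (Real.exp (0 - U a - Real.log Z)) = 1 := by
    have := hdens fun _ => 0
    rw [← this]; simp
  -- The three functions are the densities of `exp (g / t)`, `1` and `exp w` against the normalized
  -- weight `exp (-U) / Z`. The power `t` turns `g / t` into `g`, and strong convexity of `U` pays
  -- for the term `κ t s |x - y|²`.
  have key := prekopaLeindler_eucl m s t hs ht hst
    (fun a => ENNReal.ofReal (Real.exp (g a / t - U a - Real.log Z)))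
    (fun a => ENNReal.ofReal (Real.exp (0 - U a - Real.log Z)))
    (fun a => ENNReal.ofReal (Real.exp (w a - U a - Real.log Z)))
    (by fun_prop) (by fun_prop) (by fun_prop) fun x y => ?_
  · rw [← hdens, hone, ENNReal.one_rpow, mul_one, ← hdens,
      ← ofReal_integral_eq_lintegral_ofReal hgi (Eventually.of_forall fun a => Real.exp_nonneg _),
      ← ofReal_integral_eq_lintegral_ofReal hwi (Eventually.of_forall fun a => Real.exp_nonneg _),
      ENNReal.ofReal_rpow_of_nonneg (integral_nonneg fun a => Real.exp_nonneg _) ht.le,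
      ENNReal.ofReal_le_ofReal_iff (integral_nonneg fun a => Real.exp_nonneg _)] at key
    exact key
  · rw [ofReal_exp_rpow, ofReal_exp_rpow, ← ENNReal.ofReal_mul (Real.exp_nonneg _),
      ← Real.exp_add]
    refine ENNReal.ofReal_le_ofReal (Real.exp_le_exp.2 ?_)
    have h1 := h x y
    have h2 := hconv x y
    have h3 : t * (g x / t - U x - Real.log Z) + s * (0 - U y - Real.log Z) =
        g x - (t * U x + s * U y) - (s + t) * Real.log Z := by
      field_simp; ring
    rw [h3, hst]
    linarith

theorem integrable_of_continuous_of_bound {μ : Measure (Eucl m)} [IsFiniteMeasure μ]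
    {f : Eucl m → ℝ} (hf : Continuous f) {B : ℝ} (hB : ∀ a, |f a| ≤ B) : Integrable f μ :=
  (integrable_const B).mono' hf.aestronglyMeasurable (Eventually.of_forall hB)

/-- Both sides of `h` equal the integral of `exp g` at `s = 0`, so comparing one-sided derivatives
there gives the claim: on the left the derivative is the entropy, on the right it is the integral of
`R * exp g`. Explicit one-sided bounds replace differentiation. -/
theorem entropy_exp_le_of_eventually {μ : Measure (Eucl m)} [IsProbabilityMeasure μ]
    {g R : Eucl m → ℝ} (hg : Continuous g) (hR : Continuous R) {G B : ℝ} (hG : ∀ a, |g a| ≤ G)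
    (hR0 : ∀ a, 0 ≤ R a) (hB : ∀ a, R a ≤ B)
    (h : ∀ᶠ s : ℝ in 𝓝[>] 0, (∫ a, Real.exp (g a / (1 - s)) ∂μ) ^ (1 - s) ≤
      ∫ a, Real.exp (g a + s * R a) ∂μ) :
    ∫ a, g a * Real.exp (g a) ∂μ - (∫ a, Real.exp (g a) ∂μ) * Real.log (∫ a, Real.exp (g a) ∂μ) ≤
      ∫ a, R a * Real.exp (g a) ∂μ := by
  have hbd : ∀ {F : Eucl m → ℝ} {D : ℝ}, Continuous F → (∀ a, |F a| ≤ D) →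
      Integrable (fun a => F a * Real.exp (g a)) μ := fun {F D} hF hD =>
    integrable_of_continuous_of_bound (B := D * Real.exp G) (by fun_prop) fun a => by
      rw [abs_mul, abs_of_pos (Real.exp_pos _)]
      exact mul_le_mul (hD a) (Real.exp_le_exp.2 (abs_le.1 (hG a)).2) (Real.exp_nonneg _)
        ((abs_nonneg _).trans (hD a))
  have hB0 : 0 ≤ B := (hR0 0).trans (hB 0)
  have hRa : ∀ a, |R a| ≤ B := fun a => by rw [abs_of_nonneg (hR0 a)]; exact hB a
  have ie : Integrable (fun a => Real.exp (g a)) μ := by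
    simpa using hbd (F := fun _ => 1) (D := 1) continuous_const (by simp)
  have ige := hbd hg hG
  have iRe := hbd hR hRa
  have iR2 := hbd (F := fun a => R a ^ 2) (D := B ^ 2) (by fun_prop) fun a => by
    rw [abs_pow]; exact pow_le_pow_left₀ (abs_nonneg _) (hRa a) 2
  set M := ∫ a, Real.exp (g a) ∂μ with hM
  have hM0 : 0 < M := integral_exp_pos ie
  set A := ∫ a, R a * Real.exp (g a) ∂μ with hA
  set D := ∫ a, R a ^ 2 * Real.exp (g a) ∂μ with hD
  set m₁ := (∫ a, g a * Real.exp (g a) ∂μ) / M with hm₁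
  have hstep : ∀ᶠ s : ℝ in 𝓝[>] 0, m₁ - Real.log M ≤ A / M + s * (D / M) := by
    have hs1 : ∀ᶠ s : ℝ in 𝓝[>] 0, s < 1 := nhdsWithin_le_nhds (Iio_mem_nhds one_pos)
    have hs2 : ∀ᶠ s : ℝ in 𝓝[>] 0, s * B < 1 := by
      have : Tendsto (fun s : ℝ => s * B) (𝓝[>] 0) (𝓝 (0 * B)) :=
        (tendsto_id.mono_left nhdsWithin_le_nhds).mul_const B
      rw [zero_mul] at this
      exact this.eventually_lt_const one_pos
    filter_upwards [h, hs1, hs2, self_mem_nhdsWithin] with s hs hs1 hs2 hs0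
    have hs0 : 0 < s := hs0
    have ht : 0 < 1 - s := sub_pos.2 hs1
    -- Second-order upper bound from `exp x ≤ 1 + x + x²` on `[0, 1]`.
    have up : ∫ a, Real.exp (g a + s * R a) ∂μ ≤ M + s * A + s ^ 2 * D := by
      have i2 : Integrable (fun a => Real.exp (g a) + s * (R a * Real.exp (g a))) μ :=
        ie.add (iRe.const_mul s)
      rw [hM, hA, hD, ← integral_const_mul, ← integral_const_mul,
        ← integral_add ie (iRe.const_mul s),
        ← integral_add i2 (iR2.const_mul (s ^ 2))]
      refine integral_mono_of_nonneg (Eventually.of_forall fun a => Real.exp_nonneg _)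
        (i2.add (iR2.const_mul (s ^ 2)))
        (Eventually.of_forall fun a => ?_)
      have h1 : 0 ≤ s * R a := mul_nonneg hs0.le (hR0 a)
      have h2 : s * R a ≤ 1 := (mul_le_mul_of_nonneg_left (hB a) hs0.le).trans hs2.le
      have h3 := (abs_le.1 (Real.abs_exp_sub_one_sub_id_le (x := s * R a)
        (by rwa [abs_of_nonneg h1]))).2
      have h4 := mul_le_mul_of_nonneg_right h3 (Real.exp_nonneg (g a))
      beta_reduce
      rw [Real.exp_add]
      linarith
    -- Jensen's inequality for the probability measure proportional to `exp g`, whose mean of `g` is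
    -- `m₁`, obtained from the tangent line of the exponential at `q * m₁`.
    have lo : M * Real.exp (s / (1 - s) * m₁) ≤ ∫ a, Real.exp (g a / (1 - s)) ∂μ := by
      set q := s / (1 - s) with hq
      have hi : Integrable (fun a => Real.exp (q * m₁) * ((1 - q * m₁) * Real.exp (g a) +
          q * (g a * Real.exp (g a)))) μ :=
        ((ie.const_mul _).add (ige.const_mul q)).const_mul _
      have e : ∫ a, Real.exp (q * m₁) * ((1 - q * m₁) * Real.exp (g a) +
          q * (g a * Real.exp (g a))) ∂μ = M * Real.exp (q * m₁) := by
        rw [integral_const_mul, integral_add (ie.const_mul _) (ige.const_mul q),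
          integral_const_mul, integral_const_mul]
        have : ∫ a, g a * Real.exp (g a) ∂μ = m₁ * M := by rw [hm₁, div_mul_cancel₀ _ hM0.ne']
        rw [this, ← hM]; ring
      rw [← e]
      refine integral_mono hi (integrable_of_continuous_of_bound (B := Real.exp (G / (1 - s)))
        (by fun_prop) fun a => ?_) fun a => ?_
      · rw [abs_of_pos (Real.exp_pos _)]
        exact Real.exp_le_exp.2 (div_le_div_of_nonneg_right (abs_le.1 (hG a)).2 ht.le)
      · have h1 := Real.add_one_le_exp (q * g a - q * m₁)
        have h2 := mul_le_mul_of_nonneg_left h1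
          (mul_nonneg (Real.exp_nonneg (g a)) (Real.exp_nonneg (q * m₁)))
        have h3 : Real.exp (g a) * Real.exp (q * m₁) * Real.exp (q * g a - q * m₁) =
            Real.exp (g a / (1 - s)) := by
          rw [← Real.exp_add, ← Real.exp_add]
          congr 1
          rw [hq]; field_simp; ring
        rw [h3] at h2
        refine le_trans (le_of_eq ?_) h2
        ring
    have h1 : M * Real.exp (s * (m₁ - Real.log M)) ≤ M + s * A + s ^ 2 * D := by
      refine le_trans (le_trans (le_of_eq ?_)
        (Real.rpow_le_rpow (by positivity) lo ht.le)) (hs.trans up)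
      rw [Real.mul_rpow hM0.le (Real.exp_nonneg _), ← Real.exp_mul, Real.rpow_def_of_pos hM0,
        ← Real.exp_add]
      nth_rewrite 1 [← Real.exp_log hM0]
      rw [← Real.exp_add]
      congr 1
      field_simp; ring
    have h2 := Real.add_one_le_exp (s * (m₁ - Real.log M))
    have h3 := mul_le_mul_of_nonneg_left h2 hM0.le
    have h4 : s * (M * (m₁ - Real.log M)) ≤ s * (A + s * D) := by nlinarith
    have h5 := le_of_mul_le_mul_left h4 hs0
    rw [← mul_div_assoc, ← add_div, le_div_iff₀ hM0]
    linarith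
  have hlim : Tendsto (fun s : ℝ => A / M + s * (D / M)) (𝓝[>] 0) (𝓝 (A / M + 0 * (D / M))) :=
    ((tendsto_id.mono_left nhdsWithin_le_nhds).mul_const _).const_add _
  have hfin := ge_of_tendsto hlim hstep
  rw [zero_mul, add_zero, hm₁, sub_le_iff_le_add, div_le_iff₀ hM0, add_mul,
    div_mul_cancel₀ _ hM0.ne'] at hfin
  linarith

/-- The log-Sobolev inequality for `C¹` functions that are constant outside a compact set. -/
def CompactLogSobolev (μ : Measure (Eucl m)) (C : ℝ) : Prop :=
  ∀ g : Eucl m → ℝ, ContDiff ℝ 1 g → (∃ k, HasCompactSupport fun a => g a - k) →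
    ∫ a, g a * Real.exp (g a) ∂μ - (∫ a, Real.exp (g a) ∂μ) * Real.log (∫ a, Real.exp (g a) ∂μ) ≤
      C * ∫ a, ‖fderiv ℝ g a‖ ^ 2 * Real.exp (g a) ∂μ

theorem exists_bound_of_hasCompactSupport_sub {g : Eucl m → ℝ} (hg : Continuous g) {k : ℝ}
    (hk : HasCompactSupport fun a => g a - k) : ∃ G, ∀ a, |g a| ≤ G := by
  obtain ⟨G, hG⟩ := hk.exists_bound_of_continuous (hg.sub continuous_const)
  refine ⟨G + |k|, fun a => ?_⟩
  have h1 := hG a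
  rw [Real.norm_eq_abs] at h1
  calc |g a| = |(g a - k) + k| := by rw [sub_add_cancel]
    _ ≤ _ := (abs_add_le _ _).trans (add_le_add_left h1 _)

theorem hasCompactSupport_fderiv_of_sub {g : Eucl m → ℝ} {k : ℝ}
    (hk : HasCompactSupport fun a => g a - k) : HasCompactSupport (fderiv ℝ g) := by
  have e : fderiv ℝ (fun a => g a - k) = fderiv ℝ g := by
    ext1 a; exact fderiv_sub_const k
  exact e ▸ hk.fderiv (𝕜 := ℝ)

/-- A first-order expansion with uniform error. -/
theorem sub_le_of_uniformContinuous_fderiv {g : Eucl m → ℝ} (hg : ContDiff ℝ 1 g) {η δ : ℝ}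
    (hδ : ∀ a b, dist a b < δ → dist (fderiv ℝ g a) (fderiv ℝ g b) < η) {x z : Eucl m}
    (hxz : ‖x - z‖ < δ) : g x - g z ≤ (‖fderiv ℝ g z‖ + η) * ‖x - z‖ := by
  have hmem : x ∈ Metric.ball z δ := by rwa [Metric.mem_ball, dist_eq_norm]
  have := (convex_ball z δ).norm_image_sub_le_of_norm_fderiv_le (𝕜 := ℝ) (f := g)
    (C := ‖fderiv ℝ g z‖ + η) (fun y _ => hg.differentiable one_ne_zero y) (fun y hy => ?_)
    (Metric.mem_ball_self (dist_nonneg.trans_lt hmem)) hmem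
  · exact (le_abs_self _).trans this
  · have h1 := hδ y z hy
    rw [dist_eq_norm] at h1
    have := norm_le_norm_add_norm_sub' (fderiv ℝ g y) (fderiv ℝ g z)
    linarith

theorem le_of_forall_pos_le_add_quadratic {a b c d : ℝ}
    (h : ∀ η : ℝ, 0 < η → a ≤ b + η * c + η ^ 2 * d) : a ≤ b := by
  have hlim : Tendsto (fun η : ℝ => b + η * c + η ^ 2 * d) (𝓝[>] 0)
      (𝓝 (b + 0 * c + 0 ^ 2 * d)) := by
    have h0 : Tendsto (fun η : ℝ => η) (𝓝[>] 0) (𝓝 0) := nhdsWithin_le_nhds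
    exact ((h0.mul_const c).const_add b).add ((h0.pow 2).mul_const d)
  have := ge_of_tendsto hlim (eventually_nhdsWithin_of_forall h)
  simpa using this

/-- Strongly log-concave measures satisfy a log-Sobolev inequality. -/
theorem compactLogSobolev_of_strongConvex {U : Eucl m → ℝ} {κ : ℝ} (hκ : 0 < κ)
    (hUc : Continuous U) (hU : Integrable fun a => Real.exp (-U a))
    (hconv : ∀ s t : ℝ, 0 < s → 0 < t → s + t = 1 → ∀ x y,
      U (t • x + s • y) + κ * (t * s) * ‖x - y‖ ^ 2 ≤ t * U x + s * U y) :
    CompactLogSobolev (volume.tilted fun a => -U a) (1 / (2 * κ)) := by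
  rintro g hg ⟨k, hk⟩
  set μ := (volume : Measure (Eucl m)).tilted fun a => -U a with hμ
  have hprob : IsProbabilityMeasure μ := isProbabilityMeasure_tilted hU
  obtain ⟨G, hG⟩ := exists_bound_of_hasCompactSupport_sub hg.continuous hk
  have hg' : Continuous (fderiv ℝ g) := hg.continuous_fderiv one_ne_zero
  have hcs := hasCompactSupport_fderiv_of_sub hk
  obtain ⟨P, hP⟩ := hcs.exists_bound_of_continuous hg'
  have hP0 : 0 ≤ P := (norm_nonneg _).trans (hP 0)
  have hbd : ∀ {F : Eucl m → ℝ} {D : ℝ}, Continuous F → (∀ a, |F a| ≤ D) →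
      Integrable (fun a => F a * Real.exp (g a)) μ := fun {F D} hF hD =>
    integrable_of_continuous_of_bound (B := D * Real.exp G)
      (hF.mul (Real.continuous_exp.comp hg.continuous)) fun a => by
      rw [abs_mul, abs_of_pos (Real.exp_pos _)]
      exact mul_le_mul (hD a) (Real.exp_le_exp.2 (abs_le.1 (hG a)).2) (Real.exp_nonneg _)
        ((abs_nonneg _).trans (hD a))
  have ie : Integrable (fun a => Real.exp (g a)) μ := by
    simpa using hbd (F := fun _ => 1) (D := 1) continuous_const (by simp)
  have i1 := hbd (F := fun a => ‖fderiv ℝ g a‖) (D := P) hg'.norm fun a => by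
    rw [abs_norm]; exact hP a
  have i2 := hbd (F := fun a => ‖fderiv ℝ g a‖ ^ 2) (D := P ^ 2) (hg'.norm.pow 2) fun a => by
    rw [abs_pow, abs_norm]; exact pow_le_pow_left₀ (norm_nonneg _) (hP a) 2
  refine le_of_forall_pos_le_add_quadratic
    (c := 1 / (2 * κ) * (2 * ∫ a, ‖fderiv ℝ g a‖ * Real.exp (g a) ∂μ))
    (d := 1 / (2 * κ) * ∫ a, Real.exp (g a) ∂μ) fun η hη => ?_
  -- Here `w = g + s * R`. For `z = (1 - s) x + s y`, the increment `g x - g z` is about `s |Dg(z)|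
  -- |x - y|`, and Young's inequality splits it into `s * R(z)` and the convexity gain. The margin
  -- `η` covers the oscillation of `Dg` and is sent to zero at the end.
  have hR : Continuous fun a => (‖fderiv ℝ g a‖ + η) ^ 2 / (2 * κ) := by fun_prop
  have hR0 : ∀ a, 0 ≤ (‖fderiv ℝ g a‖ + η) ^ 2 / (2 * κ) := fun a => by positivity
  have hRB : ∀ a, (‖fderiv ℝ g a‖ + η) ^ 2 / (2 * κ) ≤ (P + η) ^ 2 / (2 * κ) := fun a => by
    have := hP a
    gcongr
  have key := entropy_exp_le_of_eventually (μ := μ) hg.continuous hR hG hR0 hRB ?_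
  · refine key.trans (le_of_eq ?_)
    have e : ∀ a, (‖fderiv ℝ g a‖ + η) ^ 2 / (2 * κ) * Real.exp (g a) = 1 / (2 * κ) *
        (‖fderiv ℝ g a‖ ^ 2 * Real.exp (g a) + 2 * η * (‖fderiv ℝ g a‖ * Real.exp (g a)) +
        η ^ 2 * Real.exp (g a)) := fun a => by ring
    have i3 : Integrable (fun a => ‖fderiv ℝ g a‖ ^ 2 * Real.exp (g a) +
        2 * η * (‖fderiv ℝ g a‖ * Real.exp (g a))) μ := i2.add (i1.const_mul _)
    simp only [e]
    rw [integral_const_mul, integral_add i3 (ie.const_mul _), integral_add i2 (i1.const_mul _),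
      integral_const_mul, integral_const_mul]
    ring
  obtain ⟨δ, hδ0, hδ⟩ := Metric.uniformContinuous_iff.1
    (hg'.uniformContinuous_of_tendsto_cocompact hcs.is_zero_at_infty) η hη
  have hs1 : ∀ᶠ s : ℝ in 𝓝[>] 0, s < 1 / 2 := nhdsWithin_le_nhds (Iio_mem_nhds (by norm_num))
  have hs2 : ∀ᶠ s : ℝ in 𝓝[>] 0, s * P < κ * δ / 2 := by
    have : Tendsto (fun s : ℝ => s * P) (𝓝[>] 0) (𝓝 (0 * P)) :=
      (tendsto_id.mono_left nhdsWithin_le_nhds).mul_const P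
    rw [zero_mul] at this
    exact this.eventually_lt_const (by positivity)
  filter_upwards [hs1, hs2, self_mem_nhdsWithin] with s hs1 hs2 hs0
  have hs0 : 0 < s := hs0
  have ht : 1 / 2 < 1 - s := by linarith
  have ht0 : 0 < 1 - s := by linarith
  have hw : Continuous fun a => g a + s * ((‖fderiv ℝ g a‖ + η) ^ 2 / (2 * κ)) :=
    hg.continuous.add (hR.const_mul s)
  have hgc := hg.continuous
  refine integral_exp_rpow_le hUc hU hs0 ht0 (by ring)
    (hconv s (1 - s) hs0 ht0 (by ring)) hgc hw
    (integrable_of_continuous_of_bound (B := Real.exp (G / (1 - s))) (by fun_prop) fun a => ?_)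
    (integrable_of_continuous_of_bound
      (B := Real.exp (G + s * ((P + η) ^ 2 / (2 * κ)))) (by fun_prop) fun a => ?_) fun x y => ?_
  · rw [abs_of_pos (Real.exp_pos _)]
    exact Real.exp_le_exp.2 (div_le_div_of_nonneg_right (abs_le.1 (hG a)).2 ht0.le)
  · rw [abs_of_pos (Real.exp_pos _)]
    exact Real.exp_le_exp.2 (add_le_add (abs_le.1 (hG a)).2
      (mul_le_mul_of_nonneg_left (hRB a) hs0.le))
  · set z := (1 - s) • x + s • y with hz
    have hxz : ‖x - z‖ = s * ‖x - y‖ := by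
      have : x - z = s • (x - y) := by rw [hz]; module
      rw [this, norm_smul, Real.norm_of_nonneg hs0.le]
    set r := ‖x - y‖ with hr
    have hr0 : 0 ≤ r := norm_nonneg _
    rcases lt_or_ge (s * r) δ with hlt | hge
    -- Nearby points: first-order expansion. Young's inequality costs `κ / 2 * r²`, available
    -- because `1 - s > 1 / 2`.
    · have h1 := sub_le_of_uniformContinuous_fderiv hg (fun a b => @hδ a b)
        (x := x) (z := z) (by rwa [hxz])
      rw [hxz] at h1
      set p := ‖fderiv ℝ g z‖ + η with hp
      have h2 : p * r ≤ p ^ 2 / (2 * κ) + κ * (1 - s) * r ^ 2 := by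
        have h3 : p ^ 2 / (2 * κ) + κ / 2 * r ^ 2 - p * r = (p - κ * r) ^ 2 / (2 * κ) := by
          field_simp; ring
        have h4 : 0 ≤ (p - κ * r) ^ 2 / (2 * κ) := by positivity
        have h5 : κ / 2 * r ^ 2 ≤ κ * (1 - s) * r ^ 2 := by
          have := mul_le_mul_of_nonneg_left ht.le (mul_nonneg hκ.le (sq_nonneg r))
          linarith
        linarith
      have h3 := mul_le_mul_of_nonneg_left h2 hs0.le
      linarith
    -- Distant points: when `s * r ≥ δ`, the global Lipschitz bound `P` is beaten by the quadratic
    -- gain alone, as `s * P < κ * δ / 2`.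
    · have h1 : g x - g z ≤ P * (s * r) := by
        have := convex_univ.norm_image_sub_le_of_norm_fderiv_le (𝕜 := ℝ) (f := g)
          (fun y _ => hg.differentiable one_ne_zero y) (fun y _ => hP y) (mem_univ z) (mem_univ x)
        rw [hxz] at this
        exact (le_abs_self _).trans this
      have h2 : s * P ≤ κ * (1 - s) * (s * r) := by
        have : κ * δ / 2 ≤ κ * (1 - s) * (s * r) := by
          have := mul_le_mul ht.le hge hδ0.le ht0.le
          have := mul_le_mul_of_nonneg_left this hκ.le
          linarith
        linarith
      have h3 := mul_le_mul_of_nonneg_right h2 hr0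
      have h4 := mul_nonneg hs0.le (hR0 z)
      have h5 : P * (s * r) ≤ κ * ((1 - s) * s) * r ^ 2 := by linarith
      linarith

end Entropy

/-! ### Bounded perturbations, and passage from compact variations to general densities. -/

section LogSobolev

variable {m : ℕ} {μ P : Measure (Eucl m)} {C D : ℝ}

theorem integral_le_of_le_smul {α : Type*} [MeasurableSpace α] {μ P : Measure α} {D : ℝ}
    (hD : 0 ≤ D) (h : P ≤ ENNReal.ofReal D • μ) {f : α → ℝ} (hf : Integrable f μ)
    (hf0 : ∀ a, 0 ≤ f a) : ∫ a, f a ∂P ≤ D * ∫ a, f a ∂μ := by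
  have := integral_mono_measure h (Eventually.of_forall hf0) (hf.smul_measure ENNReal.ofReal_ne_top)
  rwa [integral_smul_measure, ENNReal.toReal_ofReal hD, smul_eq_mul] at this

/-- Stability of the log-Sobolev inequality under a bounded change of density. -/
theorem CompactLogSobolev.of_le_smul [IsProbabilityMeasure μ] [IsProbabilityMeasure P]
    (h : CompactLogSobolev μ C) (hC : 0 ≤ C) (hD : 0 ≤ D)
    (h1 : P ≤ ENNReal.ofReal D • μ) (h2 : μ ≤ ENNReal.ofReal D • P) :
    CompactLogSobolev P (D ^ 2 * C) := by
  rintro g hg ⟨k, hk⟩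
  have hgc := hg.continuous
  obtain ⟨G, hG⟩ := exists_bound_of_hasCompactSupport_sub hgc hk
  have hg' : Continuous (fderiv ℝ g) := hg.continuous_fderiv one_ne_zero
  obtain ⟨B, hB⟩ := (hasCompactSupport_fderiv_of_sub hk).exists_bound_of_continuous hg'
  have hexp : ∀ a, Real.exp (g a) ≤ Real.exp G := fun a =>
    Real.exp_le_exp.2 (abs_le.1 (hG a)).2
  have hbd : ∀ (ρ : Measure (Eucl m)) [IsProbabilityMeasure ρ] {F : Eucl m → ℝ} {D : ℝ},
      Continuous F → (∀ a, |F a| ≤ D) → Integrable (fun a => F a * Real.exp (g a)) ρ :=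
    fun ρ _ F D hF hD => integrable_of_continuous_of_bound (B := D * Real.exp G)
      (by fun_prop) fun a => by
      rw [abs_mul, abs_of_pos (Real.exp_pos _)]
      exact mul_le_mul (hD a) (hexp a) (Real.exp_nonneg _) ((abs_nonneg _).trans (hD a))
  have ie : ∀ (ρ : Measure (Eucl m)) [IsProbabilityMeasure ρ],
      Integrable (fun a => Real.exp (g a)) ρ := fun ρ _ => by
    simpa using hbd ρ (F := fun _ => 1) (D := 1) continuous_const (by simp)
  have i2 : ∀ (ρ : Measure (Eucl m)) [IsProbabilityMeasure ρ],
      Integrable (fun a => ‖fderiv ℝ g a‖ ^ 2 * Real.exp (g a)) ρ := fun ρ _ =>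
    hbd ρ (D := B ^ 2) (hg'.norm.pow 2) fun a => by
      rw [abs_pow, abs_norm]; exact pow_le_pow_left₀ (norm_nonneg _) (hB a) 2
  set τ := ∫ a, Real.exp (g a) ∂μ with hτ
  have hτ0 : 0 < τ := integral_exp_pos (ie μ)
  set M := ∫ a, Real.exp (g a) ∂P with hM
  have hM0 : 0 < M := integral_exp_pos (ie P)
  -- Holley-Stroock argument: the entropy is the minimum over `τ > 0` of the integral of `g e^g -
  -- (log τ + 1) e^g + τ`. This integrand is nonnegative, so changing the measure costs only a
  -- factor `D`; the value of `τ` optimal for `μ` is admissible for `P`.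
  have hφ : ∀ (ρ : Measure (Eucl m)) [IsProbabilityMeasure ρ],
      Integrable (fun a => g a * Real.exp (g a) - (Real.log τ + 1) * Real.exp (g a) + τ) ρ ∧
      ∫ a, (g a * Real.exp (g a) - (Real.log τ + 1) * Real.exp (g a) + τ) ∂ρ =
      ∫ a, g a * Real.exp (g a) ∂ρ - (Real.log τ + 1) * ∫ a, Real.exp (g a) ∂ρ + τ := by
    intro ρ _
    have i1 : Integrable (fun a => g a * Real.exp (g a) - (Real.log τ + 1) * Real.exp (g a)) ρ :=
      (hbd ρ hgc hG).sub ((ie ρ).const_mul _)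
    refine ⟨i1.add (integrable_const τ), ?_⟩
    rw [integral_add i1 (integrable_const τ), integral_sub (hbd ρ hgc hG) ((ie ρ).const_mul _),
      integral_const_mul]
    simp
  have hφ0 : ∀ a, 0 ≤ g a * Real.exp (g a) - (Real.log τ + 1) * Real.exp (g a) + τ := fun a => by
    have h3 := Real.add_one_le_exp (Real.log τ - g a)
    rw [Real.exp_sub, Real.exp_log hτ0, le_div_iff₀ (Real.exp_pos _)] at h3
    linarith
  have h3 := integral_le_of_le_smul hD h1 (hφ μ).1 hφ0
  rw [(hφ P).2, (hφ μ).2, ← hτ, ← hM] at h3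
  have h4 := h g hg ⟨k, hk⟩
  rw [← hτ] at h4
  have h5 := integral_le_of_le_smul hD h2 (i2 P) fun a => by positivity
  have h6 : 0 ≤ M * Real.log M - M * Real.log τ - M + τ := by
    have := Real.add_one_le_exp (Real.log τ - Real.log M)
    rw [Real.exp_sub, Real.exp_log hτ0, Real.exp_log hM0, le_div_iff₀ hM0] at this
    linarith
  have h7 := mul_le_mul_of_nonneg_left h4 hD
  have h8 := mul_le_mul_of_nonneg_left h5 (mul_nonneg hD hC)
  linarith

/-- Bounded perturbations of the potential. -/
theorem CompactLogSobolev.of_bounded_perturbation {U V : Eucl m → ℝ} {δ : ℝ}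
    (hUc : Continuous U) (hVc : Continuous V)
    (hU : Integrable fun a => Real.exp (-U a)) (hV : Integrable fun a => Real.exp (-V a))
    (h1 : ∀ a, V a ≤ U a) (h2 : ∀ a, U a ≤ V a + δ) (hC : 0 ≤ C)
    (h : CompactLogSobolev (volume.tilted fun a => -U a) C) :
    CompactLogSobolev (volume.tilted fun a => -V a) (Real.exp δ ^ 2 * C) := by
  have hUp : IsProbabilityMeasure ((volume : Measure (Eucl m)).tilted fun a => -U a) :=
    isProbabilityMeasure_tilted hU
  have hVp : IsProbabilityMeasure ((volume : Measure (Eucl m)).tilted fun a => -V a) :=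
    isProbabilityMeasure_tilted hV
  have hZU : 0 < ∫ a, Real.exp (-U a) := integral_exp_pos hU
  have hZV : 0 < ∫ a, Real.exp (-V a) := integral_exp_pos hV
  have e1 : ∀ a, Real.exp (-U a) ≤ Real.exp (-V a) := fun a =>
    Real.exp_le_exp.2 (neg_le_neg (h1 a))
  have e2 : ∀ a, Real.exp (-V a) ≤ Real.exp δ * Real.exp (-U a) := fun a => by
    rw [← Real.exp_add]
    exact Real.exp_le_exp.2 (by linarith [h2 a])
  have z1 : ∫ a, Real.exp (-U a) ≤ ∫ a, Real.exp (-V a) := integral_mono hU hV e1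
  have z2 : ∫ a, Real.exp (-V a) ≤ Real.exp δ * ∫ a, Real.exp (-U a) := by
    rw [← integral_const_mul]; exact integral_mono hV (hU.const_mul _) e2
  refine h.of_le_smul hC (Real.exp_nonneg δ) ?_ ?_
  · rw [Measure.tilted, Measure.tilted, ← withDensity_smul _ (by fun_prop)]
    refine withDensity_mono (Eventually.of_forall fun a => ?_)
    simp only [Pi.smul_apply, smul_eq_mul]
    rw [← ENNReal.ofReal_mul (Real.exp_nonneg δ)]
    refine ENNReal.ofReal_le_ofReal ?_
    rw [← mul_div_assoc]
    exact div_le_div₀ (by positivity) (e2 a) hZU z1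
  · rw [Measure.tilted, Measure.tilted, ← withDensity_smul _ (by fun_prop)]
    refine withDensity_mono (Eventually.of_forall fun a => ?_)
    simp only [Pi.smul_apply, smul_eq_mul]
    rw [← ENNReal.ofReal_mul (Real.exp_nonneg δ)]
    refine ENNReal.ofReal_le_ofReal ?_
    rw [← mul_div_assoc, div_le_div_iff₀ hZU hZV]
    have := mul_le_mul (e1 a) z2 hZV.le (Real.exp_nonneg _)
    linarith

theorem norm_gradient_eq (f : Eucl m → ℝ) (a : Eucl m) : ‖gradient f a‖ = ‖fderiv ℝ f a‖ := by
  rw [gradient, LinearIsometryEquiv.norm_map]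

/-- The Fisher information density in terms of the derivative of the density. -/
theorem norm_fderiv_sq_eq {f : Eucl m → ℝ} (hf : ContDiff ℝ 1 f) (hf0 : ∀ a, 0 ≤ f a)
    (a : Eucl m) : ‖fderiv ℝ f a‖ ^ 2 =
      ‖gradient (fun a' => Real.log (f a')) a‖ ^ 2 * f a * f a := by
  rcases (hf0 a).eq_or_lt with h | h
  · have hmin : IsLocalMin f a := Eventually.of_forall fun x => h ▸ hf0 x
    rw [hmin.fderiv_eq_zero, ← h]; simp
  · have hd := ((hf.differentiable one_ne_zero a).hasFDerivAt.log h.ne').fderiv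
    rw [norm_gradient_eq, hd, norm_smul, Real.norm_of_nonneg (by positivity)]
    field_simp

/-- The entropy of a truncated density. -/
theorem CompactLogSobolev.entropy_truncation_le [IsProbabilityMeasure μ]
    (h : CompactLogSobolev μ C) (hC : 0 ≤ C) {f : Eucl m → ℝ} (hf : ContDiff ℝ 1 f)
    (hf0 : ∀ a, 0 ≤ f a) (hfi : Integrable f μ)
    (hJ : Integrable (fun a => ‖gradient (fun a' => Real.log (f a')) a‖ ^ 2 * f a) μ)
    {χ : Eucl m → ℝ} (hχ : ContDiff ℝ 1 χ) (hχs : HasCompactSupport χ) (hχ0 : ∀ a, 0 ≤ χ a)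
    (hχ1 : ∀ a, χ a ≤ 1) {δ ε : ℝ} (hδ : ∀ a, ‖fderiv ℝ χ a‖ ≤ δ) (hε : 0 < ε) :
    Integrable (fun a => (ε + χ a ^ 2 * f a) * Real.log (ε + χ a ^ 2 * f a)) μ ∧
    ∫ a, (ε + χ a ^ 2 * f a) * Real.log (ε + χ a ^ 2 * f a) ∂μ ≤
      (∫ a, (ε + χ a ^ 2 * f a) ∂μ) * Real.log (∫ a, (ε + χ a ^ 2 * f a) ∂μ) +
      C * (2 * ∫ a, ‖gradient (fun a' => Real.log (f a')) a‖ ^ 2 * f a ∂μ +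
        8 * δ ^ 2 * ∫ a, f a ∂μ) := by
  set J : Eucl m → ℝ := fun a => ‖gradient (fun a' => Real.log (f a')) a‖ ^ 2 * f a with hJdef
  have hJ0 : ∀ a, 0 ≤ J a := fun a => mul_nonneg (sq_nonneg _) (hf0 a)
  set F : Eucl m → ℝ := fun a => ε + χ a ^ 2 * f a with hF
  have hχf : ∀ a, 0 ≤ χ a ^ 2 * f a := fun a => mul_nonneg (sq_nonneg _) (hf0 a)
  have hF0 : ∀ a, 0 < F a := fun a => add_pos_of_pos_of_nonneg hε (hχf a)
  have hFc : ContDiff ℝ 1 F := contDiff_const.add ((hχ.pow 2).mul hf)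
  -- Outside the support of `χ` this equals `log ε`, so the inequality for compact variations
  -- applies to it.
  set g : Eucl m → ℝ := fun a => Real.log (F a) with hg
  have hgc : ContDiff ℝ 1 g := hFc.log fun a => (hF0 a).ne'
  have hgF : ∀ a, Real.exp (g a) = F a := fun a => Real.exp_log (hF0 a)
  have hgk : HasCompactSupport fun a => g a - Real.log ε := by
    refine hχs.mono' fun a ha => ?_
    by_contra hna
    have : χ a = 0 := image_eq_zero_of_notMem_tsupport hna
    exact ha (by simp [hg, hF, this])
  obtain ⟨G, hG⟩ := exists_bound_of_hasCompactSupport_sub hgc.continuous hgk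
  have hbound : ∀ a, ‖fderiv ℝ g a‖ ^ 2 * Real.exp (g a) ≤ 2 * J a + 8 * δ ^ 2 * f a := by
    intro a
    have hFd : fderiv ℝ F a = χ a ^ 2 • fderiv ℝ f a + (2 * χ a * f a) • fderiv ℝ χ a := by
      have h1 := (((hχ.differentiable one_ne_zero a).hasFDerivAt.pow 2).mul
        (hf.differentiable one_ne_zero a).hasFDerivAt).const_add ε
      refine h1.fderiv.trans ?_
      ext v
      simp
      ring
    have hgd : fderiv ℝ g a = (F a)⁻¹ • fderiv ℝ F a :=
      ((hFc.differentiable one_ne_zero a).hasFDerivAt.log (hF0 a).ne').fderiv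
    set p := ‖fderiv ℝ f a‖ with hp
    have hp2 : p ^ 2 = J a * f a := norm_fderiv_sq_eq hf hf0 a
    have hδ0 : 0 ≤ δ := (norm_nonneg _).trans (hδ a)
    have hn : ‖fderiv ℝ F a‖ ≤ χ a ^ 2 * p + 2 * χ a * f a * δ := by
      rw [hFd]
      refine (norm_add_le _ _).trans ?_
      have h3 : 0 ≤ 2 * χ a * f a := mul_nonneg (mul_nonneg two_pos.le (hχ0 a)) (hf0 a)
      rw [norm_smul, norm_smul, Real.norm_of_nonneg (sq_nonneg _), Real.norm_of_nonneg h3]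
      gcongr
      exact hδ a
    -- Multiplying `f` by the square of `χ` lets a factor `χ² f ≤ F` come out, which cancels the
    -- division by `F` in the Fisher information. The cross term is removed by `(p + q)² ≤ 2 p² + 2
    -- q²`, at the price of a factor 2.
    have hsq : ‖fderiv ℝ F a‖ ^ 2 ≤ F a * (2 * J a + 8 * δ ^ 2 * f a) := by
      have h1 := pow_le_pow_left₀ (norm_nonneg _) hn 2
      have h2 : (χ a ^ 2 * p + 2 * χ a * f a * δ) ^ 2 ≤
          2 * (χ a ^ 2 * p) ^ 2 + 2 * (2 * χ a * f a * δ) ^ 2 := by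
        linarith [sq_nonneg (χ a ^ 2 * p - 2 * χ a * f a * δ)]
      have h3 : 2 * (χ a ^ 2 * p) ^ 2 + 2 * (2 * χ a * f a * δ) ^ 2 =
          (χ a ^ 2 * f a) * (2 * (χ a ^ 2 * J a) + 8 * δ ^ 2 * f a) := by
        rw [mul_pow, hp2]; ring
      have h4 : χ a ^ 2 * J a ≤ J a :=
        mul_le_of_le_one_left (hJ0 a) (pow_le_one₀ (hχ0 a) (hχ1 a))
      have h5 : χ a ^ 2 * f a ≤ F a := by simp only [hF]; linarith
      have h6 : (0 : ℝ) ≤ 8 * δ ^ 2 * f a := mul_nonneg (by positivity) (hf0 a)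
      have h7 : (0 : ℝ) ≤ χ a ^ 2 * J a := mul_nonneg (sq_nonneg _) (hJ0 a)
      calc _ ≤ _ := h1.trans (h2.trans_eq h3)
        _ ≤ _ := mul_le_mul h5 (by linarith) (by positivity) (hF0 a).le
    rw [hgF, hgd, norm_smul, Real.norm_of_nonneg (inv_nonneg.2 (hF0 a).le), mul_pow]
    have h1 := mul_le_mul_of_nonneg_left hsq (inv_nonneg.2 (hF0 a).le)
    rw [inv_mul_cancel_left₀ (hF0 a).ne'] at h1
    refine le_trans (le_of_eq ?_) h1
    field_simp [(hF0 a).ne']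
  have key := h g hgc ⟨_, hgk⟩
  simp only [hgF] at key
  have hcomm : ∀ a, F a * Real.log (F a) = g a * F a := fun a => mul_comm _ _
  constructor
  · have : Integrable (fun a => g a * Real.exp (g a)) μ :=
      integrable_of_continuous_of_bound (B := G * Real.exp G)
        (hgc.continuous.mul (Real.continuous_exp.comp hgc.continuous)) fun a => by
        rw [abs_mul, abs_of_pos (Real.exp_pos _)]
        exact mul_le_mul (hG a) (Real.exp_le_exp.2 (abs_le.1 (hG a)).2) (Real.exp_nonneg _)
          ((abs_nonneg _).trans (hG a))
    refine this.congr (Eventually.of_forall fun a => ?_)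
    simp only [hgF]
    exact (hcomm a).symm
  · simp only [hgF] at hbound
    have hi : Integrable (fun a => 2 * J a + 8 * δ ^ 2 * f a) μ :=
      (hJ.const_mul 2).add (hfi.const_mul _)
    have h1 : ∫ a, ‖fderiv ℝ g a‖ ^ 2 * F a ∂μ ≤ ∫ a, (2 * J a + 8 * δ ^ 2 * f a) ∂μ :=
      integral_mono_of_nonneg (Eventually.of_forall fun a =>
        mul_nonneg (sq_nonneg _) (hF0 a).le) hi (Eventually.of_forall hbound)
    rw [integral_add (hJ.const_mul 2) (hfi.const_mul _), integral_const_mul,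
      integral_const_mul] at h1
    have h2 := mul_le_mul_of_nonneg_left h1 hC
    have e : ∫ a, (ε + χ a ^ 2 * f a) * Real.log (ε + χ a ^ 2 * f a) ∂μ = ∫ a, g a * F a ∂μ :=
      integral_congr_ae (Eventually.of_forall hcomm)
    rw [e]
    linarith

/-- The truncations `ε + χ² f` are removed with `ε → 0`, `χ → 1` and `∇χ → 0`. Fatou's lemma for `x
log x + 1 ≥ 0` yields finiteness of the entropy together with its bound; the 2 in the constant comes
from the truncation. -/
theorem CompactLogSobolev.logSobolev [IsProbabilityMeasure μ] (h : CompactLogSobolev μ C)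
    (hC : 0 ≤ C) : LogSobolev μ (2 * C) := by
  intro f hf hf0 hfi hf1 hJ
  set J : Eucl m → ℝ := fun a => ‖gradient (fun a' => Real.log (f a')) a‖ ^ 2 * f a with hJdef
  have hJ0 : 0 ≤ ∫ a, J a ∂μ := integral_nonneg fun a => mul_nonneg (sq_nonneg _) (hf0 a)
  let ψ : ContDiffBump (0 : Eucl m) := ⟨1, 2, one_pos, one_lt_two⟩
  have hψ : ContDiff ℝ 1 ψ := ψ.contDiff
  obtain ⟨G, hG⟩ := (ψ.hasCompactSupport.fderiv (𝕜 := ℝ)).exists_bound_of_continuous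
    (hψ.continuous_fderiv one_ne_zero)
  let ε : ℕ → ℝ := fun n => 1 / ((n : ℝ) + 1)
  have hε0 : ∀ n, 0 < ε n := fun n => Nat.one_div_pos_of_nat
  have hεlim : Tendsto ε atTop (𝓝 0) := tendsto_one_div_add_atTop_nhds_zero_nat
  let χ : ℕ → Eucl m → ℝ := fun n a => ψ (ε n • a)
  have hχ : ∀ n, ContDiff ℝ 1 (χ n) := fun n => hψ.comp (contDiff_const_smul (ε n))
  have hχs : ∀ n, HasCompactSupport (χ n) := fun n =>
    ψ.hasCompactSupport.comp_homeomorph (Homeomorph.smulOfNeZero (ε n) (hε0 n).ne')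
  have hχd : ∀ n a, ‖fderiv ℝ (χ n) a‖ ≤ ε n * G := fun n a => by
    have h1 : HasFDerivAt (χ n) ((fderiv ℝ ψ (ε n • a)).comp
        (ε n • ContinuousLinearMap.id ℝ (Eucl m))) a :=
      (hψ.differentiable one_ne_zero (ε n • a)).hasFDerivAt.comp a
        ((hasFDerivAt_id a).const_smul (ε n))
    rw [h1.fderiv, ContinuousLinearMap.comp_smul, ContinuousLinearMap.comp_id, norm_smul,
      Real.norm_of_nonneg (hε0 n).le]
    exact mul_le_mul_of_nonneg_left (hG _) (hε0 n).le
  have hχlim : ∀ a, Tendsto (fun n => χ n a) atTop (𝓝 1) := fun a => by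
    have h1 : Tendsto (fun n => ψ (ε n • a)) atTop (𝓝 (ψ ((0 : ℝ) • a))) :=
      (ψ.continuous.tendsto _).comp (hεlim.smul_const a)
    rwa [zero_smul, ψ.one_of_mem_closedBall (by simp [ψ.rIn_pos.le])] at h1
  have hχ0 : ∀ n a, 0 ≤ χ n a := fun n a => ψ.nonneg
  have hχ1 : ∀ n a, χ n a ≤ 1 := fun n a => ψ.le_one
  have key := fun n => h.entropy_truncation_le hC hf hf0 hfi hJ (hχ n) (hχs n) (hχ0 n) (hχ1 n)
    (hχd n) (hε0 n)
  set F : ℕ → Eucl m → ℝ := fun n a => ε n + χ n a ^ 2 * f a with hF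
  have hFlim : ∀ a, Tendsto (fun n => F n a) atTop (𝓝 (f a)) := fun a => by
    have := hεlim.add (((hχlim a).pow 2).mul_const (f a))
    simpa using this
  have hMlim : Tendsto (fun n => ∫ a, F n a ∂μ) atTop (𝓝 1) := by
    rw [← hf1]
    refine tendsto_integral_of_dominated_convergence (fun a => 1 + f a)
      (fun n => ((continuous_const.add (((hχ n).continuous.pow 2).mul
        hf.continuous)).aestronglyMeasurable)) ((integrable_const 1).add hfi)
      (fun n => Eventually.of_forall fun a => ?_) (Eventually.of_forall hFlim)
    have h1 : χ n a ^ 2 * f a ≤ f a :=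
      mul_le_of_le_one_left (hf0 a) (pow_le_one₀ (hχ0 n a) (hχ1 n a))
    have h2 : 0 ≤ χ n a ^ 2 * f a := mul_nonneg (sq_nonneg _) (hf0 a)
    have h3 : ε n ≤ 1 := by
      simp only [ε]
      rw [div_le_one (by positivity)]
      linarith [(Nat.cast_nonneg n : (0 : ℝ) ≤ n)]
    rw [Real.norm_of_nonneg (add_nonneg (hε0 n).le h2)]
    exact add_le_add h3 h1
  have hge : ∀ x : ℝ, 0 ≤ x → 0 ≤ x * Real.log x + 1 := fun x hx => by
    rcases hx.eq_or_lt with h0 | h0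
    · rw [← h0]; simp
    · have := Real.one_sub_inv_le_log_of_pos h0
      have := mul_le_mul_of_nonneg_left this hx
      rw [mul_sub, mul_inv_cancel₀ h0.ne'] at this
      linarith
  have hF0 : ∀ n a, 0 ≤ F n a := fun n a =>
    add_nonneg (hε0 n).le (mul_nonneg (sq_nonneg _) (hf0 a))
  have hfatou : ∫⁻ a, ENNReal.ofReal (f a * Real.log (f a) + 1) ∂μ ≤
      ENNReal.ofReal (2 * C * ∫ a, J a ∂μ + 1) := by
    have hcont : ∀ {φ : Eucl m → ℝ}, Continuous φ →
        Measurable fun a => ENNReal.ofReal (φ a * Real.log (φ a) + 1) := fun hφ =>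
      ((Real.continuous_mul_log.comp hφ).add continuous_const).measurable.ennreal_ofReal
    have h1 : ∫⁻ a, ENNReal.ofReal (f a * Real.log (f a) + 1) ∂μ =
        ∫⁻ a, liminf (fun n => ENNReal.ofReal (F n a * Real.log (F n a) + 1)) atTop ∂μ := by
      refine lintegral_congr fun a => ?_
      have : Tendsto (fun n => ENNReal.ofReal (F n a * Real.log (F n a) + 1)) atTop
          (𝓝 (ENNReal.ofReal (f a * Real.log (f a) + 1))) :=
        (ENNReal.continuous_ofReal.tendsto _).comp
          (((Real.continuous_mul_log.tendsto _).comp (hFlim a)).add_const 1)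
      exact this.liminf_eq.symm
    rw [h1]
    refine (lintegral_liminf_le fun n => hcont
      (continuous_const.add (((hχ n).continuous.pow 2).mul hf.continuous))).trans ?_
    set B : ℕ → ℝ := fun n => (∫ a, F n a ∂μ) * Real.log (∫ a, F n a ∂μ) +
      C * (2 * ∫ a, J a ∂μ + 8 * (ε n * G) ^ 2 * ∫ a, f a ∂μ) + 1 with hB
    have hBlim : Tendsto B atTop (𝓝 (2 * C * ∫ a, J a ∂μ + 1)) := by
      have h2 := (Real.continuous_mul_log.tendsto _).comp hMlim
      have h3 := ((((((hεlim.mul_const G).pow 2).const_mul 8).mul_const (∫ a, f a ∂μ)).const_add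
        (2 * ∫ a, J a ∂μ)).const_mul C)
      have h4 := (h2.add h3).add_const 1
      refine (h4.congr fun n => rfl).trans (le_of_eq ?_)
      congr 1
      simp
      ring
    have h2 : ∀ n, ∫⁻ a, ENNReal.ofReal (F n a * Real.log (F n a) + 1) ∂μ ≤
        ENNReal.ofReal (B n) := fun n => by
      have hi : Integrable (fun a => F n a * Real.log (F n a) + 1) μ :=
        (key n).1.add (integrable_const 1)
      rw [← ofReal_integral_eq_lintegral_ofReal hi
        (Eventually.of_forall fun a => hge _ (hF0 n a))]
      refine ENNReal.ofReal_le_ofReal ?_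
      have h5 : Integrable (fun a => F n a * Real.log (F n a)) μ := (key n).1
      rw [integral_add h5 (integrable_const 1)]
      have := (key n).2
      simp only [integral_const, probReal_univ, smul_eq_mul, mul_one, hB]
      linarith
    refine (liminf_le_liminf (Eventually.of_forall h2)).trans (le_of_eq ?_)
    exact ((ENNReal.continuous_ofReal.tendsto _).comp hBlim).liminf_eq
  have hcf : Continuous fun a => f a * Real.log (f a) :=
    Real.continuous_mul_log.comp hf.continuous
  have hint1 : Integrable (fun a => f a * Real.log (f a) + 1) μ := by
    refine ⟨(hcf.add continuous_const).aestronglyMeasurable, ?_⟩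
    rw [hasFiniteIntegral_iff_ofReal (Eventually.of_forall fun a => hge _ (hf0 a))]
    exact hfatou.trans_lt ENNReal.ofReal_lt_top
  have hint : Integrable (fun a => f a * Real.log (f a)) μ :=
    (hint1.sub (integrable_const 1)).congr (Eventually.of_forall fun a => by simp)
  refine ⟨hint, ?_⟩
  rw [← ofReal_integral_eq_lintegral_ofReal hint1 (Eventually.of_forall fun a => hge _ (hf0 a)),
    ENNReal.ofReal_le_ofReal_iff (by positivity), integral_add hint (integrable_const 1)] at hfatou
  simp only [integral_const, probReal_univ, smul_eq_mul, mul_one] at hfatou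
  linarith

end LogSobolev

/-! ### Log-Sobolev inequality for quartically confined potentials. -/

section Gibbs

variable {m : ℕ}

theorem strongConvex_of_convexOn {c : ℝ} {g : Eucl m → ℝ} (hg : ConvexOn ℝ univ g) {s t : ℝ}
    (hs : 0 < s) (ht : 0 < t) (hst : s + t = 1) (x y : Eucl m) :
    g (t • x + s • y) + c / 2 * ‖t • x + s • y‖ ^ 2 + c / 2 * (t * s) * ‖x - y‖ ^ 2 ≤
      t * (g x + c / 2 * ‖x‖ ^ 2) + s * (g y + c / 2 * ‖y‖ ^ 2) := by
  have h1 := hg.2 (mem_univ x) (mem_univ y) ht.le hs.le (by rw [add_comm, hst])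
  have h2 : ‖t • x + s • y‖ ^ 2 = t * ‖x‖ ^ 2 + s * ‖y‖ ^ 2 - t * s * ‖x - y‖ ^ 2 := by
    rw [norm_add_sq_real, norm_sub_sq_real, norm_smul, norm_smul, inner_smul_left,
      inner_smul_right, Real.norm_of_nonneg ht.le, Real.norm_of_nonneg hs.le]
    obtain rfl : t = 1 - s := by linarith
    simp
    ring
  rw [h2]
  simp only [smul_eq_mul] at h1
  linarith

theorem convexOn_max_norm_sq (s₀ : ℝ) :
    ConvexOn ℝ univ fun a : Eucl m => max (‖a‖ ^ 2 - s₀) 0 ^ 2 := by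
  have h1 : ConvexOn ℝ univ fun a : Eucl m => ‖a‖ ^ 2 :=
    convexOn_univ_norm.pow (fun a _ => norm_nonneg a) 2
  have h2 : ConvexOn ℝ univ fun a : Eucl m => max (‖a‖ ^ 2 - s₀) 0 :=
    (h1.sub (concaveOn_const s₀ convex_univ)).sup (convexOn_const 0 convex_univ)
  exact h2.pow (fun a _ => le_max_right _ _) 2

/-- The log-Sobolev constant for a potential whose Hessian is bounded from below by
`c (1 + |a|²) - N (1 + |a|)`. -/
def gibbsConstant (c N : ℝ) : ℝ :=
  2 * (Real.exp (3 * (N * (1 + 3 * N / (2 * c))) ^ 2 / (2 * c)) ^ 2 * (1 / c))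

theorem gibbsConstant_pos {c N : ℝ} (hc : 0 < c) : 0 < gibbsConstant c N := by
  unfold gibbsConstant; positivity

theorem gibbsConstant_mono {c N N' : ℝ} (hc : 0 < c) (hN : 0 ≤ N) (h : N ≤ N') :
    gibbsConstant c N ≤ gibbsConstant c N' := by
  have := hN.trans h
  unfold gibbsConstant
  gcongr

/-- Up to a convex function, `ℓ + W` is `c / 2 |a|² + c / 24 |a|⁴ - M / 2 |a|²`, half of the quartic
part of `ℓ` having been spent on `W`. Completing the square, the last two terms are `c / 24 (|a|² -
s₀)² - δ`. The part of the square outside the ball `|a|² ≤ s₀` is convex; the part inside lies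
between 0 and `δ`. So the potential differs from a strongly convex one by at most `δ`. -/
theorem integrable_and_logSobolev_tilted {ℓ W : Eucl m → ℝ} {c N : ℝ} (hc : 0 < c) (hN : 0 < N)
    (hℓ : ConvexOn ℝ univ fun a => ℓ a - c / 2 * ‖a‖ ^ 2 - c / 12 * ‖a‖ ^ 4)
    (hW : ConvexOn ℝ univ fun a => W a + N *
      ((1 + 1 / (4 * (c / (6 * N)))) / 2 * ‖a‖ ^ 2 + c / (6 * N) / 4 * ‖a‖ ^ 4)) :
    Integrable (fun a => Real.exp (-ℓ a - W a)) ∧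
      LogSobolev (volume.tilted fun a => -ℓ a - W a) (gibbsConstant c N) := by
  set M := N * (1 + 3 * N / (2 * c)) with hM
  have hM0 : 0 < M := by positivity
  set s₀ := 6 * M / c with hs₀
  have hs₀0 : 0 < s₀ := by positivity
  set δ := 3 * M ^ 2 / (2 * c) with hδ
  have hδs : c / 24 * s₀ ^ 2 = δ := by rw [hδ, hs₀]; field_simp; ring
  let g : Eucl m → ℝ := fun a => (ℓ a - c / 2 * ‖a‖ ^ 2 - c / 12 * ‖a‖ ^ 4) + (W a + N *
      ((1 + 1 / (4 * (c / (6 * N)))) / 2 * ‖a‖ ^ 2 + c / (6 * N) / 4 * ‖a‖ ^ 4)) +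
      c / 24 * max (‖a‖ ^ 2 - s₀) 0 ^ 2
  have hg : ConvexOn ℝ univ g :=
    (hℓ.add hW).add ((convexOn_max_norm_sq s₀).smul (by positivity : 0 ≤ c / 24))
  let U : Eucl m → ℝ := fun a => g a + c / 2 * ‖a‖ ^ 2
  let V : Eucl m → ℝ := fun a => ℓ a + W a
  have hUV : ∀ a, V a = U a + c / 24 * max (s₀ - ‖a‖ ^ 2) 0 ^ 2 - δ := by
    intro a
    have e1 : N * ((1 + 1 / (4 * (c / (6 * N)))) / 2 * ‖a‖ ^ 2 + c / (6 * N) / 4 * ‖a‖ ^ 4) =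
        M / 2 * ‖a‖ ^ 2 + c / 24 * (‖a‖ ^ 2) ^ 2 := by
      rw [hM]; field_simp; ring
    have e2 : c / 24 * (max (‖a‖ ^ 2 - s₀) 0 ^ 2 + max (s₀ - ‖a‖ ^ 2) 0 ^ 2) =
        c / 24 * (‖a‖ ^ 2) ^ 2 - M / 2 * ‖a‖ ^ 2 + δ := by
      have : max (‖a‖ ^ 2 - s₀) 0 ^ 2 + max (s₀ - ‖a‖ ^ 2) 0 ^ 2 = (‖a‖ ^ 2 - s₀) ^ 2 := by
        rcases le_total (‖a‖ ^ 2) s₀ with h | h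
        · rw [max_eq_right (by linarith), max_eq_left (by linarith)]; ring
        · rw [max_eq_left (by linarith), max_eq_right (by linarith)]; ring
      rw [this, ← hδs, hs₀]
      field_simp; ring
    simp only [V, U, g, e1]
    linear_combination -e2
  have hVU : ∀ a, V a ≤ U a := fun a => by
    have h1 : max (s₀ - ‖a‖ ^ 2) 0 ^ 2 ≤ s₀ ^ 2 :=
      pow_le_pow_left₀ (le_max_right _ _) (max_le (by linarith [sq_nonneg ‖a‖]) hs₀0.le) 2
    have h2 := mul_le_mul_of_nonneg_left h1 (by positivity : 0 ≤ c / 24)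
    linarith [hUV a]
  have hUV' : ∀ a, U a ≤ V a + δ := fun a => by
    have : 0 ≤ c / 24 * max (s₀ - ‖a‖ ^ 2) 0 ^ 2 := by positivity
    linarith [hUV a]
  have hgc : Continuous g := continuousOn_univ.1 (hg.continuousOn isOpen_univ)
  have hUc : Continuous U := by fun_prop
  have hVc : Continuous V := by
    have : V = fun a => U a + c / 24 * max (s₀ - ‖a‖ ^ 2) 0 ^ 2 - δ := funext hUV
    rw [this]; fun_prop
  have hUi : Integrable fun a => Real.exp (-U a) := integrable_exp_neg_of_convexOn (half_pos hc) hg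
  have hVi : Integrable fun a => Real.exp (-V a) := by
    refine (hUi.const_mul (Real.exp δ)).mono' (by fun_prop) (Eventually.of_forall fun a => ?_)
    rw [Real.norm_of_nonneg (Real.exp_nonneg _), ← Real.exp_add]
    exact Real.exp_le_exp.2 (by linarith [hUV' a])
  have e : (fun a => -ℓ a - W a) = fun a => -V a := by ext a; simp only [V]; ring
  have hmu := compactLogSobolev_of_strongConvex (U := U) (half_pos hc) hUc hUi
    fun s t hs ht hst x y => strongConvex_of_convexOn hg hs ht hst x y
  have hV := hmu.of_bounded_perturbation hUc hVc hUi hVi hVU hUV' (by positivity)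
  have hprob : IsProbabilityMeasure ((volume : Measure (Eucl m)).tilted fun a => -V a) :=
    isProbabilityMeasure_tilted hVi
  have e' : (fun a => Real.exp (-ℓ a - W a)) = fun a => Real.exp (-V a) := by
    ext a; rw [congrFun e a]
  rw [e, e']
  refine ⟨hVi, ?_⟩
  have := hV.logSobolev (by positivity)
  have h2 : 2 * (c / 2) = c := by ring
  rwa [h2] at this

end Gibbs

/-! ### Existence and uniqueness for the transport equation with a control. -/

section Solutions

variable {d₁ d₂ m : ℕ} {b : Eucl d₁ → Eucl m → Eucl d₁} {L : Eucl d₁ × Eucl d₂ → ℝ}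
  {C K t₀ T : ℝ} {μ : ℝ → Measure (Eucl m)}

theorem abs_integral_fieldKernelTwo_le (hC : 0 ≤ C) (hμ : IsControlFlow μ) {s t : ℝ}
    (hs : s ∈ Icc t₀ T) (ht : t ∈ Icc t₀ T) :
    |∫ r in s..t, fieldKernelTwo C μ r| ≤ 2 * C *
      (Real.sqrt (T - t₀) + 1 + ∫ r, ∫ a, (1 + ‖a‖ ^ 4) ∂(μ r)) * Real.sqrt |t - s| := by
  wlog hst : s ≤ t generalizing s t
  · rw [intervalIntegral.integral_symm, abs_neg, abs_sub_comm]
    exact this ht hs (le_of_not_ge hst)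
  rw [abs_of_nonneg (sub_nonneg.2 hst), abs_of_nonneg (intervalIntegral.integral_nonneg hst
    fun r _ => FieldBounds.fieldKernelTwo_nonneg hC r)]
  refine (FieldBounds.integral_fieldKernelTwo_le hC hμ hst).trans ?_
  have h1 : Real.sqrt (t - s) ≤ Real.sqrt (T - t₀) :=
    Real.sqrt_le_sqrt (by linarith [hs.1, ht.2])
  have h2 := mul_le_mul_of_nonneg_left h1
    (mul_nonneg (mul_nonneg two_pos.le hC) (Real.sqrt_nonneg (t - s)))
  linarith

/-- The cost transported along the characteristics solves the transport equation. -/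
theorem solvesTransport_transported (hb : FieldBounds b C) (hL : CostBounds L K)
    (hμ : IsControlFlow μ) :
    SolvesTransport b L t₀ T μ (transported (fun t x => avg b x (μ t)) L T) := by
  have hf := hb.isSmoothCaratheodory hμ
  have hfk := hb.norm_avg_le hμ
  have hu : IsHolderCurve t₀ T (transported (fun t x => avg b x (μ t)) L T) :=
    hf.isHolderCurve_transported hfk hL
      (fun _ _ => (FieldBounds.integrable_fieldKernelTwo hb.nonneg hμ).intervalIntegrable)
      (hb.norm_avg_le_two hμ) (hb.norm_avgDeriv_le_two hμ)
      fun s hs t ht => abs_integral_fieldKernelTwo_le hb.nonneg hμ hs ht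
  refine ⟨hu.mem, hu.holder, fun t ht z => ?_⟩
  have := hf.toIsCaratheodory.integral_inner_gradX hfk hu (fun s t x y => by
    simp only [transported]
    rw [hf.toIsCaratheodory.flow_flow]) ht z
  rw [this, transported, hf.toIsCaratheodory.flow_self]

/-- Uniqueness for the transport equation. -/
theorem SolvesTransport.eq_transported (hb : FieldBounds b C) (hμ : IsControlFlow μ)
    {u : ℝ → Eucl d₁ × Eucl d₂ → ℝ} (hu : SolvesTransport b L t₀ T μ u) {t : ℝ}
    (ht : t ∈ Icc t₀ T) : u t = transported (fun t x => avg b x (μ t)) L T t := by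
  have hf := (hb.isSmoothCaratheodory hμ).toIsCaratheodory
  have hT : T ∈ Icc t₀ T := right_mem_Icc.2 (ht.1.trans ht.2)
  ext ⟨x, y⟩
  rw [transported, ← hf.eq_comp_flow hu.isHolderCurve ?_ ht x y, hu.eqn T hT]
  · simp
  intro s hs r hr z
  rw [hu.eqn s hs z, hu.eqn r hr z, add_sub_add_left_eq_sub, sub_eq_iff_eq_add]
  exact (intervalIntegral.integral_add_adjacent_intervals
    (hf.intervalIntegrable_inner_gradX hu.isHolderCurve z hs hr)
    (hf.intervalIntegrable_inner_gradX hu.isHolderCurve z hr hT)).symm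

end Solutions

/-! ### Explicit constants in terms of the moments of the data. -/

section Constants

variable {d₁ d₂ m : ℕ}

/-- A bound for the integral in time of the Lipschitz constant of the averaged field. -/
def kernelBound (C T r : ℝ) : ℝ := 2 * C * (T + r)

/-- A bound for the Hessian of the potential of the Gibbs measure, in terms of the moments of the
data. -/
def interactionBound (C K T ε r : ℝ) : ℝ :=
  ε⁻¹ * (C * (3 * (2 * Real.exp (2 * kernelBound C T r) * K * (1 + kernelBound C T r)) *
    (2 * (4 * (1 + r)) * Real.exp (12 * kernelBound C T r)))) + 1

/-- The summand 1 in the definition ensures strict positivity even if `C` or `K` vanishes; it is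
needed because the bound is later used as a denominator. -/
theorem interactionBound_pos {C K T ε r : ℝ} (hC : 0 ≤ C) (hK : 0 ≤ K) (hT : 0 ≤ T) (hε : 0 < ε)
    (hr : 0 ≤ r) : 0 < interactionBound C K T ε r := by
  unfold interactionBound kernelBound; positivity

theorem interactionBound_mono {C K T ε r s : ℝ} (hC : 0 ≤ C) (hK : 0 ≤ K) (hT : 0 ≤ T)
    (hε : 0 < ε) (hr : 0 ≤ r) (hrs : r ≤ s) :
    interactionBound C K T ε r ≤ interactionBound C K T ε s := by
  have hs := hr.trans hrs
  unfold interactionBound kernelBound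
  gcongr

theorem one_add_sq_mul_le_bracket (z : Eucl d₁ × Eucl d₂) :
    (1 + ‖z.1‖ ^ 2) * (1 + ‖z.1‖ + ‖z.2‖) ≤ 3 * bracket z ^ 3 := by
  have h1 := one_le_bracket z
  have h2 := norm_fst_le_bracket z
  have h3 := norm_snd_le_bracket z
  have h4 : 1 + ‖z.1‖ ^ 2 ≤ bracket z ^ 2 := by
    rw [bracket_sq]; linarith [sq_nonneg ‖z.2‖]
  calc _ ≤ bracket z ^ 2 * (3 * bracket z) := by
        gcongr; linarith
    _ = _ := by ring

/-- The interaction potential is integrable and bounded by the third moment of the state. -/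
theorem FieldBounds.integrable_inner {b : Eucl d₁ → Eucl m → Eucl d₁} {C M : ℝ}
    (hb : FieldBounds b C) {γ : Measure (Eucl d₁ × Eucl d₂)} {p : Eucl d₁ × Eucl d₂ → Eucl d₁}
    (hγ : Integrable (fun z => bracket z ^ 3) γ) (hp : Continuous p)
    (hpM : ∀ z, ‖p z‖ ≤ M * (1 + ‖z.1‖ + ‖z.2‖)) :
    (∀ a, Integrable (fun z => inner ℝ (b z.1 a) (p z)) γ) ∧
    Integrable (fun z => (1 + ‖z.1‖ ^ 2) * ‖p z‖) γ ∧
    ∫ z, (1 + ‖z.1‖ ^ 2) * ‖p z‖ ∂γ ≤ 3 * M * ∫ z, bracket z ^ 3 ∂γ := by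
  have hM0 : 0 ≤ M := by simpa using (norm_nonneg _).trans (hpM 0)
  have hle : ∀ z : Eucl d₁ × Eucl d₂, (1 + ‖z.1‖ ^ 2) * ‖p z‖ ≤ 3 * M * bracket z ^ 3 :=
    fun z => by
    have h1 := mul_le_mul_of_nonneg_left (hpM z) (by positivity : 0 ≤ 1 + ‖z.1‖ ^ 2)
    have h2 := mul_le_mul_of_nonneg_left (one_add_sq_mul_le_bracket z) hM0
    linarith
  have hi : Integrable (fun z => (1 + ‖z.1‖ ^ 2) * ‖p z‖) γ := by
    refine (hγ.const_mul (3 * M)).mono' (by fun_prop) (Eventually.of_forall fun z => ?_)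
    rw [Real.norm_of_nonneg (by positivity)]
    exact hle z
  refine ⟨fun a => ?_, hi, ?_⟩
  · have hba : Continuous fun z : Eucl d₁ × Eucl d₂ => b z.1 a :=
      (hb.differentiable_left a).continuous.comp continuous_fst
    refine (hi.const_mul (C * (1 + ‖a‖))).mono' (hba.inner hp).aestronglyMeasurable
      (Eventually.of_forall fun z => (norm_inner_le_norm _ _).trans ?_)
    have h1 := mul_le_mul_of_nonneg_right (hb.bound z.1 a) (norm_nonneg (p z))
    have h2 := mul_nonneg (mul_nonneg hb.nonneg (by positivity : 0 ≤ 1 + ‖a‖))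
      (mul_nonneg (sq_nonneg ‖z.1‖) (norm_nonneg (p z)))
    linarith
  · rw [← integral_const_mul]
    exact integral_mono hi (hγ.const_mul _) hle

end Constants

/-! ### Assembling the estimates. -/

section Main

variable {d₁ d₂ m : ℕ} {b : Eucl d₁ → Eucl m → Eucl d₁} {L : Eucl d₁ × Eucl d₂ → ℝ}
  {ℓ : Eucl m → ℝ} {C K c ε t₀ T r : ℝ} {μ : ℝ → Measure (Eucl m)}

/-- The Gibbs measure satisfies a log-Sobolev inequality when the interaction is bounded. -/
theorem FieldBounds.logSobolev_gibbs (hb : FieldBounds b C) (hc : 0 < c) (hε : 0 < ε)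
    (hℓ : ConvexOn ℝ univ fun a => ℓ a - c / 2 * ‖a‖ ^ 2 - c / 12 * ‖a‖ ^ 4)
    {γ : Measure (Eucl d₁ × Eucl d₂)} {v : Eucl d₁ × Eucl d₂ → ℝ}
    (hp : ∀ a, Integrable (fun z => inner ℝ (b z.1 a) (gradX v z)) γ)
    (hp2 : Integrable (fun z => (1 + ‖z.1‖ ^ 2) * ‖gradX v z‖) γ) {N : ℝ} (hN0 : 0 < N)
    (hN : ε⁻¹ * (C * ∫ z, (1 + ‖z.1‖ ^ 2) * ‖gradX v z‖ ∂γ) ≤ N) :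
    IsProbabilityMeasure (gibbs b ℓ ε γ v) ∧ LogSobolev (gibbs b ℓ ε γ v) (gibbsConstant c N) := by
  -- After division by `ε`, the choice `β = c / (6 * N)` gives the interaction the quartic
  -- coefficient `c / 24`, half of the `c / 12` supplied by `ℓ`.
  have hW := (hb.convexOn_integral_inner hp hp2 (β := c / (6 * N)) (by positivity) (N := ε * N)
    ((inv_mul_le_iff₀ hε).1 hN)).smul (inv_nonneg.2 hε.le)
  have h := integrable_and_logSobolev_tilted (W := fun a => ε⁻¹ * ∫ z, inner ℝ (b z.1 a)
    (gradX v z) ∂γ) hc hN0 hℓ (hW.congr fun a _ => by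
      simp only [smul_eq_mul]
      rw [mul_add, mul_assoc ε, inv_mul_cancel_left₀ hε.ne'])
  exact ⟨isProbabilityMeasure_tilted h.1, h.2⟩

/-- Integrability of the interaction and its bound along a solution. -/
theorem interaction_le (hb : FieldBounds b C) (hL : CostBounds L K) (hμ : IsControlFlow μ)
    {γ₀ : Measure (Eucl d₁ × Eucl d₂)} (hγ₀ : IsPp 3 γ₀)
    {γ : ℝ → Measure (Eucl d₁ × Eucl d₂)} {u : ℝ → Eucl d₁ × Eucl d₂ → ℝ}
    (hγ : SolvesContinuity b t₀ T γ₀ μ γ) (hu : SolvesTransport b L t₀ T μ u) (hε : 0 < ε)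
    (hr : ∫ s, ∫ a, (1 + ‖a‖ ^ 4) ∂(μ s) ≤ T + r) (hr' : ∫ z, normPow 3 z ∂γ₀ ≤ r) {t : ℝ}
    (ht : t ∈ Icc t₀ T) :
    (∀ a, Integrable (fun z => inner ℝ (b z.1 a) (gradX (u t) z)) (γ t)) ∧
    Integrable (fun z => (1 + ‖z.1‖ ^ 2) * ‖gradX (u t) z‖) (γ t) ∧
    ε⁻¹ * (C * ∫ z, (1 + ‖z.1‖ ^ 2) * ‖gradX (u t) z‖ ∂(γ t)) ≤ interactionBound C K T ε r := by
  have hf := hb.isSmoothCaratheodory hμ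
  have hfk := hb.norm_avg_le hμ
  have hC := hb.nonneg
  have hK := hL.nonneg
  have hp₀ := hγ₀.1
  set k := fieldKernel C μ with hk
  set κ := ∫ s, k s with hκ
  have hκ0 : 0 ≤ κ := integral_nonneg hf.nonneg
  have hκle : κ ≤ kernelBound C T r := by
    rw [hκ, hk]
    simp only [fieldKernel]
    rw [integral_const_mul]
    exact mul_le_mul_of_nonneg_left hr (by positivity)
  obtain ⟨hB, hBle⟩ := hγ.integral_bracket_le hf.integrable hf.nonneg hfk hγ₀ ht
  have hdiff := hu.isHolderCurve.contDiff ht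
  -- Uniqueness identifies the given solution with the transported cost, for which the gradient
  -- bound is explicit.
  have hgrad : ∀ z, ‖gradX (u t) z‖ ≤
      2 * totalWeight k * K * (1 + κ) * (1 + ‖z.1‖ + ‖z.2‖) := fun z => by
    refine (norm_gradX_le (hdiff.differentiable one_ne_zero z)).trans ?_
    rw [hu.eq_transported hb hμ ht]
    exact hf.norm_fderiv_transported_le hfk hL t z
  obtain ⟨h1, h2, h3⟩ := hb.integrable_inner hB (continuous_gradX hdiff) hgrad
  refine ⟨h1, h2, ?_⟩
  have hB0 : ∫ z, bracket z ^ 3 ∂γ₀ ≤ 4 * (1 + r) := by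
    calc ∫ z, bracket z ^ 3 ∂γ₀ ≤ ∫ z, 4 * (1 + normPow 3 z) ∂γ₀ :=
          integral_mono (integrable_bracket_pow_three hγ₀)
            (((integrable_const 1).add hγ₀.2).const_mul 4) bracket_pow_three_le
      _ = 4 * (1 + ∫ z, normPow 3 z ∂γ₀) := by
          rw [integral_const_mul, integral_add (integrable_const 1) hγ₀.2]; simp
      _ ≤ _ := by linarith
  have hI0 : 0 ≤ ∫ z, bracket z ^ 3 ∂γ₀ := integral_nonneg fun z => by
    have := one_le_bracket z; positivity
  have hIt : 0 ≤ ∫ z, bracket z ^ 3 ∂(γ t) := integral_nonneg fun z => by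
    have := one_le_bracket z; positivity
  have hBt : ∫ z, bracket z ^ 3 ∂(γ t) ≤
      2 * (4 * (1 + r)) * Real.exp (12 * kernelBound C T r) := by
    refine hBle.trans ?_
    have hr0 : 0 ≤ r := (integral_nonneg fun z => normPow_nonneg 3 z).trans hr'
    gcongr
  have hMle : 2 * totalWeight k * K * (1 + κ) ≤
      2 * Real.exp (2 * kernelBound C T r) * K * (1 + kernelBound C T r) := by
    rw [totalWeight, ← hκ]
    gcongr
  have hw := totalWeight_pos k
  -- The bound is the product of the gradient constant, the third moment at time `t`, and the factor
  -- 3 relating the weight `(1 + |x|²) (1 + |x| + |y|)` to the cubed bracket.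
  unfold interactionBound
  refine le_trans ?_ (le_add_of_nonneg_right zero_le_one)
  refine mul_le_mul_of_nonneg_left (mul_le_mul_of_nonneg_left (h3.trans ?_) hC)
    (inv_nonneg.2 hε.le)
  exact mul_le_mul (mul_le_mul_of_nonneg_left hMle (by norm_num)) hBt hIt
    (by have := hκ0.trans hκle; positivity)

end Main

end MeanFieldResNet

end

theorem mainTheorem8 {d₁ d₂ m : ℕ} (hd₁ : 1 ≤ d₁) (hd₂ : 1 ≤ d₂) (hm : 1 ≤ m)
    (b : MeanFieldResNet.Eucl d₁ → MeanFieldResNet.Eucl m → MeanFieldResNet.Eucl d₁)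
    (ℓ : MeanFieldResNet.Eucl m → ℝ)
    (L : MeanFieldResNet.Eucl d₁ × MeanFieldResNet.Eucl d₂ → ℝ)
    (hreg : MeanFieldResNet.Regularity b ℓ L)
    (T ε : ℝ) (hT : 0 < T) (hε : 0 < ε) :
    ∃ Λ : ℝ → ℝ, MonotoneOn Λ (Set.Ici 0) ∧ (∀ r, 0 ≤ r → 0 ≤ Λ r) ∧
      ∀ t₀ ∈ Set.Icc 0 T,
      ∀ γ₀ : MeasureTheory.Measure (MeanFieldResNet.Eucl d₁ × MeanFieldResNet.Eucl d₂),
      MeanFieldResNet.IsPp 3 γ₀ →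
      ∀ ν : ℝ → MeasureTheory.Measure (MeanFieldResNet.Eucl m),
      MeanFieldResNet.Admissible ℓ t₀ T ν →
        (∃ γ u, MeanFieldResNet.SolvesContinuity b t₀ T γ₀ ν γ ∧
          MeanFieldResNet.SolvesTransport b L t₀ T ν u) ∧
        ∀ γ u, MeanFieldResNet.SolvesContinuity b t₀ T γ₀ ν γ →
          MeanFieldResNet.SolvesTransport b L t₀ T ν u →
          (∀ t ∈ Set.Icc t₀ T,
            (∀ a, MeasureTheory.Integrable
              (fun z => inner ℝ (b z.1 a) (MeanFieldResNet.gradX (u t) z)) (γ t)) ∧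
            MeasureTheory.IsProbabilityMeasure (MeanFieldResNet.gibbs b ℓ ε (γ t) (u t))) ∧
          ∃ C : ℝ, 0 < C ∧
            (∀ t ∈ Set.Icc t₀ T,
              MeanFieldResNet.LogSobolev (MeanFieldResNet.gibbs b ℓ ε (γ t) (u t)) C) ∧
            C ≤ Λ ((∫ z, MeanFieldResNet.normPow 3 z ∂γ₀) +
              ∫ t in t₀..T, ∫ a, ‖a‖ ^ 4 ∂(ν t)) := by
  open MeanFieldResNet MeasureTheory Set in
  obtain ⟨C, hb⟩ := hreg.exists_fieldBounds
  obtain ⟨K, hL⟩ := hreg.exists_costBounds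
  obtain ⟨c, hc, hhess⟩ := hreg.ell_hessian
  have hconv := convexOn_prior_potential hreg.ell_contDiff hhess hc.le
  -- The log-Sobolev constant chosen below is the value of this function at the moments, so the
  -- final comparison is an equality.
  refine ⟨fun r => gibbsConstant c (interactionBound C K T ε r), fun r hr s _ hrs => ?_,
    fun r _ => (gibbsConstant_pos hc).le, fun t₀ ht₀ γ₀ hγ₀ ν hν => ?_⟩
  · exact gibbsConstant_mono hc (interactionBound_pos hb.nonneg hL.nonneg hT.le hε hr).le
      (interactionBound_mono hb.nonneg hL.nonneg hT.le hε hr hrs)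
  obtain ⟨μ, hμ, hνμ, hmom⟩ := hν.exists_isControlFlow hreg.ell_contDiff.continuous ht₀.2 hc hconv
  have hμν : ∀ᵐ r, r ∈ Icc t₀ T → μ r = ν r := hνμ.mono fun r hr h => (hr h).symm
  have hA : 0 ≤ ∫ t in t₀..T, ∫ a, ‖a‖ ^ 4 ∂(ν t) :=
    intervalIntegral.integral_nonneg ht₀.2 fun t _ => integral_nonneg fun a => by positivity
  have hG : 0 ≤ ∫ z, normPow 3 z ∂γ₀ := integral_nonneg fun z => normPow_nonneg 3 z
  refine ⟨⟨_, _, (solvesContinuity_map (IsPp.two_of_three hγ₀)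
    (hb.isSmoothCaratheodory hμ).toIsCaratheodory (hb.norm_avg_le hμ)).congr hμν,
    (solvesTransport_transported hb hL hμ).congr hμν⟩, fun γ u hγ hu => ?_⟩
  set r := (∫ z, normPow 3 z ∂γ₀) + ∫ t in t₀..T, ∫ a, ‖a‖ ^ 4 ∂(ν t) with hr
  have hr0 : 0 ≤ r := add_nonneg hG hA
  -- The mass contributes `T - t₀ ≤ T` to the integrated moment, so the bound does not depend on
  -- `t₀`.
  have key := fun t (ht : t ∈ Icc t₀ T) => interaction_le (r := r) hb hL hμ hγ₀ (hγ.congr hνμ)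
    (hu.congr hνμ) hε (by rw [hmom]; linarith [ht₀.1]) (by linarith) ht
  have hgibbs := fun t (ht : t ∈ Icc t₀ T) => hb.logSobolev_gibbs hc hε hconv (key t ht).1
    (key t ht).2.1 (interactionBound_pos hb.nonneg hL.nonneg hT.le hε hr0) (key t ht).2.2
  exact ⟨fun t ht => ⟨(key t ht).1, (hgibbs t ht).1⟩, _, gibbsConstant_pos hc,
    fun t ht => (hgibbs t ht).2, le_rfl⟩
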